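/- **Conventions.** Let $\lambda$ be a partition and $n\ge|\lambda|$. Tableaux are drawn in French notation, $\mathsf{SSYT}(\lambda)_n$ (resp. $\mathsf{SYT}(\lambda)$) is the set of semistandard tableaux of shape $\lambda$ with entries in $\{1,\dots,n\}$ (resp. of standard tableaux of shape $\lambda$), $\mathsf{row}(b)$ is the row reading word (rows read left to right, top row first), $\mathsf{std}(b)$ is the standardization of $b$, and $P(w)$ is the RSK insertion tableau of a word $w$. The crystal operator $f_i$ acts on $b\in\mathsf{SSYT}(\lambda)_n$ through $\mathsf{row}(b)$: successively bracket each letter $i+1$ with a letter $i$ to its right, and change the rightmost unbracketed $i$ into $i+1$ ($f_i(b)=\emptyset$ if there is none). The *crystal skeleton* $\mathsf{CS}(\lambda)$ is the directed graph with vertex set $\mathsf{SYT}(\lambda)$ in which there is an edge $T\to T'$, for $T\ne T'$, if there are $b,b'\in\mathsf{SSYT}(\lambda)_n$ and $1\le i<n$ with $\mathsf{std}(b)=T$, $\mathsf{std}(b')=T'$ and $f_i(b)=b'$. (It does not depend on the choice of $n\ge|\lambda|$.) Its edges are labeled by Dyck pattern intervals: $I=[i,i+2m]\subseteq[1,|\lambda|]$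 with $m\ge1$ is a *Dyck pattern interval* of $T\in\mathsf{SYT}(\lambda)$ if the insertion tableau of the subword of $\mathsf{row}(T)$ consisting of the letters in $I$ has bottom row $i,i+1,\dots,i+m$ and second row $i+m+1,\dots,i+2m$. The edge leaving $T$ with label $I$ goes to $\mathsf{std}(f_i(b))$, where $b$ is obtained from $T$ by replacing the letters in $[i,i+m]$ by $i$ and the letters in $[i+m+1,i+2m]$ by $i+1$. We write $T\xrightarrow{I}T'$. For $T\in\mathsf{SYT}(\lambda)$ and an interval $[a,b]$, let $T_{[a,b]}$ be the skew tableau formed by the entries of $T$ in $[a,b]$, and let $\mathsf{jdt}(T_{[a,b]})$ be its jeu de taquin straightening. For an interval $I=[i,j]$ put $I+c=[i+c,j+c]$. **Theorem (self-similarity).** Let $T\in\mathsf{SYT}(\lambda)$, let $1\le a\le b\le|\lambda|$, and let $\mu=\mathsf{shape}(\mathsf{jdt}(T_{[a,b]}))$. Then $\mathsf{CS}(\mu)$ is isomorphic to a subgraph of $\mathsf{CS}(\lambda)$ that contains the vertex $T$, with the edge labels shifted by $a-1$. Precisely, there is an injective map $\psi:\mathsf{SYT}(\mu)\to\mathsf{SYT}(\lambda)$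 with $T$ in its image such that for all $S,S'\in\mathsf{SYT}(\mu)$: 1. if $S\to S'$ is an edge of $\mathsf{CS}(\mu)$, then $\psi(S)\to\psi(S')$ is an edge of $\mathsf{CS}(\lambda)$; 2. for every interval $I\subseteq[1,|\mu|]$, $S\xrightarrow{I}S'$ is an edge of $\mathsf{CS}(\mu)$ if and only if $\psi(S)\xrightarrow{I+a-1}\psi(S')$ is an edge of $\mathsf{CS}(\lambda)$. **Corollary (direct products).** Let $T\in\mathsf{SYT}(\lambda)$, let $N>0$, let $[a_1,b_1],\dots,[a_N,b_N]\subseteq[1,|\lambda|]$ be nonempty, pairwise disjoint intervals, and let $\mu_k=\mathsf{shape}(\mathsf{jdt}(T_{[a_k,b_k]}))$ for $1\le k\le N$. Then the Cartesian product $\mathsf{CS}(\mu_1)\times\cdots\times\mathsf{CS}(\mu_N)$ (whose edges change exactly one coordinate $k$, along an edge of $\mathsf{CS}(\mu_k)$) is isomorphic to a subgraph of $\mathsf{CS}(\lambda)$ that contains the vertex $T$, with the labels of the edges in direction $k$ shifted by $a_k-1$. Precisely, there is an injective map $\psi:\mathsf{SYT}(\mu_1)\times\cdots\times\mathsf{SYT}(\mu_N)\to\mathsf{SYT}(\lambda)$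 with $T$ in its image such that for all $S=(S_1,\dots,S_N)$, $S'=(S'_1,\dots,S'_N)$ and all $k$: 1. if $S_k\to S'_k$ is an edge of $\mathsf{CS}(\mu_k)$ and $S'_l=S_l$ for all $l\ne k$, then $\psi(S)\to\psi(S')$ is an edge of $\mathsf{CS}(\lambda)$; 2. for every interval $I\subseteq[1,|\mu_k|]$, one has $S_k\xrightarrow{I}S'_k$ in $\mathsf{CS}(\mu_k)$ and $S'_l=S_l$ for all $l\ne k$ if and only if $\psi(S)\xrightarrow{I+a_k-1}\psi(S')$ is an edge of $\mathsf{CS}(\lambda)$. -/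

import Mathlib

namespace CrystalSkeleton

/-! ### Tableaux

Partitions are Young diagrams; row `0` is the longest row, which is the bottom row in French
notation, so a row with a larger index is a higher row.  A filling gives `0` outside its shape. -/

/-- `SSYT(lam)_n`, the vertices of the crystal `B(lam)_n`: semistandard Young tableaux of shape
`lam` over the alphabet `{1, …, n}`. -/
def SSYT (lam : YoungDiagram) (n : ℕ) : Type :=
  {b : SemistandardYoungTableau lam // ∀ r k, (r, k) ∈ lam → 1 ≤ b r k ∧ b r k ≤ n}

/-- `SYT(lam)`: standard Young tableaux of shape `lam`. -/
def SYT (lam : YoungDiagram) : Type :=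
  {T : SemistandardYoungTableau lam //
    Set.BijOn (fun c : ℕ × ℕ => T c.1 c.2) (lam.cells : Set (ℕ × ℕ)) (Set.Icc 1 lam.card)}

/-- The row reading word: rows are read left to right, from the highest row to row `0`. -/
def rowWord {lam : YoungDiagram} (b : SemistandardYoungTableau lam) : List ℕ :=
  (List.range (lam.colLen 0)).reverse.flatMap fun r => (List.range (lam.rowLen r)).map (b r)

/-- `T` is the standardization of `b`: for each letter `x`, in increasing order, the occurrences
of `x` in `b` are renumbered from left to right by the next consecutive integers.  (Two equal
letters of a semistandard tableau never share a column.) -/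
def IsStandardization {lam : YoungDiagram} (b T : SemistandardYoungTableau lam) : Prop :=
  ∀ r k, (r, k) ∈ lam →
    T r k = (lam.cells.filter fun c => b c.1 c.2 < b r k).card
      + (lam.cells.filter fun c => b c.1 c.2 = b r k ∧ c.2 ≤ k).card

/-! ### Crystal operators -/

/-- The number of letters `i + 1` of the word `w` that are not bracketed with an `i` to their right
inside `w`, when letters `i + 1` are successively bracketed with letters `i` to their right.
Reading from left to right, an `i + 1` opens a bracket, and an `i` closes an open bracket if there
is one; the truncated subtraction handles an `i` that finds no open bracket. -/
def openBrackets (i : ℕ) (w : List ℕ) : ℕ :=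
  w.foldl (fun d x => if x = i + 1 then d + 1 else if x = i then d - 1 else d) 0

/-- Position `p` of the word `w` carries an unbracketed letter `i`. -/
def IsUnbracketed (i : ℕ) (w : List ℕ) (p : ℕ) : Prop :=
  w[p]? = some i ∧ openBrackets i (w.take p) = 0

/-- `f_i w = w'` on words: the rightmost unbracketed letter `i` is changed to `i + 1`. -/
def WordLowers (i : ℕ) (w w' : List ℕ) : Prop :=
  ∃ p, IsUnbracketed i w p ∧ (∀ q, p < q → ¬ IsUnbracketed i w q) ∧ w' = w.set p (i + 1)

/-- `f_i b = b'` on tableaux of the same shape, through the row reading words. -/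
def Lowers {lam : YoungDiagram} (i : ℕ) (b b' : SemistandardYoungTableau lam) : Prop :=
  WordLowers i (rowWord b) (rowWord b')

/-! ### The crystal skeleton -/

/-- There is an edge from `T` to `T'` in the crystal skeleton `CS(lam)` obtained from `B(lam)_n` by
contracting each quasi-crystal `Q_T = {b | std b = T}` to the vertex `T`.  Arrows of `B(lam)_n`
inside a quasi-crystal are contracted, so they give no loops. -/
def CSEdge (n : ℕ) {lam : YoungDiagram} (T T' : SYT lam) : Prop :=
  T ≠ T' ∧ ∃ b b' : SSYT lam n, IsStandardization b.1 T.1 ∧ IsStandardization b'.1 T'.1 ∧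
    ∃ i, 1 ≤ i ∧ i < n ∧ Lowers i b.1 b'.1

/-- Row insertion of the letter `x` into a row; the second component is the bumped letter. -/
def rowInsert (x : ℕ) : List ℕ → List ℕ × Option ℕ
  | [] => ([x], none)
  | y :: ys => if x < y then (x :: ys, some y) else (y :: (rowInsert x ys).1, (rowInsert x ys).2)

/-- Insertion of the letter `x` into a tableau, given by its list of rows starting with row `0`. -/
def tableauInsert (x : ℕ) : List (List ℕ) → List (List ℕ)
  | [] => [[x]]
  | R :: Rs =>
    match rowInsert x R with
    | (R', none) => R' :: Rs
    | (R', some y) => R' :: tableauInsert y Rs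

/-- The Robinson–Schensted–Knuth insertion tableau `P(w)`. -/
def insertionTableau (w : List ℕ) : List (List ℕ) :=
  w.foldl (fun P x => tableauInsert x P) []

/-- `[i, i + 2m]` is a Dyck pattern interval of `T`, where `m ≥ 1`: the insertion tableau of the
subword of `row(T)` on the letters of this interval has the rows
`i, …, i + m` and `i + m + 1, …, i + 2m`. -/
def IsDyckPatternInterval {lam : YoungDiagram} (T : SYT lam) (i m : ℕ) : Prop :=
  1 ≤ m ∧ 1 ≤ i ∧ i + 2 * m ≤ lam.card ∧
    insertionTableau ((rowWord T.1).filter fun x => decide (i ≤ x ∧ x ≤ i + 2 * m)) =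
      [List.range' i (m + 1), List.range' (i + m + 1) m]

/-- The letters in `[i, i + m]` become `i`, those in `[i + m + 1, i + 2m]` become `i + 1`. -/
def collapse (i m x : ℕ) : ℕ :=
  if i ≤ x ∧ x ≤ i + m then i
  else if i + m + 1 ≤ x ∧ x ≤ i + 2 * m then i + 1
  else x

/-- The edge of `CS(lam)` from `T` associated with the Dyck pattern interval `[i, j]` of `T` goes to
`T'`: if `[i, j] = [i, i + 2m]` and `b` is obtained from `T` by collapsing the letters in
`[i, i + m]` to `i` and those in `[i + m + 1, i + 2m]` to `i + 1`, then `T' = std (f_i b)`. -/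
def HasDyckLabel {lam : YoungDiagram} (T : SYT lam) (i j : ℕ) (T' : SYT lam) : Prop :=
  ∃ m, j = i + 2 * m ∧ IsDyckPatternInterval T i m ∧
    ∃ b b' : SemistandardYoungTableau lam, (∀ r k, b r k = collapse i m (T.1 r k)) ∧
      Lowers i b b' ∧ IsStandardization b' T'.1

/-- There is an edge from `T` to `T'` in `CS(lam)` labeled by the Dyck pattern interval `[i, j]`. -/
def CSLabeledEdge (n : ℕ) {lam : YoungDiagram} (T : SYT lam) (i j : ℕ) (T' : SYT lam) : Prop :=
  CSEdge n T T' ∧ HasDyckLabel T i j T'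

/-! ### Jeu de taquin -/

/-- `Slide f c g`: starting with an empty cell `c` in the filling `f` (where `0` means "no entry"),
the entry above or to the right of the empty cell, whichever is smaller (the one above in case of
a tie), is moved into the empty cell, until there is neither; the resulting filling is `g`. -/
inductive Slide : (ℕ × ℕ → ℕ) → ℕ × ℕ → (ℕ × ℕ → ℕ) → Prop
  | halt (f : ℕ × ℕ → ℕ) (r k : ℕ) (hup : f (r + 1, k) = 0) (hright : f (r, k + 1) = 0) :
      Slide f (r, k) f
  | up (f g : ℕ × ℕ → ℕ) (r k : ℕ) (hup : f (r + 1, k) ≠ 0)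
      (hle : f (r, k + 1) = 0 ∨ f (r + 1, k) ≤ f (r, k + 1))
      (h : Slide (Function.update (Function.update f (r, k) (f (r + 1, k))) (r + 1, k) 0)
        (r + 1, k) g) :
      Slide f (r, k) g
  | right (f g : ℕ × ℕ → ℕ) (r k : ℕ) (hright : f (r, k + 1) ≠ 0)
      (hlt : f (r + 1, k) = 0 ∨ f (r, k + 1) < f (r + 1, k))
      (h : Slide (Function.update (Function.update f (r, k) (f (r, k + 1))) (r, k + 1) 0)
        (r, k + 1) g) :
      Slide f (r, k) g

/-- One jeu de taquin slide on skew tableaux, given by their inner shape and their filling: a corner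
`c` of the inner shape is removed from it, and the slide into `c` is performed. -/
def JdtStep (X Y : YoungDiagram × (ℕ × ℕ → ℕ)) : Prop :=
  ∃ c ∈ X.1, Y.1.cells = X.1.cells.erase c ∧ Slide X.2 c Y.2

/-- The inner shape of the skew tableau `T_{[a,b]}`: the cells of `T` with an entry less than
`a`. -/
def innerShape {lam : YoungDiagram} (T : SYT lam) (a : ℕ) : YoungDiagram where
  cells := lam.cells.filter fun c => T.1 c.1 c.2 < a
  isLowerSet := by
    rintro ⟨r, k⟩ ⟨r', k'⟩ hle hc
    obtain ⟨h1, h2⟩ := Prod.mk_le_mk.mp hle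
    simp only [Finset.coe_filter, YoungDiagram.mem_cells, Set.mem_ofPred_eq] at hc ⊢
    refine ⟨lam.up_left_mem h1 h2 hc.1, lt_of_le_of_lt ?_ hc.2⟩
    exact (T.1.col_weak h1 (lam.up_left_mem le_rfl h2 hc.1)).trans (T.1.row_weak_of_le h2 hc.1)

/-- The filling of the skew tableau `T_{[a,b]}`. -/
def restrictFilling {lam : YoungDiagram} (T : SYT lam) (a b : ℕ) : ℕ × ℕ → ℕ :=
  fun c => if a ≤ T.1 c.1 c.2 ∧ T.1 c.1 c.2 ≤ b then T.1 c.1 c.2 else 0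

/-- `mu = shape (jdt (T_{[a,b]}))`: some sequence of jeu de taquin slides straightens `T_{[a,b]}` to
a tableau (with empty inner shape) of shape `mu`. -/
def IsJdtShape {lam : YoungDiagram} (T : SYT lam) (a b : ℕ) (mu : YoungDiagram) : Prop :=
  ∃ g : ℕ × ℕ → ℕ,
    Relation.ReflTransGen JdtStep (innerShape T a, restrictFilling T a b) (⊥, g) ∧
      ∀ c, g c ≠ 0 ↔ c ∈ mu

end CrystalSkeleton

open CrystalSkeleton

/-!
Everything is transferred to row reading words, which are permutations.  On reading words, an edge
of the crystal skeleton with label `[i, i + 2m]` is a *Dyck move* (`DyckMove`): the letters of the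
interval form a shuffle of two increasing words in which, after collapsing, exactly one letter
`i + q` is unbracketed, and the move relabels all letters by an explicit cycle that depends on `q`.
This description of the edges is `exists_dyckMove_of_csEdge`, `csEdge_of_dyckMove` and
`csLabeledEdge_iff`.

The key fact is that a Dyck move commutes with an elementary Knuth transformation at a fixed
position (`DyckMove.knuthMove`).  Therefore a Knuth equivalence between two words, performed
position by position, is a permutation of all words that respects Dyck moves
(`KnuthEq.exists_bijective`).  Jeu de taquin slides preserve the Knuth class of the reading word
(`IsSkewTableau.reflTransGen`), so the subword of `row(T)` on the letters in `[a, b]` is Knuth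
equivalent to the shifted reading word of a standard tableau of shape `mu`
(`IsJdtShape.exists_knuthEq`).  Whether a permutation admits a Dyck move on an interval inside
`[a, b]`, and what the move does, depends only on the subword on `[a, b]`.  Hence edges of `CS(mu)`
and edges of `CS(lam)` inside `[a, b]` correspond to each other, as soon as it is known that the
tableaux involved exist.

Existence is obtained by walking.  A Dyck move with `m = 1`, in either direction, interchanges two
letters `x` and `x + 1` and is an elementary dual Knuth transformation; it always leads from a
standard tableau to a standard tableau (`SYT.exists_of_dyckMove`, `SYT.exists_of_dyckMove_symm`).
These moves connect all standard tableaux of a given shape (`linked`).  So every tableau of shape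
`mu` is reached from the one that corresponds to `T`, and the walk is copied inside `SYT(lam)`.
For several disjoint intervals the coordinates are changed one after the other (`exists_isLift`).
-/

namespace CrystalSkeleton

/-! ### Knuth transformations and Dyck moves on words -/

/-- The elementary Knuth transformation of three consecutive letters: if the first or the last of
them lies strictly between the remaining two, then these remaining two letters are interchanged.
All other triples are fixed, so this is an involution. -/
def knuthTriple (x y z : ℕ) : List ℕ :=
  if (y < x ∧ x < z) ∨ (z < x ∧ x < y) then [x, z, y]
  else if (x < z ∧ z < y) ∨ (y < z ∧ z < x) then [y, x, z]
  else [x, y, z]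

/-- The elementary Knuth transformation of the three letters of a word at the positions `p`, `p + 1`
and `p + 2`, as a total operation: a word on which no transformation is possible there is fixed. -/
def knuthMove : ℕ → List ℕ → List ℕ
  | 0, x :: y :: z :: l => knuthTriple x y z ++ l
  | p + 1, x :: l => x :: knuthMove p l
  | _, l => l

theorem knuthMove_append (A l : List ℕ) (p : ℕ) :
    knuthMove (A.length + p) (A ++ l) = A ++ knuthMove p l := by
  induction A with
  | nil => simp
  | cons a A ih => simp [Nat.add_right_comm, knuthMove, ih]

/-- The words on which `knuthMove p` has a triple to act on are determined by their length. -/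
theorem knuthMove_eq_or (p : ℕ) (w : List ℕ) :
    (∀ w' : List ℕ, w'.length = w.length → knuthMove p w' = w') ∨
      ∃ A x y z B, w = A ++ x :: y :: z :: B ∧ A.length = p := by
  by_cases hp : p + 2 < w.length
  · right
    refine ⟨w.take p, w[p], w[p+1], w[p+2], w.drop (p+3), ?_, by simp; omega⟩
    simp
  · left
    intro w' hw
    rw [← hw] at hp
    clear hw w
    induction p generalizing w' with
    | zero =>
      match w' with
      | [] => rfl
      | [_] => rfl
      | [_, _] => rfl
      | _ :: _ :: _ :: _ => simp at hp
    | succ p ih =>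
      match w' with
      | [] => rfl
      | a :: w' => simp at hp; simp [knuthMove]; exact ih w' (by omega)

theorem knuthMove_append_triple (A B : List ℕ) (x y z : ℕ) :
    knuthMove A.length (A ++ x :: y :: z :: B) = A ++ (knuthTriple x y z ++ B) := by
  simpa [knuthMove] using knuthMove_append A (x :: y :: z :: B) 0

theorem knuthTriple_perm (x y z : ℕ) : (knuthTriple x y z).Perm [x, y, z] := by
  unfold knuthTriple
  split_ifs
  · exact (List.Perm.swap _ _ _).cons _
  · exact List.Perm.swap _ _ _
  · exact List.Perm.refl _

theorem knuthMove_perm (p : ℕ) (w : List ℕ) : (knuthMove p w).Perm w := by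
  rcases knuthMove_eq_or p w with h | ⟨A, x, y, z, B, rfl, rfl⟩
  · rw [h w rfl]
  · rw [knuthMove_append_triple]
    exact ((knuthTriple_perm x y z).append_right B).append_left A

theorem knuthMove_knuthMove (p : ℕ) (w : List ℕ) : knuthMove p (knuthMove p w) = w := by
  rcases knuthMove_eq_or p w with h | ⟨A, x, y, z, B, rfl, rfl⟩
  · rw [h w rfl, h w rfl]
  · rw [knuthMove_append_triple]
    have : ∃ x' y' z', knuthTriple x y z = [x', y', z'] ∧ knuthTriple x' y' z' = [x, y, z] := by
      unfold knuthTriple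
      split_ifs with h1 h2
      · refine ⟨_, _, _, rfl, ?_⟩
        rw [if_pos (by omega)]
      · refine ⟨_, _, _, rfl, ?_⟩
        rw [if_neg (by omega), if_pos (by omega)]
      · refine ⟨_, _, _, rfl, ?_⟩
        rw [if_neg h1, if_neg h2]
    obtain ⟨x', y', z', h1, h2⟩ := this
    rw [h1]
    simp only [List.cons_append, List.nil_append]
    rw [knuthMove_append_triple, h2]
    simp

/-- The letters `i, …, i + 2m`, at the positions given by `pos`, are arranged such that the small
letters `i, …, i + m` increase from left to right, the large letters `i + m + 1, …, i + 2m` do so,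
and if small letters are read as `i` and large letters as `i + 1`, then all letters but the small
letter `i + q` are bracketed: the small letter `i + j` closes the large letter `i + m + 1 + j` for
`j < q`, and it closes the large letter `i + m + j` for `j > q`. -/
structure DyckOrder (i m q : ℕ) (pos : ℕ → ℕ) : Prop where
  le : q ≤ m
  small : ∀ j, j < m → pos (i + j) < pos (i + j + 1)
  large : ∀ j, j + 1 < m → pos (i + m + 1 + j) < pos (i + m + 1 + j + 1)
  left : ∀ j, j < q → pos (i + m + 1 + j) < pos (i + j)
  mid : q < m → pos (i + q) < pos (i + m + 1 + q)
  right : ∀ j, q ≤ j → j < m → pos (i + m + 1 + j) < pos (i + j + 1)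

theorem DyckOrder.small_lt {i m q : ℕ} {pos : ℕ → ℕ} (h : DyckOrder i m q pos) {x y : ℕ}
    (hx : i ≤ x) (hxy : x < y) (hy : y ≤ i + m) : pos x < pos y := by
  obtain ⟨j, rfl⟩ := Nat.exists_eq_add_of_le hx
  obtain ⟨k, rfl⟩ := Nat.exists_eq_add_of_lt hxy
  induction k with
  | zero => exact h.small j (by omega)
  | succ k ih =>
    have := ih (by omega) (by omega)
    have h2 := h.small (j + k + 1) (by omega)
    exact this.trans (by simpa only [← add_assoc] using h2)

theorem DyckOrder.large_lt {i m q : ℕ} {pos : ℕ → ℕ} (h : DyckOrder i m q pos) {x y : ℕ}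
    (hx : i + m + 1 ≤ x) (hxy : x < y) (hy : y ≤ i + 2 * m) : pos x < pos y := by
  obtain ⟨j, rfl⟩ := Nat.exists_eq_add_of_le hx
  obtain ⟨k, rfl⟩ := Nat.exists_eq_add_of_lt hxy
  induction k with
  | zero => exact h.large j (by omega)
  | succ k ih =>
    have := ih (by omega) (by omega)
    have h2 := h.large (j + k + 1) (by omega)
    exact this.trans (by simpa only [← add_assoc] using h2)

/-- The effect on standardizations of changing the small letter `i + q` from `i` to `i + 1`: it
becomes the letter `i + m + q`, and the letters that it overtakes go down by one. -/
def dyckCycle (i m q x : ℕ) : ℕ :=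
  if x = i + q then i + m + q else if i + q < x ∧ x ≤ i + m + q then x - 1 else x

/-- The cycle changes the order of the letter `i + q` relative to the letters `e` in
`(i + q, i + m + q]` only.  Such a letter `e` is never adjacent to `i + q` in the word. -/
theorem DyckOrder.separated {i m q : ℕ} {pos : ℕ → ℕ} (h : DyckOrder i m q pos) {e : ℕ}
    (h1 : i + q < e) (h2 : e ≤ i + m + q) :
    (e ≤ i + m ∧ pos (i + q) < pos (i + m + 1 + q) ∧ pos (i + m + 1 + q) < pos (i + q + 1) ∧
      (e = i + q + 1 ∨ pos (i + q + 1) < pos e)) ∨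
    (i + m < e ∧ pos e < pos (i + q - 1) ∧ pos (i + q - 1) < pos (i + q) ∧
      (e = i + m + q ∨ pos e < pos (i + m + q))) := by
  by_cases he : e ≤ i + m
  · left
    have hq : q < m := by omega
    refine ⟨he, h.mid hq, h.right q le_rfl hq, ?_⟩
    by_cases h3 : e = i + q + 1
    · exact Or.inl h3
    · exact Or.inr (h.small_lt (by omega) (by omega) he)
  · right
    obtain ⟨j, rfl⟩ := Nat.exists_eq_add_of_le (show i + m + 1 ≤ e by omega)
    have h3 := h.left j (by omega)
    have h4 : j = q - 1 ∨ pos (i + j) < pos (i + q - 1) := by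
      by_cases h5 : j = q - 1
      · exact Or.inl h5
      · exact Or.inr (h.small_lt (by omega) (by omega) (by have := h.le; omega))
    have h6 : pos (i + q - 1) < pos (i + q) :=
      h.small_lt (by omega) (by omega) (by have := h.le; omega)
    refine ⟨by omega, ?_, h6, ?_⟩
    · rcases h4 with rfl | h4
      · rwa [Nat.add_sub_assoc (by omega)]
      · omega
    · by_cases h5 : j = q - 1
      · left; omega
      · right
        exact h.large_lt (by omega) (by omega) (by have := h.le; omega)

/-- Interchanging two adjacent letters `u`, `v` next to a letter `y` of intermediate value keeps the
Dyck order, with the same unbracketed letter, apart from two exceptional triples `u v y`. -/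
theorem DyckOrder.swap {i m q : ℕ} {pos : ℕ → ℕ} (h : DyckOrder i m q pos) {k u v y : ℕ}
    (hu : pos u = k) (hv : pos v = k + 1)
    (hinj : ∀ t, i ≤ t → t ≤ i + 2 * m → ∀ t', pos t = pos t' → t = t')
    (hy : (u < y ∧ y < v) ∨ (v < y ∧ y < u)) (hyk : pos y = k + 2 ∨ pos y + 1 = k)
    (hs1 : ¬ (q < m ∧ u = i + q ∧ v = i + m + 1 + q ∧ y = i + q + 1))
    (hs2 : ¬ (0 < q ∧ u = i + m + q ∧ v + 1 = i + q ∧ y = i + q)) :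
    DyckOrder i m q (fun t => Equiv.swap k (k + 1) (pos t)) := by
  have key : ∀ s t, i ≤ s → s ≤ i + 2 * m → i ≤ t → t ≤ i + 2 * m → pos s < pos t →
      ¬ (s = u ∧ t = v) → Equiv.swap k (k + 1) (pos s) < Equiv.swap k (k + 1) (pos t) := by
    intro s t hs hs' ht ht' hst hne
    have h1 : ¬ (pos s = k ∧ pos t = k + 1) := by
      rintro ⟨h1, h2⟩
      exact hne ⟨hinj s hs hs' _ (by omega), hinj t ht ht' _ (by omega)⟩
    simp only [Equiv.swap_apply_def]
    split_ifs <;> omega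
  refine ⟨h.le, ?_, ?_, ?_, ?_, ?_⟩
  · intro j hj
    exact key _ _ (by omega) (by omega) (by omega) (by omega) (h.small j hj) (by omega)
  · intro j hj
    exact key _ _ (by omega) (by omega) (by omega) (by omega) (h.large j hj) (by omega)
  · intro j hj
    have hle := h.le
    refine key _ _ (by omega) (by omega) (by omega) (by omega) (h.left j hj) ?_
    rintro ⟨rfl, rfl⟩
    by_cases hyy : y ≤ i + m
    · have h1 := h.small_lt (show i ≤ i + j by omega) (show i + j < y by omega) hyy
      have h2 : y = i + j + 1 := by
        by_contra h3
        have h4 := h.small_lt (show i ≤ i + j + 1 by omega) (show _ < y by omega) hyy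
        have h5 := h.small j (by omega)
        omega
      subst h2
      by_cases h3 : j + 1 < q
      · have h4 := h.left (j + 1) h3
        have h5 := h.large j (by omega)
        rw [← add_assoc, ← add_assoc] at h4
        have h6 := hinj (i + m + 1 + j + 1) (by omega) (by omega) (i + j) (by omega)
        omega
      · apply hs2; omega
    · obtain ⟨j', rfl⟩ := Nat.exists_eq_add_of_le (show i + m + 1 ≤ y by omega)
      have h1 := h.large_lt (show i + m + 1 ≤ i + m + 1 + j' by omega)
        (show _ < i + m + 1 + j by omega) (by omega)
      have h2 := h.left j' (by omega)
      have h3 := h.small_lt (show i ≤ i + j' by omega) (show _ < i + j by omega) (by omega)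
      have h4 := hinj (i + j') (by omega) (by omega) (i + m + 1 + j) (by omega)
      omega
  · intro hq
    refine key _ _ (by omega) (by omega) (by omega) (by omega) (h.mid hq) ?_
    rintro ⟨rfl, rfl⟩
    by_cases hyy : y ≤ i + m
    · have h1 := h.small_lt (show i ≤ i + q by omega) (show i + q < y by omega) hyy
      have h2 : y = i + q + 1 := by
        by_contra h3
        have h4 := h.small_lt (show i ≤ i + q + 1 by omega) (show _ < y by omega) hyy
        have h5 := h.small q (by omega)
        have h6 := hinj (i + q + 1) (by omega) (by omega) (i + m + 1 + q) (by omega)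
        omega
      apply hs1; omega
    · obtain ⟨j', rfl⟩ := Nat.exists_eq_add_of_le (show i + m + 1 ≤ y by omega)
      have h1 := h.large_lt (show i + m + 1 ≤ i + m + 1 + j' by omega)
        (show _ < i + m + 1 + q by omega) (by omega)
      have h2 := h.left j' (by omega)
      have h3 := h.small_lt (show i ≤ i + j' by omega) (show _ < i + q by omega) (by omega)
      omega
  · intro j hj hjm
    refine key _ _ (by omega) (by omega) (by omega) (by omega) (h.right j hj hjm) ?_
    rintro ⟨rfl, rfl⟩
    by_cases hyy : y ≤ i + m
    · have h1 := h.small_lt (show i ≤ i + j + 1 by omega) (show _ < y by omega) hyy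
      have h4 := h.right (j + 1) (by omega) (by omega)
      have h5 := h.large j (by omega)
      rw [← add_assoc, ← add_assoc] at h4
      have h6 := hinj (i + m + 1 + j + 1) (by omega) (by omega) (i + j + 1)
      have h7 : y = i + j + 1 + 1 ∨ pos (i + j + 1 + 1) < pos y := by
        by_cases h8 : y = i + j + 1 + 1
        · exact Or.inl h8
        · exact Or.inr (h.small_lt (by omega) (by omega) (by omega))
      rcases h7 with rfl | h7 <;> omega
    · obtain ⟨j', rfl⟩ := Nat.exists_eq_add_of_le (show i + m + 1 ≤ y by omega)
      have h1 := h.large_lt (show i + m + 1 ≤ i + m + 1 + j' by omega)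
        (show _ < i + m + 1 + j by omega) (by omega)
      by_cases hq : q ≤ j'
      · have h2 := h.right j' hq (by omega)
        have h3 := h.small_lt (show i ≤ i + j' + 1 by omega) (show _ < i + j + 1 by omega)
          (by omega)
        have h4 := hinj (i + j' + 1) (by omega) (by omega) (i + m + 1 + j) (by omega)
        omega
      · have h2 := h.left j' (by omega)
        have h3 := h.small_lt (show i ≤ i + j' by omega) (show _ < i + q by omega) (by omega)
        have h4 := h.mid (by omega)
        have h5 : q = j ∨ pos (i + m + 1 + q) < pos (i + m + 1 + j) := by
          by_cases h6 : q = j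
          · exact Or.inl h6
          · exact Or.inr (h.large_lt (by omega) (by omega) (by omega))
        rcases h5 with rfl | h5 <;> omega

/-- The word `v` arises from the word `w` by the Dyck pattern interval `[i, i + 2m]`: the letters of
the interval occur in `w` and form a Dyck pattern there, and `v` is the standardization after the
crystal operator has been applied to the collapsed word. -/
def DyckMove (i m : ℕ) (w v : List ℕ) : Prop :=
  ∃ q, (∀ x, i ≤ x → x ≤ i + 2 * m → x ∈ w) ∧ DyckOrder i m q (fun x => w.idxOf x) ∧
    v = w.map (dyckCycle i m q)

theorem idxOf_append_swap {A B : List ℕ} {u v : ℕ} (hA : (A ++ u :: v :: B).Nodup) (t : ℕ) :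
    (A ++ v :: u :: B).idxOf t =
      Equiv.swap A.length (A.length + 1) ((A ++ u :: v :: B).idxOf t) := by
  have h1 := List.nodup_append.1 hA
  have h2 := List.nodup_cons.1 h1.2.1
  have huv : u ≠ v := fun h => h2.1 (by simp [h])
  by_cases ht : t ∈ A
  · have := List.idxOf_lt_length_iff.2 ht
    rw [List.idxOf_append_of_mem ht, List.idxOf_append_of_mem ht,
      Equiv.swap_apply_of_ne_of_ne (by omega) (by omega)]
  · rw [List.idxOf_append_of_notMem ht, List.idxOf_append_of_notMem ht]
    by_cases hu : t = u
    · subst hu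
      rw [List.idxOf_cons_ne _ huv.symm, List.idxOf_cons_self, List.idxOf_cons_self, add_zero,
        Equiv.swap_apply_left]
    · by_cases hv : t = v
      · subst hv
        rw [List.idxOf_cons_ne _ huv, List.idxOf_cons_self, List.idxOf_cons_self, add_zero,
          Equiv.swap_apply_right]
      · rw [List.idxOf_cons_ne _ (Ne.symm hu), List.idxOf_cons_ne _ (Ne.symm hv),
          List.idxOf_cons_ne _ (Ne.symm hu), List.idxOf_cons_ne _ (Ne.symm hv),
          Equiv.swap_apply_of_ne_of_ne (by omega) (by omega)]

theorem dyckCycle_lt_iff {i m q s t : ℕ} (h1 : ¬ (s = i + q ∧ s < t ∧ t ≤ i + m + q))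
    (h2 : ¬ (t = i + q ∧ t < s ∧ s ≤ i + m + q)) :
    dyckCycle i m q s < dyckCycle i m q t ↔ s < t := by
  unfold dyckCycle
  split_ifs <;> omega

theorem knuthTriple_map {f : ℕ → ℕ} {x y z : ℕ} (hxy : f x < f y ↔ x < y)
    (hyx : f y < f x ↔ y < x) (hxz : f x < f z ↔ x < z) (hzx : f z < f x ↔ z < x)
    (hyz : f y < f z ↔ y < z) (hzy : f z < f y ↔ z < y) :
    knuthTriple (f x) (f y) (f z) = (knuthTriple x y z).map f := by
  unfold knuthTriple
  simp only [hxy, hyx, hxz, hzx, hyz, hzy]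
  split_ifs <;> rfl

theorem swap_lt_swap {k a b : ℕ} (h1 : a < b) (h2 : ¬ (a = k ∧ b = k + 1)) :
    Equiv.swap k (k + 1) a < Equiv.swap k (k + 1) b := by
  simp only [Equiv.swap_apply_def]
  split_ifs <;> omega

/-- The first exceptional triple: a Knuth transformation moves the large letter `i + m + 1 + q`
across the unbracketed letter `i + q`, whose role is taken over by `i + q + 1`. -/
theorem DyckOrder.raise {i m q : ℕ} {pos : ℕ → ℕ} (h : DyckOrder i m q pos) {k : ℕ}
    (hq : q < m) (px : pos (i + q) = k) (py : pos (i + m + 1 + q) = k + 1)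
    (pz : pos (i + q + 1) = k + 2)
    (hinj : ∀ t, i ≤ t → t ≤ i + 2 * m → ∀ t', pos t = pos t' → t = t') :
    DyckOrder i m (q + 1) (fun t => Equiv.swap k (k + 1) (pos t)) := by
  have hadj : ∀ s t, pos s < pos t → ¬ (s = i + q ∧ t = i + m + 1 + q) →
      i ≤ s → s ≤ i + 2 * m → i ≤ t → t ≤ i + 2 * m →
      Equiv.swap k (k + 1) (pos s) < Equiv.swap k (k + 1) (pos t) := by
    intro s t hst hne h1 h2 h3 h4
    refine swap_lt_swap hst ?_
    rintro ⟨h5, h6⟩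
    exact hne ⟨hinj s h1 h2 _ (by omega), hinj t h3 h4 _ (by omega)⟩
  refine ⟨by omega, ?_, ?_, ?_, ?_, ?_⟩
  · intro j hj
    exact hadj _ _ (h.small j hj) (by omega) (by omega) (by omega) (by omega) (by omega)
  · intro j hj
    exact hadj _ _ (h.large j hj) (by omega) (by omega) (by omega) (by omega) (by omega)
  · intro j hj
    by_cases hjq : j = q
    · subst hjq
      rw [px, py, Equiv.swap_apply_left, Equiv.swap_apply_right]
      omega
    · exact hadj _ _ (h.left j (by omega)) (by omega) (by omega) (by omega) (by omega) (by omega)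
  · intro hj
    have h7 := h.large q (by omega)
    have h8 := hinj (i + m + 1 + q + 1) (by omega) (by omega) (i + q + 1)
    exact hadj _ _ (by rw [← add_assoc, ← add_assoc]; omega) (by omega) (by omega) (by omega)
      (by omega) (by omega)
  · intro j hj hj2
    exact hadj _ _ (h.right j (by omega) hj2) (by omega) (by omega) (by omega) (by omega)
      (by omega)

/-- The second exceptional triple, inverse to `DyckOrder.raise`. -/
theorem DyckOrder.lower {i m r : ℕ} {pos : ℕ → ℕ} (h : DyckOrder i m (r + 1) pos) {k : ℕ}
    (px : pos (i + m + 1 + r) = k) (py : pos (i + r) = k + 1) (pz : pos (i + r + 1) = k + 2)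
    (hinj : ∀ t, i ≤ t → t ≤ i + 2 * m → ∀ t', pos t = pos t' → t = t') :
    DyckOrder i m r (fun t => Equiv.swap k (k + 1) (pos t)) := by
  have hle := h.le
  have hadj : ∀ s t, pos s < pos t → ¬ (t = i + r ∧ s = i + m + 1 + r) →
      i ≤ s → s ≤ i + 2 * m → i ≤ t → t ≤ i + 2 * m →
      Equiv.swap k (k + 1) (pos s) < Equiv.swap k (k + 1) (pos t) := by
    intro s t hst hne h1 h2 h3 h4
    refine swap_lt_swap hst ?_
    rintro ⟨h5, h6⟩
    exact hne ⟨hinj t h3 h4 _ (by omega), hinj s h1 h2 _ (by omega)⟩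
  refine ⟨by omega, ?_, ?_, ?_, ?_, ?_⟩
  · intro j hj
    exact hadj _ _ (h.small j hj) (by omega) (by omega) (by omega) (by omega) (by omega)
  · intro j hj
    exact hadj _ _ (h.large j hj) (by omega) (by omega) (by omega) (by omega) (by omega)
  · intro j hj
    exact hadj _ _ (h.left j (by omega)) (by omega) (by omega) (by omega) (by omega) (by omega)
  · intro hj
    rw [px, py, Equiv.swap_apply_left, Equiv.swap_apply_right]
    omega
  · intro j hj hj2
    by_cases hjr : j = r
    · subst hjr
      rw [px, pz, Equiv.swap_apply_left,
        Equiv.swap_apply_of_ne_of_ne (by omega) (by omega)]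
      omega
    · exact hadj _ _ (h.right j (by omega) hj2) (by omega) (by omega) (by omega) (by omega)
        (by omega)

theorem map_dyckCycle_succ {i m q : ℕ} {l : List ℕ}
    (h : ∀ t ∈ l, t ≠ i + q ∧ t ≠ i + m + 1 + q ∧ t ≠ i + q + 1) :
    l.map (dyckCycle i m q) = l.map (dyckCycle i m (q + 1)) := by
  refine List.map_congr_left fun t ht => ?_
  have := h t ht
  unfold dyckCycle
  split_ifs <;> omega

theorem dyckCycle_succ_values {i m q : ℕ} (hm : q < m) :
    dyckCycle i m q (i + q) = i + m + q ∧ dyckCycle i m q (i + m + 1 + q) = i + m + 1 + q ∧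
    dyckCycle i m q (i + q + 1) = i + q ∧ dyckCycle i m (q + 1) (i + q) = i + q ∧
    dyckCycle i m (q + 1) (i + m + 1 + q) = i + m + q ∧
    dyckCycle i m (q + 1) (i + q + 1) = i + m + 1 + q := by
  unfold dyckCycle
  refine ⟨?_, ?_, ?_, ?_, ?_, ?_⟩ <;> split_ifs <;> omega

/-- Knuth transformations at a fixed position commute with Dyck moves.  Apart from the two
exceptional triples, the cycle preserves the relative order of the three letters, so that the same
two of them are interchanged on both sides.  In the exceptional triples different letters are
interchanged, and this is made up for by the change of the unbracketed letter. -/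
theorem DyckMove.knuthMove {i m : ℕ} {w v : List ℕ} (hw : w.Nodup) (h : DyckMove i m w v) (p : ℕ) :
    DyckMove i m (knuthMove p w) (knuthMove p v) := by
  obtain ⟨q, hmem, h, rfl⟩ := h
  rcases knuthMove_eq_or p w with h' | ⟨A, x, y, z, B, rfl, rfl⟩
  · rw [h' w rfl, h' _ (by simp)]
    exact ⟨q, hmem, h, rfl⟩
  have hmem' : ∀ t, i ≤ t → t ≤ i + 2 * m → t ∈ CrystalSkeleton.knuthMove A.length
      (A ++ x :: y :: z :: B) := fun t h1 h2 => ((knuthMove_perm _ _).mem_iff).2 (hmem t h1 h2)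
  have hinj : ∀ t, i ≤ t → t ≤ i + 2 * m → ∀ t', (A ++ x :: y :: z :: B).idxOf t =
      (A ++ x :: y :: z :: B).idxOf t' → t = t' := fun t h1 h2 t' h3 =>
    (List.idxOf_inj (hmem t h1 h2)).1 h3
  have hnd := hw
  rw [List.nodup_append, List.nodup_cons, List.nodup_cons, List.nodup_cons] at hnd
  obtain ⟨-, ⟨hx, hy, hz, -⟩, hA⟩ := hnd
  simp only [List.mem_cons, not_or] at hx hy
  have px : (A ++ x :: y :: z :: B).idxOf x = A.length := by
    rw [List.idxOf_append_of_notMem (fun h => hA x h x (by simp) rfl)]; simp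
  have py : (A ++ x :: y :: z :: B).idxOf y = A.length + 1 := by
    rw [List.idxOf_append_of_notMem (fun h => hA y h y (by simp) rfl),
      List.idxOf_cons_ne _ (by omega)]; simp
  have pz : (A ++ x :: y :: z :: B).idxOf z = A.length + 2 := by
    rw [List.idxOf_append_of_notMem (fun h => hA z h z (by simp) rfl),
      List.idxOf_cons_ne _ (by omega), List.idxOf_cons_ne _ (by omega)]; simp
  have sw1 := idxOf_append_swap hw
  have sw2 : ∀ t, (A ++ x :: z :: y :: B).idxOf t =
      Equiv.swap (A.length + 1) (A.length + 1 + 1) ((A ++ x :: y :: z :: B).idxOf t) := by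
    have := idxOf_append_swap (A := A ++ [x]) (B := B) (u := y) (v := z) (by simpa using hw)
    simpa using this
  rw [knuthMove_append_triple] at hmem' ⊢
  rw [List.map_append, List.map_cons, List.map_cons, List.map_cons]
  have hlen : A.length = (A.map (dyckCycle i m q)).length := by simp
  rw [hlen, knuthMove_append_triple]
  have hA' : ∀ t ∈ A, t ≠ x ∧ t ≠ y ∧ t ≠ z := fun t ht =>
    ⟨hA t ht x (by simp), hA t ht y (by simp), hA t ht z (by simp)⟩
  have hB' : ∀ t ∈ B, t ≠ x ∧ t ≠ y ∧ t ≠ z := fun t ht =>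
    ⟨fun h => hx.2.2 (h ▸ ht), fun h => hy.2 (h ▸ ht), fun h => hz (h ▸ ht)⟩
  obtain ⟨pos, hpos⟩ : ∃ pos : ℕ → ℕ, ∀ t, pos t = (A ++ x :: y :: z :: B).idxOf t :=
    ⟨_, fun _ => rfl⟩
  have h' := h
  simp only [← hpos] at h hinj px py pz sw1 sw2
  clear hpos
  -- the triple on which the unbracketed letter changes from `i + q` to `i + q + 1`
  by_cases hs1 : q < m ∧ x = i + q ∧ y = i + m + 1 + q ∧ z = i + q + 1
  · obtain ⟨hq, rfl, rfl, rfl⟩ := hs1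
    obtain ⟨e1, e2, e3, e4, e5, e6⟩ := dyckCycle_succ_values (i := i) hq
    rw [show knuthTriple (i + q) (i + m + 1 + q) (i + q + 1) =
        [i + m + 1 + q, i + q, i + q + 1] by
      rw [knuthTriple, if_neg (by omega), if_pos (by omega)]] at hmem' ⊢
    refine ⟨q + 1, hmem', ?_, ?_⟩
    · simp only [List.cons_append, List.nil_append, sw1]
      exact h.raise hq px py pz hinj
    · rw [e1, e2, e3, map_dyckCycle_succ hA', map_dyckCycle_succ hB', knuthTriple,
        if_pos (by omega)]
      simp only [List.cons_append, List.nil_append, List.map_append, List.map_cons, e4, e5, e6]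
  -- the triple on which the unbracketed letter changes from `i + q` to `i + q - 1`
  by_cases hs2 : 0 < q ∧ x = i + m + q ∧ y + 1 = i + q ∧ z = i + q
  · obtain ⟨hq, hx', hy', hz'⟩ := hs2
    obtain ⟨r, rfl⟩ : ∃ r, q = r + 1 := ⟨q - 1, by omega⟩
    obtain rfl : y = i + r := by omega
    obtain rfl : x = i + m + 1 + r := by omega
    obtain rfl : z = i + r + 1 := by omega
    obtain ⟨e1, e2, e3, e4, e5, e6⟩ := dyckCycle_succ_values (i := i) (show r < m from h.le)
    rw [show knuthTriple (i + m + 1 + r) (i + r) (i + r + 1) =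
        [i + r, i + m + 1 + r, i + r + 1] by
      rw [knuthTriple, if_neg (by omega), if_pos (by omega)]] at hmem' ⊢
    refine ⟨r, hmem', ?_, ?_⟩
    · simp only [List.cons_append, List.nil_append, sw1]
      exact h.lower px py pz hinj
    · rw [e4, e5, e6,
        ← map_dyckCycle_succ fun t ht => ⟨(hA' t ht).2.1, (hA' t ht).1, (hA' t ht).2.2⟩,
        ← map_dyckCycle_succ fun t ht => ⟨(hB' t ht).2.1, (hB' t ht).1, (hB' t ht).2.2⟩,
        knuthTriple, if_pos (by omega)]
      simp only [List.cons_append, List.nil_append, List.map_append, List.map_cons, e1, e2, e3]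
  -- in all other cases the cycle keeps the relative order of the three letters
  have hbad : ∀ s t, s ∈ [x, y, z] → t ∈ [x, y, z] → ¬ (s = i + q ∧ s < t ∧ t ≤ i + m + q) := by
    rintro s t hs ht ⟨rfl, h1, h2⟩
    have h3 := h.separated h1 h2
    have hle := h.le
    simp only [List.mem_cons, List.not_mem_nil, or_false] at hs ht
    have hsp : A.length ≤ pos (i + q) ∧ pos (i + q) ≤ A.length + 2 := by
      rcases hs with h | h | h <;> rw [h] <;> omega
    have htp : A.length ≤ pos t ∧ pos t ≤ A.length + 2 := by
      rcases ht with rfl | rfl | rfl <;> omega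
    rcases h3 with ⟨a1, a2, a3, a4⟩ | ⟨a1, a2, a3, a4⟩
    · have i1 := hinj (i + m + 1 + q) (by omega) (by omega) y
      have i2 := hinj (i + q) (by omega) (by omega) x
      have i3 := hinj (i + q + 1) (by omega) (by omega) z
      rcases a4 with rfl | a4 <;> omega
    · have i1 := hinj (i + q - 1) (by omega) (by omega) y
      have i2 := hinj (i + q) (by omega) (by omega) z
      have i3 := hinj (i + m + q) (by omega) (by omega) x
      have i4 := h.left (q - 1) (by omega)
      rw [show i + m + 1 + (q - 1) = i + m + q by omega,
        show i + (q - 1) = i + q - 1 by omega] at i4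
      rcases a4 with rfl | a4 <;> omega
  have htri : knuthTriple (dyckCycle i m q x) (dyckCycle i m q y) (dyckCycle i m q z) =
      (knuthTriple x y z).map (dyckCycle i m q) := by
    apply knuthTriple_map <;> apply dyckCycle_lt_iff <;> apply hbad <;> simp
  refine ⟨q, hmem', ?_, ?_⟩
  · clear hmem' htri
    unfold knuthTriple
    split_ifs with c1 c2
    · simp only [List.cons_append, List.nil_append, sw2]
      have h5 := h.small q
      have h6 : 0 < q → pos (i + q - 1) < pos (i + q) :=
        fun hq => h.small_lt (by omega) (by omega) (by have := h.le; omega)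
      apply h.swap py pz hinj (y := x) (by omega) (by omega)
      · rintro ⟨a1, a2, a3, a4⟩
        subst a2 a4
        have := h5 a1
        omega
      · rintro ⟨a1, a2, a3, a4⟩
        have := h6 a1
        rw [show i + q - 1 = z by omega, ← a4] at this
        omega
    · simp only [List.cons_append, List.nil_append, sw1]
      exact h.swap px py hinj (y := z) (by omega) (by omega) (by omega) (by omega)
    · exact h'
  · simp [htri]

/-- Knuth equivalence of words. -/
def KnuthEq : List ℕ → List ℕ → Prop :=
  Relation.ReflTransGen fun w w' => ∃ p, w' = knuthMove p w

theorem KnuthEq.perm {w w' : List ℕ} (h : KnuthEq w w') : w'.Perm w := by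
  induction h with
  | refl => exact List.Perm.refl _
  | tail _ h ih => obtain ⟨p, rfl⟩ := h; exact (knuthMove_perm _ _).trans ih

theorem KnuthEq.symm {w w' : List ℕ} (h : KnuthEq w w') : KnuthEq w' w := by
  induction h with
  | refl => exact Relation.ReflTransGen.refl
  | tail _ h ih =>
    obtain ⟨p, rfl⟩ := h
    exact Relation.ReflTransGen.head ⟨p, (knuthMove_knuthMove p _).symm⟩ ih

theorem KnuthEq.trans {u v w : List ℕ} (h : KnuthEq u v) (h' : KnuthEq v w) : KnuthEq u w :=
  Relation.ReflTransGen.trans h h'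

theorem knuthMove_append_right {p : ℕ} {l : List ℕ} (B : List ℕ) (h : knuthMove p l ≠ l) :
    knuthMove p (l ++ B) = knuthMove p l ++ B := by
  rcases knuthMove_eq_or p l with h' | ⟨A, x, y, z, C, rfl, rfl⟩
  · exact absurd (h' l rfl) h
  · rw [knuthMove_append_triple, List.append_assoc, List.cons_append, List.cons_append,
      List.cons_append, knuthMove_append_triple]
    simp

theorem KnuthEq.append {w w' : List ℕ} (h : KnuthEq w w') (A B : List ℕ) :
    KnuthEq (A ++ (w ++ B)) (A ++ (w' ++ B)) := by
  induction h with
  | refl => exact Relation.ReflTransGen.refl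
  | @tail b c _ h ih =>
    obtain ⟨p, rfl⟩ := h
    by_cases hp : knuthMove p b = b
    · rwa [hp]
    · refine Relation.ReflTransGen.tail ih ⟨A.length + p, ?_⟩
      rw [knuthMove_append, knuthMove_append_right B hp]

/-- A Knuth equivalence between two words extends to a bijection of the set of all words that is
compatible with Dyck moves: it performs the same Knuth transformations at the same positions. -/
theorem KnuthEq.exists_bijective {w w' : List ℕ} (h : KnuthEq w w') :
    ∃ K : List ℕ → List ℕ, Function.Bijective K ∧ K w = w' ∧ (∀ u, (K u).Perm u) ∧
      ∀ (i m : ℕ) (u v : List ℕ), u.Nodup → v.Nodup →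
        (DyckMove i m u v ↔ DyckMove i m (K u) (K v)) := by
  induction h with
  | refl =>
    exact ⟨id, Function.bijective_id, rfl, fun u => List.Perm.refl _, fun _ _ _ _ _ _ => Iff.rfl⟩
  | tail _ h ih =>
    obtain ⟨p, rfl⟩ := h
    obtain ⟨K, h1, h2, h3, h4⟩ := ih
    refine ⟨fun u => CrystalSkeleton.knuthMove p (K u), ?_, by simp only [h2],
      fun u => (knuthMove_perm _ _).trans (h3 u), fun i m u v hu hv => (h4 i m u v hu hv).trans ?_⟩
    · exact (Function.Involutive.bijective (knuthMove_knuthMove p)).comp h1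
    · have hu' := (h3 u).nodup_iff.2 hu
      refine ⟨fun h => h.knuthMove hu' p, fun h => ?_⟩
      have := h.knuthMove ((knuthMove_perm p _).nodup_iff.2 hu') p
      rwa [knuthMove_knuthMove, knuthMove_knuthMove] at this

/-! ### Knuth equivalence of two-row words -/

theorem KnuthEq.refl (w : List ℕ) : KnuthEq w w := Relation.ReflTransGen.refl

theorem KnuthEq.cons {w w' : List ℕ} (h : KnuthEq w w') (x : ℕ) : KnuthEq (x :: w) (x :: w') := by
  simpa using h.append [x] []

theorem KnuthEq.append_left {w w' : List ℕ} (h : KnuthEq w w') (A : List ℕ) :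
    KnuthEq (A ++ w) (A ++ w') := by
  simpa using h.append A []

theorem KnuthEq.append_right {w w' : List ℕ} (h : KnuthEq w w') (B : List ℕ) :
    KnuthEq (w ++ B) (w' ++ B) := by
  simpa using h.append [] B

theorem knuthEq_bca {a b c : ℕ} (hab : a < b) (hbc : b < c) (B : List ℕ) :
    KnuthEq (b :: c :: a :: B) (b :: a :: c :: B) := by
  refine Relation.ReflTransGen.single ⟨0, ?_⟩
  simp [knuthMove, knuthTriple, hab, hbc]

theorem knuthEq_cab {a b c : ℕ} (hab : a < b) (hbc : b < c) (B : List ℕ) :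
    KnuthEq (c :: a :: b :: B) (a :: c :: b :: B) := by
  refine Relation.ReflTransGen.single ⟨0, ?_⟩
  simp only [knuthMove, knuthTriple]
  rw [if_neg (by omega), if_pos (by omega)]
  rfl

/-- A small letter moves to the left through an increasing row until it stands behind the first
letter. -/
theorem knuthEq_cons_append_singleton {a c : ℕ} {R : List ℕ} (hR : (a :: R).Pairwise (· < ·))
    (hc : c < a) : KnuthEq (a :: (R ++ [c])) (a :: c :: R) := by
  induction R generalizing a with
  | nil => exact KnuthEq.refl _
  | cons z R ih =>
    have haz : a < z := (List.pairwise_cons.1 hR).1 z (by simp)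
    have h1 := (ih (List.pairwise_cons.1 hR).2 (hc.trans haz)).cons a
    exact h1.trans (knuthEq_bca hc haz R)

/-- A large letter moves to the right through an increasing row until it stands in front of the last
letter. -/
theorem knuthEq_cons_append_pair {b d : ℕ} {R : List ℕ} (hR : (R ++ [d]).Pairwise (· < ·))
    (hd : d < b) : KnuthEq (b :: (R ++ [d])) (R ++ [b, d]) := by
  induction R with
  | nil => exact KnuthEq.refl _
  | cons x R ih =>
    have h1 := (ih (List.pairwise_cons.1 hR).2).cons x
    refine KnuthEq.trans ?_ h1
    have hx := (List.pairwise_cons.1 hR).1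
    cases R with
    | nil => exact knuthEq_cab (hx d (by simp)) hd []
    | cons x2 R =>
      have hR2 := (List.pairwise_cons.1 (List.pairwise_cons.1 hR).2).1 d (by simp)
      exact knuthEq_cab (hx x2 (by simp)) (hR2.trans hd) (R ++ [d])

/-- The entries of the row `f` in the columns `L`, where `0` means that there is no entry. -/
def entries (f : ℕ → ℕ) (L : List ℕ) : List ℕ := (L.map f).filter (· ≠ 0)

theorem entries_append (f : ℕ → ℕ) (L L' : List ℕ) :
    entries f (L ++ L') = entries f L ++ entries f L' := by simp [entries]

theorem entries_cons_zero {f : ℕ → ℕ} {k : ℕ} (h : f k = 0) (L : List ℕ) :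
    entries f (k :: L) = entries f L := by simp [entries, h]

theorem entries_cons_ne {f : ℕ → ℕ} {k : ℕ} (h : f k ≠ 0) (L : List ℕ) :
    entries f (k :: L) = f k :: entries f L := by simp [entries, h]

theorem entries_congr {f g : ℕ → ℕ} {L : List ℕ} (h : ∀ k ∈ L, f k = g k) :
    entries f L = entries g L := by
  rw [entries, entries, List.map_congr_left h]

/-- The rows `fa` and `fc`, with `fc` below `fa`, occupy the columns `L`.  The remainder `V` of the
upper row can be moved across the lower row: both words are equivalent to the column reading of the
columns `L`, followed by `V`. -/
theorem knuthEq_left_columns (V : List ℕ) (fa fc : ℕ → ℕ) (L : List ℕ)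
    (hdom : ∀ k ∈ L, fc k ≠ 0 → fa k ≠ 0 ∧ fc k < fa k)
    (hA : (entries fa L ++ V).Pairwise (· < ·)) :
    KnuthEq (entries fa L ++ (V ++ entries fc L)) (entries fa L ++ (entries fc L ++ V)) := by
  have key : ∀ V : List ℕ, (entries fa L ++ V).Pairwise (· < ·) →
      KnuthEq (entries fa L ++ (V ++ entries fc L))
        (L.flatMap (fun k => entries fa [k] ++ entries fc [k]) ++ V) := by
    clear hA V
    intro V hA
    induction L with
    | nil => simp [entries]; exact KnuthEq.refl _
    | cons k L ih =>
      have ih := ih (fun k hk => hdom k (by simp [hk]))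
      by_cases ha : fa k = 0
      · have hc : fc k = 0 := by
          by_contra hc
          exact (hdom k (by simp) hc).1 ha
        rw [entries_cons_zero ha] at hA ⊢
        rw [entries_cons_zero hc]
        simpa [entries, ha, hc] using ih hA
      · rw [entries_cons_ne ha] at hA ⊢
        have ih' := ih (List.pairwise_cons.1 hA).2
        by_cases hc : fc k = 0
        · rw [entries_cons_zero hc]
          simpa [entries, ha, hc] using ih'.cons (fa k)
        · rw [entries_cons_ne hc]
          have h1 := knuthEq_cons_append_singleton hA (hdom k (by simp) hc).2
          have h2 := h1.append_right (entries fc L)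
          refine KnuthEq.trans ?_ (KnuthEq.trans h2 ?_)
          · simp; exact KnuthEq.refl _
          · simpa [entries, ha, hc] using (ih'.cons (fc k)).cons (fa k)
  have h1 := key V hA
  have h2 := (key [] (by simpa using hA.sublist (List.sublist_append_left _ _))).append_right V
  simp only [List.nil_append, List.append_nil, List.append_assoc] at h2
  exact h1.trans h2.symm

/-- The rows `fb` and `fd`, with `fd` below `fb`, occupy the columns `L`.  The letter `y` moves from
the front of the upper row to the front of the lower row. -/
theorem knuthEq_right_columns (y : ℕ) (fb fd : ℕ → ℕ) (L : List ℕ)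
    (hdom : ∀ k ∈ L, fb k ≠ 0 → fd k ≠ 0 ∧ fd k < fb k)
    (hD : (y :: entries fd L).Pairwise (· < ·)) :
    KnuthEq (y :: (entries fb L ++ entries fd L)) (entries fb L ++ y :: entries fd L) := by
  induction L using List.reverseRecOn with
  | nil => simp [entries]; exact KnuthEq.refl _
  | append_singleton L k ih =>
    rw [entries_append, entries_append] at *
    have ih := ih (fun k hk => hdom k (by simp [hk])) (hD.sublist (by simp))
    by_cases hb : fb k = 0
    · have e1 : entries fb [k] = [] := by simp [entries, hb]
      rw [e1]
      simpa using ih.append_right (entries fd [k])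
    · obtain ⟨hd, hlt⟩ := hdom k (by simp) hb
      have e1 : entries fb [k] = [fb k] := by simp [entries, hb]
      have e2 : entries fd [k] = [fd k] := by simp [entries, hd]
      rw [e2] at hD
      rw [e1, e2]
      have h1 := (knuthEq_cons_append_pair (R := entries fd L)
        (d := fd k) (List.pairwise_cons.1 hD).2 hlt).append_left (y :: entries fb L)
      have h2 := (knuthEq_cons_append_pair (R := y :: entries fd L) hD hlt).append_left
        (entries fb L)
      have h3 := ih.append_right [fb k, fd k]
      refine KnuthEq.trans ?_ (h1.trans (KnuthEq.trans ?_
        (h3.trans (KnuthEq.trans ?_ h2.symm |>.trans ?_))))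
      all_goals simp; try exact KnuthEq.refl _

/-- A vertical step of a slide preserves the Knuth class of the reading word: the entry `y` moves
from the row `f₁` down into the row `f₀`, between the columns `L` on the left and `R` on the right.
-/
theorem knuthEq_two_rows (y : ℕ) (f₁ f₀ : ℕ → ℕ) (L R : List ℕ)
    (hL : ∀ k ∈ L, f₀ k ≠ 0 → f₁ k ≠ 0 ∧ f₀ k < f₁ k)
    (hR : ∀ k ∈ R, f₁ k ≠ 0 → f₀ k ≠ 0 ∧ f₀ k < f₁ k)
    (h1 : (entries f₁ L ++ y :: entries f₁ R).Pairwise (· < ·))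
    (h0 : (y :: entries f₀ R).Pairwise (· < ·)) :
    KnuthEq ((entries f₁ L ++ y :: entries f₁ R) ++ (entries f₀ L ++ entries f₀ R))
      ((entries f₁ L ++ entries f₁ R) ++ (entries f₀ L ++ y :: entries f₀ R)) := by
  have a1 := (knuthEq_left_columns (y :: entries f₁ R) f₁ f₀ L hL h1).append_right (entries f₀ R)
  have a2 := (knuthEq_left_columns (entries f₁ R) f₁ f₀ L hL
    (h1.sublist (by simp))).append_right (y :: entries f₀ R)
  have a3 := (knuthEq_right_columns y f₁ f₀ R hR h0).append_left (entries f₁ L ++ entries f₀ L)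
  simp only [List.append_assoc, List.cons_append] at a1 a2 a3 ⊢
  exact a1.trans (a3.trans a2.symm)

/-! ### Jeu de taquin slides preserve the Knuth class -/

/-- The row reading word of a filling of the box `[0, N) × [0, N)`, in which `0` means that there is
no entry. -/
def fillingWord (N : ℕ) (f : ℕ × ℕ → ℕ) : List ℕ :=
  (List.range N).reverse.flatMap fun r => entries (fun k => f (r, k)) (List.range N)

/-- The filling `f` has distinct entries, increases along rows and columns, and fills a skew shape
except for its cell `h`, which is left empty.  The skew shape is recorded by its convexity for the
componentwise order on cells. -/
structure Punctured (f : ℕ × ℕ → ℕ) (h : ℕ × ℕ) : Prop where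
  hole : f h = 0
  convex : ∀ x y z, x ≤ y → y ≤ z → f x ≠ 0 ∨ x = h → f z ≠ 0 ∨ z = h → f y ≠ 0 ∨ y = h
  row : ∀ r k k', k < k' → f (r, k) ≠ 0 → f (r, k') ≠ 0 → f (r, k) < f (r, k')
  col : ∀ r r' k, r < r' → f (r, k) ≠ 0 → f (r', k) ≠ 0 → f (r, k) < f (r', k)
  inj : ∀ x y, f x ≠ 0 → f x = f y → x = y

/-- The filling `f` after the entry of the cell `h'` has been moved into the empty cell `h`. -/
def moveHole (f : ℕ × ℕ → ℕ) (h h' : ℕ × ℕ) : ℕ × ℕ → ℕ :=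
  Function.update (Function.update f h (f h')) h' 0

theorem moveHole_apply {f : ℕ × ℕ → ℕ} {h h' : ℕ × ℕ} (x : ℕ × ℕ) :
    moveHole f h h' x = if x = h' then 0 else if x = h then f h' else f x := by
  simp [moveHole, Function.update_apply]

theorem moveHole_support {f : ℕ × ℕ → ℕ} {h h' : ℕ × ℕ} (hh' : f h' ≠ 0) (hne : h ≠ h')
    (x : ℕ × ℕ) : (moveHole f h h' x ≠ 0 ∨ x = h') ↔ (f x ≠ 0 ∨ x = h) := by
  rw [moveHole_apply]
  split_ifs with h1 h2
  · subst h1; simp [hh']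
  · subst h2; simp [hh']
  · simp [h1, h2]

theorem moveHole_ne_zero {f : ℕ × ℕ → ℕ} {h h' x : ℕ × ℕ} (hx : moveHole f h h' x ≠ 0) :
    (x = h ∧ moveHole f h h' x = f h') ∨
      (x ≠ h' ∧ f x ≠ 0 ∧ moveHole f h h' x = f x) := by
  rw [moveHole_apply] at *
  split_ifs at * with a1 a2
  · exact absurd rfl hx
  · exact Or.inl ⟨a2, rfl⟩
  · exact Or.inr ⟨a1, hx, rfl⟩

theorem moveHole_inj {f : ℕ × ℕ → ℕ} {h h' : ℕ × ℕ} (hf : Punctured f h) (hh' : f h' ≠ 0)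
    (x y : ℕ × ℕ) (hx : moveHole f h h' x ≠ 0)
    (hxy : moveHole f h h' x = moveHole f h h' y) : x = y := by
  rcases moveHole_ne_zero hx with ⟨rfl, h1⟩ | ⟨h1, h2, h3⟩ <;>
  rcases moveHole_ne_zero (hxy ▸ hx) with ⟨rfl, h4⟩ | ⟨h4, h5, h6⟩
  · rfl
  · exact absurd (hf.inj _ _ hh' (by rw [← h1, hxy, h6])).symm h4
  · exact absurd (hf.inj _ _ h2 (by rw [← h3, hxy, h4])) h1
  · exact hf.inj _ _ h2 (by rw [← h3, hxy, h6])

theorem Punctured.up {f : ℕ × ℕ → ℕ} {r k : ℕ} (hf : Punctured f (r, k))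
    (hup : f (r + 1, k) ≠ 0) (hle : f (r, k + 1) = 0 ∨ f (r + 1, k) ≤ f (r, k + 1)) :
    Punctured (moveHole f (r, k) (r + 1, k)) (r + 1, k) := by
  have hsupp := moveHole_support (f := f) (h := (r, k)) hup (by simp)
  have hhole := hf.hole
  refine ⟨by simp [moveHole_apply], ?_, ?_, ?_, moveHole_inj hf hup⟩
  · intro x y z hxy hyz hx hz
    rw [hsupp] at hx hz ⊢
    exact hf.convex x y z hxy hyz hx hz
  · intro r' a b hab ha hb
    rcases moveHole_ne_zero ha with ⟨a1, a2⟩ | ⟨a1, a2, a3⟩ <;>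
    rcases moveHole_ne_zero hb with ⟨b1, b2⟩ | ⟨b1, b2, b3⟩ <;>
    simp only [Prod.mk.injEq, ne_eq] at a1 b1
    · omega
    · rw [a2, b3]
      clear ha hb
      have hb := b2
      obtain ⟨rfl, rfl⟩ := a1
      have h1 := hf.convex (r', a) (r', a + 1) (r', b) (by simp) (by simp; omega) (by simp)
        (by simp [hb])
      simp at h1
      have h2 : f (r', a + 1) ≤ f (r', b) := by
        rcases Nat.lt_or_ge (a + 1) b with h | h
        · exact (hf.row _ _ _ h h1 hb).le
        · rw [show b = a + 1 by omega]
      have h3 : f (r' + 1, a) ≠ f (r', a + 1) := by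
        intro h
        have := hf.inj _ _ hup h
        simp at this
      omega
    · rw [a3, b2]
      clear ha hb
      have ha := a2
      obtain ⟨rfl, rfl⟩ := b1
      have h1 := hf.convex (r', a) (r' + 1, a) (r' + 1, b) (by simp) (by simp; omega) (by simp [ha])
        (by simp [hup])
      simp at h1
      exact (hf.col _ _ _ (by omega) ha h1).trans (hf.row _ _ _ hab h1 hup)
    · rw [a3, b3]
      exact hf.row _ _ _ hab a2 b2
  · intro a b c hab ha hb
    rcases moveHole_ne_zero ha with ⟨a1, a2⟩ | ⟨a1, a2, a3⟩ <;>
    rcases moveHole_ne_zero hb with ⟨b1, b2⟩ | ⟨b1, b2, b3⟩ <;>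
    simp only [Prod.mk.injEq, ne_eq] at a1 b1
    · omega
    · rw [a2, b3]
      clear ha hb
      have hb := b2
      obtain ⟨rfl, rfl⟩ := a1
      exact hf.col _ _ _ (by omega) hup hb
    · rw [a3, b2]
      clear ha hb
      have ha := a2
      obtain ⟨rfl, rfl⟩ := b1
      exact hf.col _ _ _ (by omega) ha hup
    · rw [a3, b3]
      exact hf.col _ _ _ hab a2 b2

theorem Punctured.right {f : ℕ × ℕ → ℕ} {r k : ℕ} (hf : Punctured f (r, k))
    (hright : f (r, k + 1) ≠ 0) (hlt : f (r + 1, k) = 0 ∨ f (r, k + 1) < f (r + 1, k)) :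
    Punctured (moveHole f (r, k) (r, k + 1)) (r, k + 1) := by
  have hsupp := moveHole_support (f := f) (h := (r, k)) hright (by simp)
  have hhole := hf.hole
  refine ⟨by simp [moveHole_apply], ?_, ?_, ?_, moveHole_inj hf hright⟩
  · intro x y z hxy hyz hx hz
    rw [hsupp] at hx hz ⊢
    exact hf.convex x y z hxy hyz hx hz
  · intro c a b hab ha hb
    rcases moveHole_ne_zero ha with ⟨a1, a2⟩ | ⟨a1, a2, a3⟩ <;>
    rcases moveHole_ne_zero hb with ⟨b1, b2⟩ | ⟨b1, b2, b3⟩ <;>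
    simp only [Prod.mk.injEq, ne_eq] at a1 b1
    · omega
    · rw [a2, b3]
      clear ha hb
      have hb := b2
      obtain ⟨rfl, rfl⟩ := a1
      exact hf.row _ _ _ (by omega) hright hb
    · rw [a3, b2]
      clear ha hb
      have ha := a2
      obtain ⟨rfl, rfl⟩ := b1
      exact hf.row _ _ _ (by omega) ha hright
    · rw [a3, b3]
      exact hf.row _ _ _ hab a2 b2
  · intro a b c hab ha hb
    rcases moveHole_ne_zero ha with ⟨a1, a2⟩ | ⟨a1, a2, a3⟩ <;>
    rcases moveHole_ne_zero hb with ⟨b1, b2⟩ | ⟨b1, b2, b3⟩ <;>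
    simp only [Prod.mk.injEq, ne_eq] at a1 b1
    · omega
    · rw [a2, b3]
      clear ha hb
      have hb := b2
      obtain ⟨rfl, rfl⟩ := a1
      have h1 := hf.convex (a, c) (a + 1, c) (b, c) (by simp) (by simp; omega) (by simp)
        (by simp [hb])
      simp at h1
      have h2 : f (a + 1, c) ≤ f (b, c) := by
        rcases Nat.lt_or_ge (a + 1) b with h | h
        · exact (hf.col _ _ _ h h1 hb).le
        · rw [show b = a + 1 by omega]
      omega
    · rw [a3, b2]
      clear ha hb
      have ha := a2
      obtain ⟨rfl, rfl⟩ := b1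
      have h1 := hf.convex (a, c) (a, c + 1) (b, c + 1) (by simp) (by simp; omega) (by simp [ha])
        (by simp [hright])
      simp at h1
      exact (hf.row _ _ _ (by omega) ha h1).trans (hf.col _ _ _ hab h1 hright)
    · rw [a3, b3]
      exact hf.col _ _ _ hab a2 b2

theorem entries_range_split (f : ℕ → ℕ) {N k : ℕ} (hk : k < N) :
    entries f (List.range N) = entries f (List.range k) ++ (entries f [k] ++
      entries f (List.range' (k + 1) (N - (k + 1)))) := by
  rw [← entries_append, ← entries_append]
  congr 1
  rw [List.range_eq_range', List.range_eq_range', ← List.range'_one (s := k), List.range'_append_1]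
  have := List.range'_append_1 (s := 0) (m := k) (n := 1 + (N - (k + 1)))
  rw [Nat.zero_add] at this
  rw [this]
  congr 1
  omega

theorem entries_pairwise {f : ℕ → ℕ} {L : List ℕ} (hL : L.Pairwise (· < ·))
    (hf : ∀ a ∈ L, ∀ b ∈ L, a < b → f a ≠ 0 → f b ≠ 0 → f a < f b) :
    (entries f L).Pairwise (· < ·) := by
  rw [entries, List.pairwise_filter, List.pairwise_map]
  refine hL.imp_of_mem ?_
  intro a b ha hb hab h1 h2
  exact hf a ha b hb hab (by simpa using h1) (by simpa using h2)

/-- A horizontal step of a slide does not change the reading word. -/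
theorem fillingWord_moveHole_right {N : ℕ} {f : ℕ × ℕ → ℕ} {r k : ℕ} (hf : f (r, k) = 0)
    (hN : r < N ∧ k + 1 < N) :
    fillingWord N (moveHole f (r, k) (r, k + 1)) = fillingWord N f := by
  unfold fillingWord
  congr 1
  funext a
  by_cases ha : a = r
  · subst ha
    rw [entries_range_split _ hN.2, entries_range_split _ (show k < k + 1 by omega),
      entries_range_split (fun b => f (a, b)) hN.2,
      entries_range_split (fun b => f (a, b)) (show k < k + 1 by omega)]
    have e1 : entries (fun b => moveHole f (a, k) (a, k + 1) (a, b)) (List.range k) =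
        entries (fun b => f (a, b)) (List.range k) := by
      apply entries_congr
      intro b hb
      rw [List.mem_range] at hb
      rw [moveHole_apply, if_neg (by simp; omega), if_neg (by simp; omega)]
    have e2 : entries (fun b => moveHole f (a, k) (a, k + 1) (a, b))
        (List.range' (k + 1 + 1) (N - (k + 1 + 1))) = entries (fun b => f (a, b))
          (List.range' (k + 1 + 1) (N - (k + 1 + 1))) := by
      apply entries_congr
      intro b hb
      rw [List.mem_range'_1] at hb
      rw [moveHole_apply, if_neg (by simp; omega), if_neg (by simp; omega)]
    rw [e1, e2]
    simp [entries, moveHole_apply, hf]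
  · apply entries_congr
    intro b hb
    rw [moveHole_apply, if_neg (by simp [ha]), if_neg (by simp [ha])]

theorem fillingWord_moveHole_up {N : ℕ} {f : ℕ × ℕ → ℕ} {r k : ℕ} (hf : Punctured f (r, k))
    (hup : f (r + 1, k) ≠ 0) (hle : f (r, k + 1) = 0 ∨ f (r + 1, k) ≤ f (r, k + 1))
    (hN : r + 1 < N ∧ k < N) :
    KnuthEq (fillingWord N f) (fillingWord N (moveHole f (r, k) (r + 1, k))) := by
  have hg := hf.up hup hle
  set g := moveHole f (r, k) (r + 1, k) with hgdef
  have hsplit : (List.range N).reverse = (List.range' (r + 2) (N - (r + 2))).reverse ++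
      (r + 1) :: r :: (List.range r).reverse := by
    have h1 := List.range'_append_1 (s := 0) (m := r) (n := 2 + (N - (r + 2)))
    have h2 := List.range'_append_1 (s := r) (m := 2) (n := N - (r + 2))
    rw [Nat.zero_add] at h1
    rw [List.range_eq_range', List.range_eq_range',
      show N = r + (2 + (N - (r + 2))) by omega, ← h1, ← h2]
    simp [List.range'_succ]
    omega
  have hoff : ∀ L : List ℕ, (∀ a ∈ L, a ≠ r ∧ a ≠ r + 1) →
      L.flatMap (fun r => entries (fun k => g (r, k)) (List.range N)) =
        L.flatMap (fun r => entries (fun k => f (r, k)) (List.range N)) := by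
    intro L hL
    induction L with
    | nil => rfl
    | cons a L ih =>
      rw [List.flatMap_cons, List.flatMap_cons, ih fun b hb => hL b (by simp [hb])]
      congr 1
      apply entries_congr
      intro b hb
      have := hL a (by simp)
      rw [hgdef, moveHole_apply, if_neg (by simp; omega), if_neg (by simp; omega)]
  have hoff' : ∀ a b, b ≠ k → g (a, b) = f (a, b) := by
    intro a b hb
    rw [hgdef, moveHole_apply, if_neg (by simp; omega), if_neg (by simp; omega)]
  have hL : ∀ a, entries (fun b => g (a, b)) (List.range k) =
      entries (fun b => f (a, b)) (List.range k) := by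
    intro a
    apply entries_congr
    intro b hb
    rw [List.mem_range] at hb
    exact hoff' a b (by omega)
  have hR : ∀ a, entries (fun b => g (a, b)) (List.range' (k + 1) (N - (k + 1))) =
      entries (fun b => f (a, b)) (List.range' (k + 1) (N - (k + 1))) := by
    intro a
    apply entries_congr
    intro b hb
    rw [List.mem_range'_1] at hb
    exact hoff' a b (by omega)
  have f0 : entries (fun b => f (r, b)) [k] = [] := by simp [entries, hf.hole]
  have f1 : entries (fun b => f (r + 1, b)) [k] = [f (r + 1, k)] := by simp [entries, hup]
  have g1 : entries (fun b => g (r + 1, b)) [k] = [] := by simp [entries, hg.hole]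
  have gk : g (r, k) = f (r + 1, k) := by simp [hgdef, moveHole_apply]
  have g0 : entries (fun b => g (r, b)) [k] = [f (r + 1, k)] := by simp [entries, hup, gk]
  unfold fillingWord
  rw [hsplit, List.flatMap_append, List.flatMap_append, List.flatMap_cons, List.flatMap_cons,
    List.flatMap_cons, List.flatMap_cons, hoff, hoff]
  rotate_left
  · intro a ha; simp at ha; omega
  · intro a ha; simp at ha; omega
  refine KnuthEq.append_left ?_ _
  rw [← List.append_assoc, ← List.append_assoc]
  refine KnuthEq.append_right ?_ _
  have e1 := entries_range_split (fun b => f (r + 1, b)) hN.2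
  have e0 := entries_range_split (fun b => f (r, b)) hN.2
  have e1' := entries_range_split (fun b => g (r + 1, b)) hN.2
  have e0' := entries_range_split (fun b => g (r, b)) hN.2
  have sortedRange : (List.range N).Pairwise (· < ·) := List.pairwise_lt_range
  have p1 : (entries (fun b => f (r + 1, b)) (List.range N)).Pairwise (· < ·) :=
    entries_pairwise sortedRange fun a _ b _ hab => hf.row _ _ _ hab
  have p0 : (entries (fun b => g (r, b)) (List.range N)).Pairwise (· < ·) :=
    entries_pairwise sortedRange fun a _ b _ hab => hg.row _ _ _ hab
  rw [f1] at e1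
  rw [f0] at e0
  rw [g1, hL, hR] at e1'
  rw [g0, hL, hR] at e0'
  rw [e1] at p1 ⊢
  rw [e0'] at p0 ⊢
  rw [e0, e1']
  refine knuthEq_two_rows _ _ _ _ _ ?_ ?_ p1 (List.pairwise_append.1 p0).2.1
  · intro b hb hb0
    rw [List.mem_range] at hb
    have h1 := hf.convex (r, b) (r + 1, b) (r + 1, k) (by simp) (by simp; omega) (by simp [hb0])
      (by simp [hup])
    simp at h1
    exact ⟨h1, hf.col _ _ _ (by omega) hb0 h1⟩
  · intro b hb hb0
    rw [List.mem_range'_1] at hb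
    have h1 := hf.convex (r, k) (r, b) (r + 1, b) (by simp; omega) (by simp) (by simp)
      (by simp [hb0])
    have h2 : f (r, b) ≠ 0 := h1.resolve_right (by simp; omega)
    exact ⟨h2, hf.col _ _ _ (by omega) h2 hb0⟩

/-- A slide preserves the Knuth class of the reading word, and it leads to a skew shape again, in
which the hole has become an outer corner. -/
theorem Slide.knuthEq {N : ℕ} {f g : ℕ × ℕ → ℕ} {c : ℕ × ℕ} (h : Slide f c g)
    (hf : Punctured f c) (hN : ∀ x, f x ≠ 0 → x.1 < N ∧ x.2 < N) (hc : c.1 < N ∧ c.2 < N) :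
    KnuthEq (fillingWord N f) (fillingWord N g) ∧ ∃ h, Punctured g h ∧
      (∀ x, (g x ≠ 0 ∨ x = h) ↔ (f x ≠ 0 ∨ x = c)) ∧ g (h.1 + 1, h.2) = 0 ∧
      g (h.1, h.2 + 1) = 0 := by
  have hN' : ∀ c', f c' ≠ 0 → c ≠ c' → ∀ x, moveHole f c c' x ≠ 0 → x.1 < N ∧ x.2 < N := by
    intro c' h1 h2 x hx
    rcases (moveHole_support h1 h2 x).1 (Or.inl hx) with h | rfl
    · exact hN x h
    · exact hc
  induction h with
  | halt f r k hup hright =>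
    exact ⟨KnuthEq.refl _, (r, k), hf, fun x => Iff.rfl, hup, hright⟩
  | up f g r k hup hle h ih =>
    have hf' := hf.up hup hle
    have hs := moveHole_support (f := f) (h := (r, k)) hup (by simp)
    have hb := hN' (r + 1, k) hup (by simp)
    have hc' := hN _ hup
    obtain ⟨h1, h', h2, h3, h4⟩ := ih hf' hb hc' (by
      intro c' h1 h2 x hx
      rcases (moveHole_support h1 h2 x).1 (Or.inl hx) with h | rfl
      · exact hb x h
      · exact hc')
    exact ⟨(fillingWord_moveHole_up hf hup hle hc').trans h1, h', h2,
      fun x => (h3 x).trans (hs x), h4⟩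
  | right f g r k hright hlt h ih =>
    have hf' := hf.right hright hlt
    have hs := moveHole_support (f := f) (h := (r, k)) hright (by simp)
    have hb := hN' (r, k + 1) hright (by simp)
    have hc' := hN _ hright
    obtain ⟨h1, h', h2, h3, h4⟩ := ih hf' hb hc' (by
      intro c' h1 h2 x hx
      rcases (moveHole_support h1 h2 x).1 (Or.inl hx) with h | rfl
      · exact hb x h
      · exact hc')
    refine ⟨?_, h', h2, fun x => (h3 x).trans (hs x), h4⟩
    rw [← fillingWord_moveHole_right hf.hole hc']
    exact h1

/-- The pair `X` of an inner shape and a filling is a skew tableau with distinct entries that fits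
into the box `[0, N) × [0, N)`. -/
structure IsSkewTableau (N : ℕ) (X : YoungDiagram × (ℕ × ℕ → ℕ)) : Prop where
  disj : ∀ x ∈ X.1, X.2 x = 0
  lower : ∀ x z, x ≤ z → X.2 z ≠ 0 → X.2 x ≠ 0 ∨ x ∈ X.1
  row : ∀ r k k', k < k' → X.2 (r, k) ≠ 0 → X.2 (r, k') ≠ 0 → X.2 (r, k) < X.2 (r, k')
  col : ∀ r r' k, r < r' → X.2 (r, k) ≠ 0 → X.2 (r', k) ≠ 0 → X.2 (r, k) < X.2 (r', k)
  inj : ∀ x y, X.2 x ≠ 0 → X.2 x = X.2 y → x = y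
  bound : ∀ x, X.2 x ≠ 0 ∨ x ∈ X.1 → x.1 < N ∧ x.2 < N

theorem IsSkewTableau.jdtStep {N : ℕ} {X Y : YoungDiagram × (ℕ × ℕ → ℕ)}
    (hX : IsSkewTableau N X) (h : JdtStep X Y) :
    IsSkewTableau N Y ∧ KnuthEq (fillingWord N X.2) (fillingWord N Y.2) := by
  obtain ⟨c, hc, hcells, hslide⟩ := h
  have hY : ∀ x, x ∈ Y.1 ↔ x ≠ c ∧ x ∈ X.1 := by
    intro x
    rw [← YoungDiagram.mem_cells, hcells, Finset.mem_erase, YoungDiagram.mem_cells]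
  have hp : Punctured X.2 c := by
    refine ⟨hX.disj c hc, ?_, hX.row, hX.col, hX.inj⟩
    intro x y z hxy hyz hx hz
    by_contra hy
    push Not at hy
    have hyX : y ∈ X.1 := by
      rcases hz with hz | rfl
      · exact (hX.lower y z hyz hz).resolve_left (by simp [hy.1])
      · exact X.1.isLowerSet hyz hc
    have hyY : y ∈ Y.1 := (hY y).2 ⟨hy.2, hyX⟩
    have hxY : x ∈ Y.1 := Y.1.isLowerSet hxy hyY
    have hx2 := (hY x).1 hxY
    exact hx.elim (fun h => h (hX.disj x hx2.2)) hx2.1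
  obtain ⟨hk, h, hg, hs, hu, hr⟩ := hslide.knuthEq hp (fun x hx => hX.bound x (Or.inl hx))
    (hX.bound c (Or.inr hc))
  refine ⟨⟨?_, ?_, hg.row, hg.col, hg.inj, ?_⟩, hk⟩
  · intro x hx
    have hx2 := (hY x).1 hx
    by_contra h0
    rcases (hs x).1 (Or.inl h0) with h | h
    · exact h (hX.disj x hx2.2)
    · exact hx2.1 h
  · intro x z hxz hz
    have h1 : X.2 x ≠ 0 ∨ x ∈ X.1 := by
      rcases (hs z).1 (Or.inl hz) with h | rfl
      · exact hX.lower x z hxz h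
      · exact Or.inr (X.1.isLowerSet hxz hc)
    by_cases hxc : X.2 x ≠ 0 ∨ x = c
    · rcases (hs x).2 hxc with h2 | rfl
      · exact Or.inl h2
      · exfalso
        have hxz' : x ≠ z := fun h => hz (h ▸ hg.hole)
        obtain ⟨a, b⟩ := x
        obtain ⟨a', b'⟩ := z
        simp only [ne_eq, Prod.mk.injEq, Prod.mk_le_mk] at hxz hxz'
        by_cases hab : a < a'
        · have := hg.convex (a, b) (a + 1, b) (a', b') (by simp) (by simp; omega) (by simp)
            (Or.inl hz)
          simp [hu] at this
        · have := hg.convex (a, b) (a, b + 1) (a', b') (by simp) (by simp; omega) (by simp)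
            (Or.inl hz)
          simp [hr] at this
    · push Not at hxc
      exact Or.inr ((hY x).2 ⟨hxc.2, h1.resolve_left (by simp [hxc.1])⟩)
  · intro x hx
    rcases hx with hx | hx
    · rcases (hs x).1 (Or.inl hx) with h | rfl
      · exact hX.bound x (Or.inl h)
      · exact hX.bound x (Or.inr hc)
    · exact hX.bound x (Or.inr ((hY x).1 hx).2)

theorem IsSkewTableau.reflTransGen {N : ℕ} {X Y : YoungDiagram × (ℕ × ℕ → ℕ)}
    (hX : IsSkewTableau N X) (h : Relation.ReflTransGen JdtStep X Y) :
    IsSkewTableau N Y ∧ KnuthEq (fillingWord N X.2) (fillingWord N Y.2) := by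
  induction h with
  | refl => exact ⟨hX, KnuthEq.refl _⟩
  | tail _ h ih =>
    obtain ⟨h1, h2⟩ := ih.1.jdtStep h
    exact ⟨h1, ih.2.trans h2⟩

/-! ### Insertion tableaux and Dyck patterns -/

/-- The reading word of a tableau that is given by its list of rows, starting with row `0`. -/
def rowsWord (P : List (List ℕ)) : List ℕ := P.reverse.flatten

theorem rowsWord_cons (R : List ℕ) (P : List (List ℕ)) :
    rowsWord (R :: P) = rowsWord P ++ R := by simp [rowsWord]

theorem rowInsert_none {x : ℕ} {R R' : List ℕ} (h : rowInsert x R = (R', none)) :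
    R' = R ++ [x] ∧ ∀ y ∈ R, y ≤ x := by
  induction R generalizing R' with
  | nil => simp [rowInsert] at h; simp [← h]
  | cons y R ih =>
    rw [rowInsert] at h
    split_ifs at h with hxy
    · simp at h
    · simp only [Prod.mk.injEq] at h
      obtain ⟨h1, h2⟩ := ih (R' := (rowInsert x R).1) (by rw [← h.2])
      rw [h1] at h
      refine ⟨by simp [← h.1], ?_⟩
      intro z hz
      rcases List.mem_cons.1 hz with rfl | hz
      · omega
      · exact h2 z hz

theorem rowInsert_some {x y : ℕ} {R R' : List ℕ} (h : rowInsert x R = (R', some y)) :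
    ∃ A B, R = A ++ y :: B ∧ R' = A ++ x :: B ∧ x < y ∧ ∀ z ∈ A, z ≤ x := by
  induction R generalizing R' with
  | nil => simp [rowInsert] at h
  | cons z R ih =>
    rw [rowInsert] at h
    split_ifs at h with hxz
    · simp only [Prod.mk.injEq, Option.some.injEq] at h
      obtain ⟨rfl, rfl⟩ := h
      exact ⟨[], R, rfl, rfl, hxz, by simp⟩
    · simp only [Prod.mk.injEq] at h
      obtain ⟨A, B, h1, h2, h3, h4⟩ := ih (R' := (rowInsert x R).1) (by rw [← h.2])
      refine ⟨z :: A, B, by simp [h1], by simp [← h.1, h2], h3, ?_⟩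
      intro t ht
      rcases List.mem_cons.1 ht with rfl | ht
      · omega
      · exact h4 t ht

theorem knuthEq_rowInsert {x y : ℕ} {A B : List ℕ} (hR : (A ++ y :: B).Pairwise (· < ·))
    (hA : (A ++ [x]).Pairwise (· < ·)) (hxy : x < y) :
    KnuthEq ((A ++ y :: B) ++ [x]) (y :: (A ++ x :: B)) := by
  have h1 := (knuthEq_cons_append_singleton (List.pairwise_append.1 hR).2.1 hxy).append_left A
  have h2 := (knuthEq_cons_append_pair hA hxy).append_right B
  simp only [List.append_assoc, List.cons_append, List.nil_append] at h1 h2 ⊢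
  exact h1.trans h2.symm

theorem knuthEq_tableauInsert (P : List (List ℕ)) (x : ℕ)
    (hP : ∀ R ∈ P, R.Pairwise (· < ·)) (hnd : (rowsWord P ++ [x]).Nodup) :
    KnuthEq (rowsWord P ++ [x]) (rowsWord (tableauInsert x P)) ∧
      ∀ R ∈ tableauInsert x P, R.Pairwise (· < ·) := by
  induction P generalizing x with
  | nil => simp [tableauInsert, rowsWord]; exact KnuthEq.refl _
  | cons R P ih =>
    rw [rowsWord_cons] at hnd ⊢
    have hR := hP R (by simp)
    have hx : ∀ y ∈ R, y ≠ x := by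
      intro y hy
      exact (List.nodup_append.1 hnd).2.2 y (by simp [hy]) x (by simp)
    rw [tableauInsert]
    split
    · next R' heq =>
      obtain ⟨rfl, h2⟩ := rowInsert_none heq
      refine ⟨by rw [rowsWord_cons, List.append_assoc]; exact KnuthEq.refl _, ?_⟩
      intro S hS
      rcases List.mem_cons.1 hS with rfl | hS
      · refine List.pairwise_append.2 ⟨hR, by simp, ?_⟩
        intro a ha b hb
        have h3 := h2 a ha
        have h4 := hx a ha
        simp only [List.mem_singleton] at hb
        omega
      · exact hP S (by simp [hS])
    · next R' y heq =>
      obtain ⟨A, B, rfl, rfl, hxy, hA⟩ := rowInsert_some heq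
      have hAx : ∀ z ∈ A, z < x := fun z hz =>
        lt_of_le_of_ne (hA z hz) (hx z (by simp [hz]))
      have hAx' : (A ++ [x]).Pairwise (· < ·) := by
        refine List.pairwise_append.2 ⟨(List.pairwise_append.1 hR).1, by simp, ?_⟩
        intro a ha b hb
        simp only [List.mem_singleton] at hb
        exact hb ▸ hAx a ha
      have h1 := (knuthEq_rowInsert hR hAx' hxy).append_left (rowsWord P)
      have hnd2 := h1.perm.nodup_iff.2 (by simpa using hnd)
      have hnd3 : (rowsWord P ++ [y]).Nodup := hnd2.sublist (by simp)
      obtain ⟨h2, h3⟩ := ih y (fun R hR => hP R (by simp [hR])) hnd3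
      refine ⟨?_, ?_⟩
      · rw [rowsWord_cons]
        have h4 := h2.append_right (A ++ x :: B)
        simp only [List.append_assoc, List.cons_append, List.nil_append] at h1 h4 ⊢
        exact h1.trans h4
      · intro S hS
        rcases List.mem_cons.1 hS with rfl | hS
        · have h5 := List.pairwise_append.1 hR
          have h6 := List.pairwise_cons.1 h5.2.1
          refine List.pairwise_append.2 ⟨h5.1, List.pairwise_cons.2 ⟨?_, h6.2⟩, ?_⟩
          · intro a ha
            exact hxy.trans (h6.1 a ha)
          · intro a ha b hb
            rcases List.mem_cons.1 hb with rfl | hb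
            · exact hAx a ha
            · exact h5.2.2 a ha b (by simp [hb])
        · exact h3 S hS

/-- Knuth's theorem: a word without repeated letters is Knuth equivalent to the reading word of its
insertion tableau. -/
theorem knuthEq_insertionTableau {w : List ℕ} (hw : w.Nodup) :
    KnuthEq w (rowsWord (insertionTableau w)) ∧
      ∀ R ∈ insertionTableau w, R.Pairwise (· < ·) := by
  induction w using List.reverseRecOn with
  | nil => simp [insertionTableau, rowsWord]; exact KnuthEq.refl _
  | append_singleton w x ih =>
    obtain ⟨h1, h2⟩ := ih (hw.sublist (by simp))
    have h3 := h1.append_right [x]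
    have h4 := knuthEq_tableauInsert (insertionTableau w) x h2 (h3.perm.nodup_iff.2 hw)
    have h5 : insertionTableau (w ++ [x]) = tableauInsert x (insertionTableau w) := by
      simp [insertionTableau]
    rw [h5]
    exact ⟨h3.trans h4.1, h4.2⟩

theorem idxOf_range' {s n j : ℕ} (hj : j < n) : (List.range' s n).idxOf (s + j) = j := by
  have := (List.nodup_range' (s := s) (n := n)).idxOf_getElem j (by simpa using hj)
  simpa using this

/-- The reading word of the two-row tableau that defines Dyck pattern intervals has a Dyck pattern:
all large letters come first, so that the last small letter is the unbracketed one. -/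
theorem dyckMove_twoRows (i m : ℕ) : DyckMove i m
    (List.range' (i + m + 1) m ++ List.range' i (m + 1))
    ((List.range' (i + m + 1) m ++ List.range' i (m + 1)).map (dyckCycle i m m)) := by
  refine ⟨m, ?_, ?_, rfl⟩
  · intro x h1 h2
    simp only [List.mem_append, List.mem_range'_1]
    omega
  · have hs : ∀ j, j < m + 1 → (List.range' (i + m + 1) m ++ List.range' i (m + 1)).idxOf (i + j) =
        m + j := by
      intro j hj
      rw [List.idxOf_append_of_notMem (by simp only [List.mem_range'_1]; omega), idxOf_range' hj,
        List.length_range', add_comm]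
    have hl : ∀ j, j < m → (List.range' (i + m + 1) m ++ List.range' i (m + 1)).idxOf
        (i + m + 1 + j) = j := by
      intro j hj
      rw [List.idxOf_append_of_mem (by simp only [List.mem_range'_1]; omega), idxOf_range' hj]
    refine ⟨le_rfl, ?_, ?_, ?_, by omega, by omega⟩
    · intro j hj
      simp only [add_assoc i j 1]
      rw [hs _ (by omega), hs _ (by omega)]
      omega
    · intro j hj
      simp only [add_assoc (i + m + 1) j 1]
      rw [hl _ (by omega), hl _ (by omega)]
      omega
    · intro j hj
      rw [hl _ hj, hs _ (by omega)]
      omega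

theorem KnuthEq.exists_dyckMove {i m : ℕ} {w w' v : List ℕ} (h : KnuthEq w w') (hw : w.Nodup)
    (hv : DyckMove i m w v) : ∃ v', DyckMove i m w' v' := by
  obtain ⟨K, -, rfl, -, hK⟩ := h.exists_bijective
  by_cases hvn : v.Nodup
  · exact ⟨K v, (hK i m w v hw hvn).1 hv⟩
  · exfalso
    obtain ⟨q, -, -, rfl⟩ := hv
    exact hvn (hw.map fun a b => by unfold dyckCycle; split_ifs <;> omega)

/-- The insertion tableau of a Dyck pattern interval forces a Dyck pattern, since a Dyck move of the
reading word of this tableau can be carried back along the Knuth equivalence. -/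
theorem exists_dyckMove_of_insertionTableau {i m : ℕ} {w : List ℕ} (hw : w.Nodup)
    (h : insertionTableau w = [List.range' i (m + 1), List.range' (i + m + 1) m]) :
    ∃ v, DyckMove i m w v := by
  have h1 := (knuthEq_insertionTableau hw).1
  rw [h] at h1
  have h2 : rowsWord [List.range' i (m + 1), List.range' (i + m + 1) m] =
    List.range' (i + m + 1) m ++ List.range' i (m + 1) := by simp [rowsWord]
  rw [h2] at h1
  exact h1.symm.exists_dyckMove (h1.perm.nodup_iff.2 hw) (dyckMove_twoRows i m)

theorem rowInsert_append_of_le {x : ℕ} {A : List ℕ} (hA : ∀ a ∈ A, a ≤ x) (B : List ℕ) :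
    rowInsert x (A ++ B) = (A ++ (rowInsert x B).1, (rowInsert x B).2) := by
  induction A with
  | nil => rfl
  | cons a A ih =>
    have h1 := hA a (by simp)
    rw [List.cons_append, rowInsert, if_neg (by omega), ih fun b hb => hA b (by simp [hb])]
    rfl

theorem rowInsert_of_le {x : ℕ} {A : List ℕ} (hA : ∀ a ∈ A, a ≤ x) :
    rowInsert x A = (A ++ [x], none) := by
  simpa [rowInsert] using rowInsert_append_of_le hA []

theorem openBrackets_append_singleton (i : ℕ) (w : List ℕ) (x : ℕ) :
    openBrackets i (w ++ [x]) = if x = i + 1 then openBrackets i w + 1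
      else if x = i then openBrackets i w - 1 else openBrackets i w := by
  simp [openBrackets]

theorem tableauInsert_of_none {x : ℕ} {R S R' : List ℕ} (h : rowInsert x R = (R', none))
    (hS : R = [] → S = []) :
    tableauInsert x ([R, S].filter (· ≠ [])) = [R', S].filter (· ≠ []) := by
  have hR' : R' ≠ [] := by
    rw [(rowInsert_none h).1]; simp
  by_cases hR : R = []
  · have := (rowInsert_none h).1
    subst hR
    rw [hS rfl, this]
    rfl
  · by_cases hS' : S = []
    · simp [hR, hS', hR', tableauInsert, h]
    · simp [hR, hS', hR', tableauInsert, h]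

theorem tableauInsert_of_some {x y : ℕ} {R S R' : List ℕ} (h : rowInsert x R = (R', some y))
    (hS : ∀ s ∈ S, s ≤ y) :
    tableauInsert x ([R, S].filter (· ≠ [])) = [R', S ++ [y]].filter (· ≠ []) := by
  obtain ⟨A, B, h1, h2, -⟩ := rowInsert_some h
  have hR : R ≠ [] := by simp [h1]
  have hR' : R' ≠ [] := by simp [h2]
  by_cases hS' : S = []
  · simp [hR, hS', hR', tableauInsert, h]
  · simp [hR, hS', hR', tableauInsert, h, rowInsert_of_le hS]

/-- The insertion of a shuffle `u` of `α` small letters, in order, and `β` large letters, in order.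
The second row collects the large letters that are bracketed, and the large letters that are still
open are at the end of row `0`.  Empty rows are removed by the filter. -/
theorem insertionTableau_of_filter {i m : ℕ} (u : List ℕ) {α β : ℕ}
    (hα : α ≤ m + 1)
    (hu : ∀ x ∈ u, i ≤ x ∧ x ≤ i + 2 * m)
    (hs : u.filter (fun x => decide (x ≤ i + m)) = List.range' i α)
    (hl : u.filter (fun x => decide (i + m < x)) = List.range' (i + m + 1) β) :
    ∃ d e, openBrackets i (u.map (collapse i m)) = d ∧ d + e = β ∧ e ≤ α ∧
      insertionTableau u = [List.range' i α ++ List.range' (i + m + 1 + e) d,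
        List.range' (i + m + 1) e].filter (· ≠ []) := by
  induction u using List.reverseRecOn generalizing α β with
  | nil =>
    have h1 : α = 0 := by simpa using hs.symm
    have h2 : β = 0 := by simpa using hl.symm
    subst h1 h2
    exact ⟨0, 0, rfl, rfl, le_rfl, rfl⟩
  | append_singleton u x ih =>
    have hux := hu x (by simp)
    have hu' : ∀ y ∈ u, i ≤ y ∧ y ≤ i + 2 * m := fun y hy => hu y (by simp [hy])
    have hins : insertionTableau (u ++ [x]) = tableauInsert x (insertionTableau u) := by
      simp [insertionTableau]
    rw [List.filter_append] at hs hl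
    rw [hins, List.map_append, List.map_singleton, openBrackets_append_singleton]
    by_cases hx : x ≤ i + m
    · have e1 : [x].filter (fun x => decide (x ≤ i + m)) = [x] := by simp [hx]
      have e2 : [x].filter (fun x => decide (i + m < x)) = [] := by simp; omega
      rw [e1] at hs
      rw [e2, List.append_nil] at hl
      obtain ⟨a, rfl⟩ : ∃ a, α = a + 1 := by
        cases α with
        | zero => simp at hs
        | succ a => exact ⟨a, rfl⟩
      rw [List.range'_concat, one_mul] at hs
      obtain ⟨hs1, hs2⟩ := List.append_inj' hs rfl
      simp only [List.cons.injEq, and_true] at hs2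
      obtain ⟨d, e, h1, h2, he, h3⟩ := ih (by omega) hu' hs1 hl
      have hc : collapse i m x = i := by rw [collapse, if_pos ⟨hux.1, hx⟩]
      rw [hc, if_neg (by omega), if_pos rfl, h1, h3]
      have hle : ∀ z ∈ List.range' i a, z ≤ x := by
        intro z hz; rw [List.mem_range'_1] at hz; omega
      rw [List.range'_concat, one_mul, ← hs2]
      cases d with
      | zero =>
        refine ⟨0, e, rfl, h2, by omega, ?_⟩
        simp only [List.range'_zero, List.append_nil]
        refine tableauInsert_of_none (rowInsert_of_le hle) ?_
        intro h
        rw [List.range'_eq_nil_iff] at h ⊢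
        omega
      | succ d =>
        refine ⟨d, e + 1, rfl, by omega, by omega, ?_⟩
        rw [List.range'_concat (n := e), one_mul]
        refine tableauInsert_of_some ?_ (by simp only [List.mem_range'_1]; omega)
        rw [rowInsert_append_of_le hle, List.range'_succ, rowInsert, if_pos (by omega)]
        simp [add_assoc]
    · have e1 : [x].filter (fun x => decide (x ≤ i + m)) = [] := by simp; omega
      have e2 : [x].filter (fun x => decide (i + m < x)) = [x] := by simp; omega
      rw [e2] at hl
      rw [e1, List.append_nil] at hs
      obtain ⟨a, rfl⟩ : ∃ a, β = a + 1 := by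
        cases β with
        | zero => simp at hl
        | succ a => exact ⟨a, rfl⟩
      rw [List.range'_concat, one_mul] at hl
      obtain ⟨hs1, hs2⟩ := List.append_inj' hl rfl
      simp only [List.cons.injEq, and_true] at hs2
      obtain ⟨d, e, h1, h2, he, h3⟩ := ih hα hu' hs hs1
      have hc : collapse i m x = i + 1 := by
        rw [collapse, if_neg (by omega), if_pos (by omega)]
      rw [hc, if_pos rfl, h1, h3]
      refine ⟨d + 1, e, rfl, by omega, he, ?_⟩
      have := rowInsert_of_le (x := x) (A := List.range' i α ++ List.range' (i + m + 1 + e) d) (by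
        simp only [List.mem_append, List.mem_range'_1]; omega)
      rw [List.range'_concat (n := d), one_mul, ← List.append_assoc,
        show i + m + 1 + e + d = x by omega]
      refine tableauInsert_of_none this ?_
      intro h
      rw [List.append_eq_nil_iff, List.range'_eq_nil_iff] at h
      rw [List.range'_eq_nil_iff]
      omega

/-! ### Crystal operators and standardization -/

theorem count_take_mono (x : ℕ) (w : List ℕ) {p q : ℕ} (h : p ≤ q) :
    (w.take p).count x ≤ (w.take q).count x :=
  (List.take_sublist_take_left h).count_le x

theorem count_take_succ (x : ℕ) {w : List ℕ} {p y : ℕ} (h : w[p]? = some y) :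
    (w.take (p + 1)).count x = (w.take p).count x + if y = x then 1 else 0 := by
  rw [List.take_add_one, h]
  simp [List.count_singleton]

theorem count_take_succ_of_none (x : ℕ) {w : List ℕ} {p : ℕ} (h : w[p]? = none) :
    (w.take (p + 1)).count x = (w.take p).count x := by
  rw [List.take_add_one, h]
  simp

theorem lt_count_take {x : ℕ} {w : List ℕ} {p q : ℕ} (h : w[p]? = some x) (hpq : p < q) :
    (w.take p).count x < (w.take q).count x := by
  have h1 := count_take_succ x h
  have h2 := count_take_mono x w (show p + 1 ≤ q from hpq)
  rw [if_pos rfl] at h1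
  omega

theorem lt_count {x : ℕ} {w : List ℕ} {p : ℕ} (h : w[p]? = some x) :
    (w.take p).count x < w.count x := by
  have h1 := lt_count_take h (show p < max (p + 1) w.length by omega)
  rwa [List.take_of_length_le (le_max_right (p + 1) w.length)] at h1

theorem exists_count_take_eq {x k : ℕ} {w : List ℕ} (h : k < w.count x) :
    ∃ p, w[p]? = some x ∧ (w.take p).count x = k := by
  induction w using List.reverseRecOn with
  | nil => simp at h
  | append_singleton w y ih =>
    by_cases hk : k < w.count x
    · obtain ⟨p, h1, h2⟩ := ih hk
      have hp : p < w.length := by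
        by_contra hp
        rw [List.getElem?_eq_none (by omega)] at h1
        simp at h1
      refine ⟨p, by rw [List.getElem?_append_left hp, h1], ?_⟩
      rw [List.take_append_of_le_length hp.le, h2]
    · rw [List.count_append, List.count_singleton] at h
      have hy : y = x := by
        by_contra hy
        simp [hy] at h
        omega
      subst hy
      simp at h
      exact ⟨w.length, by simp, by simp; omega⟩

theorem openBrackets_take_succ (i : ℕ) {w : List ℕ} {p y : ℕ} (h : w[p]? = some y) :
    openBrackets i (w.take (p + 1)) = if y = i + 1 then openBrackets i (w.take p) + 1
      else if y = i then openBrackets i (w.take p) - 1 else openBrackets i (w.take p) := by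
  rw [List.take_add_one, h]
  exact openBrackets_append_singleton i _ y

theorem openBrackets_take_succ_of_none (i : ℕ) {w : List ℕ} {p : ℕ} (h : w[p]? = none) :
    openBrackets i (w.take (p + 1)) = openBrackets i (w.take p) := by
  rw [List.take_add_one, h]
  simp

/-- The number of open brackets is at least the excess of letters `i + 1` over letters `i` on any
segment that ends at the position `p`.  The inequality is stated without subtraction. -/
theorem le_openBrackets (i : ℕ) (w : List ℕ) {p₀ p : ℕ} (h : p₀ ≤ p) :
    (w.take p).count (i + 1) + (w.take p₀).count i ≤
      openBrackets i (w.take p) + (w.take p).count i + (w.take p₀).count (i + 1) := by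
  induction p, h using Nat.le_induction with
  | base => omega
  | succ p hp ih =>
    cases hw : w[p]? with
    | none => rwa [count_take_succ_of_none _ hw, count_take_succ_of_none _ hw,
        openBrackets_take_succ_of_none _ hw]
    | some y =>
      rw [count_take_succ _ hw, count_take_succ _ hw, openBrackets_take_succ _ hw]
      split_ifs <;> omega

/-- The bound `le_openBrackets` is attained by the segment that begins after the last unbracketed
`i`, or at the start of the word if there is none. -/
theorem exists_openBrackets_eq (i : ℕ) (w : List ℕ) (p : ℕ) :
    ∃ p₀ ≤ p, openBrackets i (w.take p) + (w.take p).count i + (w.take p₀).count (i + 1) =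
      (w.take p).count (i + 1) + (w.take p₀).count i := by
  induction p with
  | zero => exact ⟨0, le_rfl, by simp [openBrackets]⟩
  | succ p ih =>
    obtain ⟨p₀, h1, h2⟩ := ih
    cases hw : w[p]? with
    | none =>
      refine ⟨p₀, by omega, ?_⟩
      rwa [count_take_succ_of_none _ hw, count_take_succ_of_none _ hw,
        openBrackets_take_succ_of_none _ hw]
    | some y =>
      by_cases h0 : y = i ∧ openBrackets i (w.take p) = 0
      · refine ⟨p + 1, le_rfl, ?_⟩
        rw [openBrackets_take_succ _ hw, if_neg (by omega), if_pos h0.1, h0.2]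
        omega
      · refine ⟨p₀, by omega, ?_⟩
        rw [count_take_succ _ hw, count_take_succ _ hw, openBrackets_take_succ _ hw]
        split_ifs <;> omega

/-- After the last unbracketed `i`, the number of open brackets is the excess of letters `i + 1`
over letters `i`, as no truncation happens there. -/
theorem openBrackets_eq_of_bracketed {i : ℕ} {w : List ℕ} {P : ℕ} (hP : IsUnbracketed i w P)
    (hmax : ∀ q, P < q → ¬ IsUnbracketed i w q) {p : ℕ} (hp : P + 1 ≤ p) :
    openBrackets i (w.take p) + (w.take p).count i + (w.take P).count (i + 1) =
      (w.take p).count (i + 1) + (w.take P).count i + 1 := by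
  induction p, hp using Nat.le_induction with
  | base =>
    rw [count_take_succ _ hP.1, count_take_succ _ hP.1, openBrackets_take_succ _ hP.1, hP.2]
    simp
    omega
  | succ p hp ih =>
    cases hw : w[p]? with
    | none => rwa [count_take_succ_of_none _ hw, count_take_succ_of_none _ hw,
        openBrackets_take_succ_of_none _ hw]
    | some y =>
      have h0 : y = i → openBrackets i (w.take p) ≠ 0 := by
        rintro rfl h
        exact hmax p hp ⟨hw, h⟩
      rw [count_take_succ _ hw, count_take_succ _ hw, openBrackets_take_succ _ hw]
      split_ifs <;> omega

/-- The word `t` is the standardization of the word `w`: equal letters are numbered from left to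
right. -/
def IsStdWord (w t : List ℕ) : Prop :=
  t.length = w.length ∧ ∀ p x, w[p]? = some x →
    t[p]? = some (w.countP (· < x) + (w.take (p + 1)).count x)

theorem IsStdWord.unique {w t t' : List ℕ} (h : IsStdWord w t) (h' : IsStdWord w t') : t = t' := by
  apply List.ext_getElem?
  intro p
  cases hw : w[p]? with
  | none =>
    rw [List.getElem?_eq_none_iff] at hw
    rw [List.getElem?_eq_none (by rw [h.1]; exact hw),
      List.getElem?_eq_none (by rw [h'.1]; exact hw)]
  | some x => rw [h.2 p x hw, h'.2 p x hw]

theorem countP_lt_succ (w : List ℕ) (x : ℕ) :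
    w.countP (· < x + 1) = w.countP (· < x) + w.count x := by
  induction w with
  | nil => rfl
  | cons y w ih =>
    rw [List.countP_cons, List.countP_cons, List.count_cons, ih]
    simp only [decide_eq_true_eq, beq_iff_eq]
    split_ifs <;> omega

theorem countP_lt_mono (w : List ℕ) {x y : ℕ} (h : x ≤ y) :
    w.countP (· < x) ≤ w.countP (· < y) := by
  apply List.countP_mono_left
  intro a _ ha
  simp only [decide_eq_true_eq] at *
  omega

theorem IsStdWord.getElem? {w t : List ℕ} (h : IsStdWord w t) {p x : ℕ} (hw : w[p]? = some x) :
    t[p]? = some (w.countP (· < x) + (w.take p).count x + 1) := by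
  rw [h.2 p x hw, count_take_succ _ hw, if_pos rfl, add_assoc]

theorem idxOf_eq_of_getElem? {t : List ℕ} (ht : t.Nodup) {p x : ℕ} (h : t[p]? = some x) :
    t.idxOf x = p := by
  obtain ⟨hp, rfl⟩ := List.getElem?_eq_some_iff.1 h
  exact ht.idxOf_getElem p hp

theorem count_take_set {w : List ℕ} {P a b x p : ℕ} (hP : w[P]? = some a) :
    ((w.set P b).take p).count x + (if P < p ∧ a = x then 1 else 0) =
      (w.take p).count x + (if P < p ∧ b = x then 1 else 0) := by
  rw [List.take_set]
  obtain ⟨hPl, rfl⟩ := List.getElem?_eq_some_iff.1 hP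
  by_cases hp : P < p
  · have h1 : P < (w.take p).length := by simp; omega
    rw [List.count_set h1]
    have h2 : (w.take p)[P] = w[P] := by simp
    simp only [h2, beq_iff_eq, hp, true_and]
    have h3 : w[P] = x → 0 < (w.take p).count x := by
      intro h
      rw [List.count_pos_iff]
      rw [← h, ← h2]
      exact List.getElem_mem _
    split_ifs with h4 h5 <;> omega
  · rw [List.set_eq_of_length_le (by simp; omega)]
    simp [hp]

theorem countP_lt_set {w : List ℕ} {P a b x : ℕ} (hP : w[P]? = some a) :
    (w.set P b).countP (· < x) + (if a < x then 1 else 0) =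
      w.countP (· < x) + (if b < x then 1 else 0) := by
  obtain ⟨hPl, rfl⟩ := List.getElem?_eq_some_iff.1 hP
  rw [List.countP_set hPl]
  have h3 : w[P] < x → 0 < w.countP (· < x) := by
    intro h
    rw [List.countP_pos_iff]
    exact ⟨w[P], List.getElem_mem _, by simpa using h⟩
  simp only [decide_eq_true_eq]
  split_ifs with h4 h5 <;> omega

/-- A crystal operator that changes the standardization acts on the standardizations by a Dyck move.
If `q` letters `i + 1` precede the letter `i` that is changed, then the pattern consists of the last
`q` letters `i` in front of it, this letter, all letters `i` behind it, and the first `m` letters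
`i + 1`, where `m + 1` is the number of these letters `i`. -/
theorem exists_dyckMove_of_wordLowers {i : ℕ} {w w' t t' : List ℕ} (ht : IsStdWord w t)
    (ht' : IsStdWord w' t') (hnd : t.Nodup) (h : WordLowers i w w') (hne : t ≠ t') :
    ∃ i₀ m, 1 ≤ m ∧ DyckMove i₀ m t t' := by
  obtain ⟨P, hP, hmax, rfl⟩ := h
  have hwP := hP.1
  have hDP := hP.2
  have hcl := countP_lt_succ w i
  have hcl2 := countP_lt_succ w (i + 1)
  set C := w.countP (· < i) with hC
  set X := w.count i with hX
  set Y := w.count (i + 1) with hY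
  set a := (w.take P).count i with ha
  set q := (w.take P).count (i + 1) with hq
  have hidxA : ∀ k, k < X → ∃ p, w[p]? = some i ∧ (w.take p).count i = k ∧
      t[p]? = some (C + k + 1) ∧ t.idxOf (C + k + 1) = p := by
    intro k hk
    obtain ⟨p, h1, h2⟩ := exists_count_take_eq hk
    have h3 := ht.getElem? h1
    rw [h2] at h3
    exact ⟨p, h1, h2, h3, idxOf_eq_of_getElem? hnd h3⟩
  have hidxB : ∀ k, k < Y → ∃ p, w[p]? = some (i + 1) ∧ (w.take p).count (i + 1) = k ∧
      t[p]? = some (C + X + k + 1) ∧ t.idxOf (C + X + k + 1) = p := by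
    intro k hk
    obtain ⟨p, h1, h2⟩ := exists_count_take_eq hk
    have h3 := ht.getElem? h1
    rw [h2, hcl] at h3
    exact ⟨p, h1, h2, h3, idxOf_eq_of_getElem? hnd h3⟩
  have haX : a < X := lt_count hwP
  have hqa : q ≤ a := by
    have := le_openBrackets i w (Nat.zero_le P)
    simp [hDP] at this
    omega
  have hmY : X - a - 1 + q ≤ Y := by
    have h1 := openBrackets_eq_of_bracketed hP hmax (p := max (P + 1) w.length) (by omega)
    rw [List.take_of_length_le (by omega)] at h1
    omega
  obtain ⟨m, hm⟩ : ∃ m, m = X - a - 1 + q := ⟨_, rfl⟩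
  obtain ⟨i₀, hi₀⟩ : ∃ i₀, i₀ = C + a + 1 - q := ⟨_, rfl⟩
  have hsm : ∀ j, j ≤ m → ∃ p, w[p]? = some i ∧ (w.take p).count i = a - q + j ∧
      t[p]? = some (i₀ + j) ∧ t.idxOf (i₀ + j) = p := by
    intro j hj
    have := hidxA (a - q + j) (by omega)
    rwa [show C + (a - q + j) + 1 = i₀ + j by omega] at this
  have hlg : ∀ j, j < m → ∃ p, w[p]? = some (i + 1) ∧ (w.take p).count (i + 1) = j ∧
      t[p]? = some (i₀ + m + 1 + j) ∧ t.idxOf (i₀ + m + 1 + j) = p := by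
    intro j hj
    have := hidxB j (by omega)
    rwa [show C + X + j + 1 = i₀ + m + 1 + j by omega] at this
  have hmove : DyckMove i₀ m t t' := by
    refine ⟨q, ?_, ⟨by omega, ?_, ?_, ?_, ?_, ?_⟩, ?_⟩
    · intro x h1 h2
      by_cases hx : x ≤ i₀ + m
      · obtain ⟨p, -, -, h3, -⟩ := hsm (x - i₀) (by omega)
        rw [show i₀ + (x - i₀) = x by omega] at h3
        exact List.mem_of_getElem? h3
      · obtain ⟨p, -, -, h3, -⟩ := hlg (x - (i₀ + m + 1)) (by omega)
        rw [show i₀ + m + 1 + (x - (i₀ + m + 1)) = x by omega] at h3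
        exact List.mem_of_getElem? h3
    · intro j hj
      obtain ⟨p, h1, h2, -, h3⟩ := hsm j hj.le
      obtain ⟨p', h1', h2', -, h3'⟩ := hsm (j + 1) hj
      simp only [add_assoc i₀ j 1]
      rw [h3, h3']
      by_contra hlt
      have := count_take_mono i w (not_lt.1 hlt)
      omega
    · intro j hj
      obtain ⟨p, h1, h2, -, h3⟩ := hlg j (by omega)
      obtain ⟨p', h1', h2', -, h3'⟩ := hlg (j + 1) hj
      simp only [add_assoc (i₀ + m + 1) j 1]
      rw [h3, h3']
      by_contra hlt
      have := count_take_mono (i + 1) w (not_lt.1 hlt)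
      omega
    · intro j hj
      obtain ⟨p, h1, h2, -, h3⟩ := hlg j (by omega)
      obtain ⟨p', h1', h2', -, h3'⟩ := hsm j (by omega)
      simp only [h3, h3']
      by_contra hlt
      have hne : p ≠ p' := by rintro rfl; rw [h1] at h1'; simp at h1'
      have hP' : p' < P := by
        by_contra hP'
        have := count_take_mono i w (not_lt.1 hP')
        omega
      have h4 := le_openBrackets i w (show p' + 1 ≤ P from hP')
      have h5 := count_take_mono (i + 1) w (show p' + 1 ≤ p by omega)
      have h6 := count_take_succ i h1'
      rw [if_pos rfl] at h6
      omega
    · intro hqm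
      obtain ⟨p, h1, h2, -, h3⟩ := hlg q hqm
      have h4 := ht.getElem? hwP
      have h5 := idxOf_eq_of_getElem? hnd h4
      rw [show C + a + 1 = i₀ + q by omega] at h5
      simp only [h3, h5]
      by_contra hlt
      have hne : p ≠ P := by rintro rfl; rw [h1] at hwP; simp at hwP
      have := lt_count_take h1 (show p < P by omega)
      omega
    · intro j hqj hj
      obtain ⟨p, h1, h2, -, h3⟩ := hlg j (by omega)
      obtain ⟨p', h1', h2', -, h3'⟩ := hsm (j + 1) (by omega)
      simp only [add_assoc i₀ j 1]
      rw [h3, h3']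
      by_contra hlt
      have hP' : P < p' := by
        by_contra hP'
        have := count_take_mono i w (not_lt.1 hP')
        omega
      have h4 := openBrackets_eq_of_bracketed hP hmax (show P + 1 ≤ p' from hP')
      have h5 : openBrackets i (w.take p') ≠ 0 := fun h => hmax p' hP' ⟨h1', h⟩
      have h6 := count_take_mono (i + 1) w (not_lt.1 hlt)
      omega
    · apply List.ext_getElem?
      intro p
      rw [List.getElem?_map]
      cases hw : w[p]? with
      | none =>
        rw [List.getElem?_eq_none_iff] at hw
        rw [List.getElem?_eq_none (l := t) (by rw [ht.1]; exact hw),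
          List.getElem?_eq_none (l := t') (by rw [ht'.1, List.length_set]; exact hw)]
        rfl
      | some x =>
        rw [ht.getElem? hw, Option.map_some]
        by_cases hpP : p = P
        · subst hpP
          have hx : x = i := by rw [hw] at hwP; simpa using hwP
          subst hx
          have h1 : (w.set p (x + 1))[p]? = some (x + 1) := by
            rw [List.getElem?_set_self']
            simp [hw]
          rw [ht'.getElem? h1]
          have h2 := countP_lt_set (b := x + 1) (x := x + 1) hw
          have h3 := count_take_set (b := x + 1) (x := x + 1) (p := p) hw
          rw [if_pos (by omega), if_neg (by omega)] at h2
          rw [if_neg (by omega), if_neg (by omega)] at h3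
          rw [Option.some.injEq, dyckCycle, if_pos (by omega)]
          omega
        · have h1 : (w.set P (i + 1))[p]? = some x := by
            rw [List.getElem?_set_ne (Ne.symm hpP), hw]
          rw [ht'.getElem? h1, Option.some.injEq]
          have h2 := countP_lt_set (b := i + 1) (x := x) hwP
          have h3 := count_take_set (b := i + 1) (x := x) (p := p) hwP
          have h4 := lt_count hw
          have h5 := fun h : x < i => countP_lt_mono w (show x + 1 ≤ i from h)
          have h6 := fun h : i + 1 < x => countP_lt_mono w (show i + 1 + 1 ≤ x from h)
          have h7 := countP_lt_succ w x
          have h8 := fun h : p < P => lt_count_take hw h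
          have h9 := fun h : P < p => lt_count_take hwP h
          have h10 := fun h : P < p => count_take_mono (i + 1) w h.le
          clear hsm hlg hidxA hidxB hP hmax
          rw [dyckCycle]
          rcases lt_trichotomy x i with hxi | rfl | hxi
          · have h5 := h5 hxi
            rw [if_neg (by omega), if_neg (by omega)] at h2 h3
            rw [if_neg (by omega), if_neg (by omega)]
            omega
          · rw [if_neg (by omega), if_neg (by omega)] at h2
            rw [if_neg (show ¬ (P < p ∧ x + 1 = x) by omega)] at h3
            rcases Nat.lt_or_gt_of_ne hpP with hp | hp
            · have h8 := h8 hp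
              rw [if_neg (by omega)] at h3
              rw [if_neg (by omega), if_neg (by omega)]
              omega
            · have h9 := h9 hp
              rw [if_pos ⟨hp, rfl⟩] at h3
              rw [if_neg (by omega), if_pos (by omega)]
              omega
          · rcases Nat.lt_or_eq_of_le (show i + 1 ≤ x from hxi) with hxi1 | rfl
            · have h6 := h6 hxi1
              rw [if_pos (by omega), if_pos (by omega)] at h2
              rw [if_neg (by omega), if_neg (by omega)] at h3
              rw [if_neg (by omega), if_neg (by omega)]
              omega
            · rw [if_pos (by omega), if_neg (by omega)] at h2
              rw [if_neg (show ¬ (P < p ∧ i = i + 1) by omega)] at h3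
              rcases Nat.lt_or_gt_of_ne hpP with hp | hp
              · have h8 := h8 hp
                rw [if_neg (by omega)] at h3
                rw [if_neg (by omega), if_pos (by omega)]
                omega
              · have h10 := h10 hp
                rw [if_pos ⟨hp, rfl⟩] at h3
                rw [if_neg (by omega), if_neg (by omega)]
                omega
  -- for `m = 0` the cycle is the identity, so the standardization would not change
  have hm1 : 1 ≤ m := by
    by_contra h0
    obtain rfl : m = 0 := by omega
    obtain ⟨q', -, hq', rfl⟩ := hmove
    apply hne
    have h1 : dyckCycle i₀ 0 q' = id := by
      have := hq'.le
      funext x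
      simp only [dyckCycle, id]
      split_ifs <;> omega
    rw [h1, List.map_id]
  exact ⟨i₀, m, hm1, hmove⟩

/-! ### Dyck moves come from crystal operators -/

theorem countP_le_of_perm {t : List ℕ} {n v : ℕ} (ht : t.Perm (List.range' 1 n)) (hv : v ≤ n) :
    t.countP (· ≤ v) = v := by
  rw [ht.countP_eq]
  obtain ⟨k, rfl⟩ := Nat.exists_eq_add_of_le hv
  rw [← List.range'_append_1, List.countP_append]
  have h1 : (List.range' 1 v).countP (· ≤ v) = v := by
    rw [List.countP_eq_length.2]
    · simp
    · intro a ha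
      rw [List.mem_range'_1] at ha
      simp; omega
  have h2 : (List.range' (1 + v) k).countP (· ≤ v) = 0 := by
    rw [List.countP_eq_zero]
    intro a ha
    rw [List.mem_range'_1] at ha
    simp; omega
  rw [h1, h2, add_zero]

theorem countP_add_of_disjoint {l : List ℕ} {a b c : ℕ → Bool}
    (h : ∀ x ∈ l, (a x || b x) = c x) (hd : ∀ x ∈ l, ¬ (a x = true ∧ b x = true)) :
    l.countP a + l.countP b = l.countP c := by
  induction l with
  | nil => rfl
  | cons x l ih =>
    have h1 := h x (by simp)
    have h2 := hd x (by simp)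
    have ih := ih (fun y hy => h y (by simp [hy])) (fun y hy => hd y (by simp [hy]))
    rw [List.countP_cons, List.countP_cons, List.countP_cons, ← ih, ← h1]
    cases ha : a x <;> cases hb : b x <;> simp [ha, hb] at h2 ⊢ <;> omega

/-- A permutation is the standardization of each of its images under a weakly increasing map whose
fibers are read in increasing order. -/
theorem isStdWord_map {t : List ℕ} {n : ℕ} (ht : t.Perm (List.range' 1 n)) {φ : ℕ → ℕ}
    (hmono : ∀ x ∈ t, ∀ y ∈ t, x < y → φ x ≤ φ y)
    (hfib : ∀ x ∈ t, ∀ y ∈ t, x < y → φ x = φ y → t.idxOf x < t.idxOf y) :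
    IsStdWord (t.map φ) t := by
  have hnd : t.Nodup := ht.nodup_iff.2 List.nodup_range'
  refine ⟨by simp, ?_⟩
  intro p x hx
  rw [List.getElem?_map, Option.map_eq_some_iff] at hx
  obtain ⟨v, hv, rfl⟩ := hx
  have hidx := idxOf_eq_of_getElem? hnd hv
  have hvt : v ∈ t := List.mem_of_getElem? hv
  rw [hv, Option.some.injEq, ← List.map_take, List.count, List.countP_map, List.countP_map]
  have hvn : v ≤ n := by
    have := ht.mem_iff.1 hvt
    rw [List.mem_range'_1] at this
    omega
  have hdrop : (t.drop (p + 1)).countP (fun y => decide (φ y = φ v ∧ y ≤ v)) = 0 := by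
    rw [List.countP_eq_zero]
    intro y hy
    obtain ⟨k, hk, rfl⟩ := List.getElem_of_mem hy
    simp only [List.getElem_drop, decide_eq_true_eq, not_and, not_le]
    intro h1
    by_contra h2
    have hlt : p + 1 + k < t.length := by simp at hk; omega
    have h3 : t.idxOf t[p + 1 + k] = p + 1 + k := hnd.idxOf_getElem _ hlt
    rcases Nat.lt_or_eq_of_le (not_lt.1 h2) with h4 | h4
    · have := hfib _ (List.getElem_mem hlt) v hvt h4 h1
      omega
    · rw [h4] at h3
      omega
  have htake : (t.take (p + 1)).countP ((fun y => y == φ v) ∘ φ) =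
      (t.take (p + 1)).countP (fun y => decide (φ y = φ v ∧ y ≤ v)) := by
    apply List.countP_congr
    intro y hy
    have hyt := List.mem_of_mem_take hy
    have hyp : t.idxOf y < p + 1 := by
      obtain ⟨k, hk, rfl⟩ := List.getElem_of_mem hy
      rw [List.length_take] at hk
      rw [List.getElem_take, hnd.idxOf_getElem]
      omega
    simp only [Function.comp_apply, beq_iff_eq, decide_eq_true_eq]
    refine ⟨fun h => ⟨h, ?_⟩, fun h => h.1⟩
    by_contra h2
    have := hfib v hvt y hyt (not_le.1 h2) h.symm
    omega
  have hsum : (t.take (p + 1)).countP (fun y => decide (φ y = φ v ∧ y ≤ v)) =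
      t.countP (fun y => decide (φ y = φ v ∧ y ≤ v)) := by
    conv_rhs => rw [← List.take_append_drop (p + 1) t, List.countP_append, hdrop]
    rfl
  rw [htake, hsum, countP_add_of_disjoint (c := fun y => decide (y ≤ v)),
    countP_le_of_perm ht hvn]
  · intro y hy
    simp only [Function.comp_apply, ← Bool.decide_or, decide_eq_decide]
    constructor
    · rintro (h | h)
      · by_contra h2
        have := hmono v hvt y hy (not_le.1 h2)
        omega
      · exact h.2
    · intro h
      rcases Nat.lt_or_eq_of_le h with h1 | rfl
      · have := hmono y hy v hvt h1
        omega
      · right; simp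
  · intro y hy
    simp only [Function.comp_apply, decide_eq_true_eq]
    omega

/-- Letters that are collapsed to the same letter are read in increasing order. -/
theorem dyckOrder_fiber {i m q : ℕ} {pos : ℕ → ℕ} (h : DyckOrder i m q pos) {x y : ℕ}
    (hxy : x < y) (he : collapse i m x = collapse i m y) : pos x < pos y := by
  unfold collapse at he
  have : (i ≤ x ∧ y ≤ i + m) ∨ (i + m + 1 ≤ x ∧ y ≤ i + 2 * m) := by
    split_ifs at he <;> omega
  rcases this with h1 | h1
  · exact h.small_lt h1.1 hxy h1.2
  · exact h.large_lt h1.1 hxy h1.2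

theorem collapse_mono {i m : ℕ} (hm : 1 ≤ m) {x y : ℕ} (hxy : x ≤ y) :
    collapse i m x ≤ collapse i m y := by
  unfold collapse
  split_ifs <;> omega

/-- The collapse that corresponds to a Dyck pattern after the crystal operator has been applied: the
letters in `[i, i + m)` become `i`, those in `[i + m, i + 2m]` become `i + 1`. -/
def collapseTarget (i m x : ℕ) : ℕ :=
  if i ≤ x ∧ x < i + m then i
  else if i + m ≤ x ∧ x ≤ i + 2 * m then i + 1
  else x

theorem collapseTarget_mono {i m : ℕ} (hm : 1 ≤ m) {x y : ℕ} (hxy : x ≤ y) :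
    collapseTarget i m x ≤ collapseTarget i m y := by
  unfold collapseTarget
  split_ifs <;> omega

theorem collapseTarget_dyckCycle {i m q x : ℕ} (hq : q ≤ m) :
    collapseTarget i m (dyckCycle i m q x) =
      if x = i + q then i + 1 else collapse i m x := by
  unfold collapseTarget dyckCycle collapse
  split_ifs <;> omega

theorem dyckCycle_injective (i m q : ℕ) : Function.Injective (dyckCycle i m q) :=
  fun a b => by unfold dyckCycle; split_ifs <;> omega

theorem idxOf_map_of_injOn {α : Type*} [BEq α] [LawfulBEq α] {f : α → ℕ} {l : List α} {x : α}
    (hf : ∀ y ∈ l, f y = f x → y = x) : (l.map f).idxOf (f x) = l.idxOf x := by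
  induction l with
  | nil => rfl
  | cons y t ih =>
    rw [List.map_cons, List.idxOf_cons, List.idxOf_cons, ih fun z hz => hf z (by simp [hz])]
    have : (f y == f x) = (y == x) := by
      by_cases h : y = x
      · simp [h]
      · have h' : f y ≠ f x := fun h' => h (hf y (by simp) h')
        rw [beq_false_of_ne h, beq_false_of_ne h']
    rw [this]

theorem idxOf_map_of_injective {f : ℕ → ℕ} (hf : Function.Injective f) (t : List ℕ) (x : ℕ) :
    (t.map f).idxOf (f x) = t.idxOf x :=
  idxOf_map_of_injOn fun _ _ h => hf h

theorem DyckMove.isStdWord_collapse {i m n : ℕ} {t t' : List ℕ} (hm : 1 ≤ m)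
    (ht : t.Perm (List.range' 1 n)) (h : DyckMove i m t t') :
    IsStdWord (t.map (collapse i m)) t := by
  obtain ⟨q, -, h, -⟩ := h
  exact isStdWord_map ht (fun x _ y _ hxy => collapse_mono hm hxy.le)
    (fun x _ y _ hxy he => dyckOrder_fiber h hxy he)

/-- After a Dyck move, letters with the same image under `collapseTarget` are read in increasing
order. -/
theorem DyckMove.target_fiber {i m : ℕ} {t t' : List ℕ} (hm : 1 ≤ m) (h : DyckMove i m t t')
    {x y : ℕ} (hxy : x < y)
    (he : collapseTarget i m x = collapseTarget i m y) : t'.idxOf x < t'.idxOf y := by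
  obtain ⟨q, -, h, rfl⟩ := h
  have hle := h.le
  have hex : ∀ z, i ≤ z → z ≤ i + 2 * m → ∃ z', dyckCycle i m q z' = z ∧
      z' = if z = i + m + q then i + q else if i + q ≤ z ∧ z < i + m + q then z + 1 else z := by
    intro z h1 h2
    refine ⟨_, ?_, rfl⟩
    unfold dyckCycle
    split_ifs <;> omega
  have : (i ≤ x ∧ y < i + m) ∨ (i + m ≤ x ∧ y ≤ i + 2 * m) := by
    unfold collapseTarget at he
    split_ifs at he <;> omega
  obtain ⟨x', rfl, hx'⟩ := hex x (by omega) (by omega)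
  obtain ⟨y', rfl, hy'⟩ := hex y (by omega) (by omega)
  rw [idxOf_map_of_injective (dyckCycle_injective i m q),
    idxOf_map_of_injective (dyckCycle_injective i m q)]
  generalize dyckCycle i m q x' = x at *
  generalize dyckCycle i m q y' = y at *
  rcases this with h1 | h1
  · apply h.small_lt <;> split_ifs at hx' hy' <;> omega
  · by_cases hx : x = i + m + q
    · rw [if_pos hx] at hx'
      rw [if_neg (by omega), if_neg (by omega)] at hy'
      subst hx' hy'
      have h2 := h.mid (by omega)
      rcases Nat.lt_or_eq_of_le (show i + m + 1 + q ≤ y' by omega) with h3 | h3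
      · exact h2.trans (h.large_lt (by omega) h3 (by omega))
      · rwa [← h3]
    · by_cases hy : y = i + m + q
      · rw [if_pos hy] at hy'
        rw [if_neg (by omega), if_pos (by omega)] at hx'
        subst hx' hy'
        have h2 := h.left (q - 1) (by omega)
        have h3 := h.small_lt (show i ≤ i + (q - 1) by omega) (show _ < i + q by omega) (by omega)
        rcases Nat.lt_or_eq_of_le (show x + 1 ≤ i + m + 1 + (q - 1) by omega) with h4 | h4
        · exact (h.large_lt (by omega) h4 (by omega)).trans (h2.trans h3)
        · rw [h4]; exact h2.trans h3
      · apply h.large_lt <;> split_ifs at hx' hy' <;> omega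

theorem dyckCycle_perm {i m q n : ℕ} (h1 : 1 ≤ i) (h2 : i + m + q ≤ n) {t : List ℕ}
    (ht : t.Perm (List.range' 1 n)) : (t.map (dyckCycle i m q)).Perm (List.range' 1 n) := by
  have hnd : t.Nodup := ht.nodup_iff.2 List.nodup_range'
  rw [List.perm_ext_iff_of_nodup (hnd.map (dyckCycle_injective i m q)) List.nodup_range']
  intro a
  simp only [List.mem_map, ht.mem_iff, List.mem_range'_1]
  constructor
  · rintro ⟨b, hb, rfl⟩
    unfold dyckCycle
    split_ifs <;> omega
  · intro ha
    refine ⟨if a = i + m + q then i + q else if i + q ≤ a ∧ a < i + m + q then a + 1 else a, ?_, ?_⟩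
    · split_ifs <;> omega
    · unfold dyckCycle
      split_ifs <;> omega

theorem DyckMove.bound {i m n : ℕ} {t t' : List ℕ} (ht : t.Perm (List.range' 1 n))
    (h : DyckMove i m t t') : 1 ≤ i ∧ i + 2 * m ≤ n := by
  obtain ⟨q, h, -⟩ := h
  have h1 := ht.mem_iff.1 (h i le_rfl (by omega))
  have h2 := ht.mem_iff.1 (h (i + 2 * m) (by omega) le_rfl)
  rw [List.mem_range'_1] at h1 h2
  omega

theorem DyckMove.perm {i m n : ℕ} {t t' : List ℕ} (ht : t.Perm (List.range' 1 n))
    (h : DyckMove i m t t') : t'.Perm (List.range' 1 n) := by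
  have := h.bound ht
  obtain ⟨q, -, h, rfl⟩ := h
  have := h.le
  exact dyckCycle_perm (by omega) (by omega) ht

theorem DyckMove.isStdWord_collapseTarget {i m n : ℕ} {t t' : List ℕ} (hm : 1 ≤ m)
    (ht : t.Perm (List.range' 1 n)) (h : DyckMove i m t t') :
    IsStdWord (t'.map (collapseTarget i m)) t' :=
  isStdWord_map (h.perm ht) (fun _ _ _ _ hxy => collapseTarget_mono hm hxy.le)
    (fun _ _ _ _ hxy he => h.target_fiber hm hxy he)

/-- A Dyck move is induced by the crystal operator on the collapsed words, in which every letter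
`i + 1` is bracketed. -/
theorem DyckMove.wordLowers {i m n : ℕ} {t t' : List ℕ} (hm : 1 ≤ m)
    (ht : t.Perm (List.range' 1 n)) (h : DyckMove i m t t') :
    WordLowers i (t.map (collapse i m)) (t'.map (collapseTarget i m)) ∧
      openBrackets i (t.map (collapse i m)) = 0 := by
  have hnd : t.Nodup := ht.nodup_iff.2 List.nodup_range'
  have hstd := h.isStdWord_collapse hm ht
  obtain ⟨hi, hin⟩ := h.bound ht
  obtain ⟨q, hmem, h, rfl⟩ := h
  have hle := h.le
  set w := t.map (collapse i m) with hw
  have hC1 : w.countP (· < i) = i - 1 := by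
    rw [hw, List.countP_map, ← countP_le_of_perm ht (show i - 1 ≤ n by omega)]
    apply List.countP_congr
    intro x _
    simp only [Function.comp_apply, decide_eq_true_eq, collapse]
    split_ifs <;> rw [decide_eq_true_eq] <;> omega
  have hC2 : w.countP (· < i + 1) = i + m := by
    rw [hw, List.countP_map, ← countP_le_of_perm ht (show i + m ≤ n by omega)]
    apply List.countP_congr
    intro x _
    simp only [Function.comp_apply, decide_eq_true_eq, collapse]
    split_ifs <;> rw [decide_eq_true_eq] <;> omega
  have hC3 : w.countP (· < i + 1 + 1) = i + 2 * m := by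
    rw [hw, List.countP_map, ← countP_le_of_perm ht (show i + 2 * m ≤ n by omega)]
    apply List.countP_congr
    intro x _
    simp only [Function.comp_apply, decide_eq_true_eq, collapse]
    split_ifs <;> rw [decide_eq_true_eq] <;> omega
  have hX := countP_lt_succ w i
  have hY := countP_lt_succ w (i + 1)
  have hsm : ∀ k, k ≤ m → w[t.idxOf (i + k)]? = some i ∧
      (w.take (t.idxOf (i + k))).count i = k := by
    intro k hk
    have h1 : t[t.idxOf (i + k)]? = some (i + k) :=
      List.getElem?_idxOf (hmem _ (by omega) (by omega))
    have h2 : w[t.idxOf (i + k)]? = some i := by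
      rw [hw, List.getElem?_map, h1, Option.map_some, collapse, if_pos (by omega)]
    refine ⟨h2, ?_⟩
    have h3 := hstd.getElem? h2
    rw [h1, Option.some.injEq] at h3
    omega
  have hlg : ∀ k, k < m → w[t.idxOf (i + m + 1 + k)]? = some (i + 1) ∧
      (w.take (t.idxOf (i + m + 1 + k))).count (i + 1) = k := by
    intro k hk
    have h1 : t[t.idxOf (i + m + 1 + k)]? = some (i + m + 1 + k) :=
      List.getElem?_idxOf (hmem _ (by omega) (by omega))
    have h2 : w[t.idxOf (i + m + 1 + k)]? = some (i + 1) := by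
      rw [hw, List.getElem?_map, h1, Option.map_some, collapse, if_neg (by omega),
        if_pos (by omega)]
    refine ⟨h2, ?_⟩
    have h3 := hstd.getElem? h2
    rw [h1, Option.some.injEq] at h3
    omega
  obtain ⟨hwP, hAP⟩ := hsm q hle
  obtain ⟨P, hP⟩ : ∃ P, P = t.idxOf (i + q) := ⟨_, rfl⟩
  rw [← hP] at hwP hAP
  have hBP : (w.take P).count (i + 1) = q := by
    apply le_antisymm
    · rcases Nat.lt_or_eq_of_le hle with hq | rfl
      · have h1 := h.mid hq
        have h2 := count_take_mono (i + 1) w h1.le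
        rw [(hlg q hq).2] at h2
        rwa [hP]
      · have := (List.take_sublist P w).count_le (i + 1)
        omega
    · rcases Nat.eq_zero_or_pos q with rfl | hq
      · omega
      · have h1 := h.left (q - 1) (by omega)
        have h2 := h.small_lt (show i ≤ i + (q - 1) by omega) (show _ < i + q by omega) (by omega)
        have h3 := hlg (q - 1) (by omega)
        have h4 := lt_count_take h3.1 (h1.trans h2)
        rw [← hP] at h4
        omega
  -- otherwise one of the first `q` small letters would precede its large partner
  have hunb : IsUnbracketed i w P := by
    refine ⟨hwP, ?_⟩
    obtain ⟨p₀, hp₀, h1⟩ := exists_openBrackets_eq i w P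
    by_contra h0
    have h5 := count_take_mono i w hp₀
    have h2 : (w.take p₀).count (i + 1) < q := by omega
    have h3 := hlg _ (show (w.take p₀).count (i + 1) < m by omega)
    have h4 := h.left _ h2
    have h6 : p₀ ≤ t.idxOf (i + m + 1 + (w.take p₀).count (i + 1)) := by
      by_contra h7
      have := lt_count_take h3.1 (not_le.1 h7)
      omega
    have h8 := count_take_mono i w (h6.trans h4.le)
    rw [(hsm _ (by omega)).2] at h8
    omega
  -- each later letter `i` is preceded by a large letter that it can close
  have hlater : ∀ p, P < p → ¬ IsUnbracketed i w p := by
    rintro p hp ⟨h1, h2⟩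
    have h3 := hstd.getElem? h1
    have h4 := idxOf_eq_of_getElem? hnd h3
    have h5 := lt_count_take hwP hp
    have h6 := lt_count h1
    have h7 := h.right ((w.take p).count i - 1) (by omega) (by omega)
    rw [show i + ((w.take p).count i - 1) + 1 = w.countP (· < i) + (w.take p).count i + 1 by omega,
      h4] at h7
    have h8 := lt_count_take (hlg ((w.take p).count i - 1) (by omega)).1 h7
    rw [(hlg ((w.take p).count i - 1) (by omega)).2] at h8
    have h9 := le_openBrackets i w (show P + 1 ≤ p from hp)
    rw [count_take_succ _ hwP, count_take_succ _ hwP, if_pos rfl, if_neg (by omega)] at h9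
    omega
  refine ⟨⟨P, hunb, hlater, ?_⟩, ?_⟩
  · apply List.ext_getElem?
    intro p
    by_cases hp : P = p
    · subst hp
      have h1 : t[P]? = some (i + q) := by
        rw [hP]
        exact List.getElem?_idxOf (hmem _ (by omega) (by omega))
      rw [List.getElem?_set_self', hwP, List.map_map, List.getElem?_map, h1]
      simp [collapseTarget_dyckCycle hle]
    · rw [List.getElem?_set_ne hp, List.map_map, List.getElem?_map, hw, List.getElem?_map]
      cases h1 : t[p]? with
      | none => rfl
      | some x =>
        have h2 : x ≠ i + q := by
          rintro rfl
          exact hp (hP.trans (idxOf_eq_of_getElem? hnd h1))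
        simp [collapseTarget_dyckCycle hle, h2]
  · have h1 := openBrackets_eq_of_bracketed hunb hlater (p := max (P + 1) w.length) (by omega)
    rw [List.take_of_length_le (le_max_right (P + 1) w.length)] at h1
    omega

/-! ### Reading words of standard tableaux -/

/-- The cells of `lam` in the order in which the row reading word visits them. -/
def readingCells (lam : YoungDiagram) : List (ℕ × ℕ) :=
  (List.range (lam.colLen 0)).reverse.flatMap fun r => (List.range (lam.rowLen r)).map (Prod.mk r)

/-- The cell `c` comes before the cell `c'` in the row reading order: it lies in a higher row, or
further to the left in the same row. -/
def ReadBefore (c c' : ℕ × ℕ) : Prop := c'.1 < c.1 ∨ (c.1 = c'.1 ∧ c.2 < c'.2)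

theorem rowWord_eq_map {lam : YoungDiagram} (b : SemistandardYoungTableau lam) :
    rowWord b = (readingCells lam).map fun c => b c.1 c.2 := by
  simp [rowWord, readingCells, List.map_flatMap, Function.comp_def]

theorem mem_readingCells {lam : YoungDiagram} {c : ℕ × ℕ} : c ∈ readingCells lam ↔ c ∈ lam := by
  obtain ⟨r, k⟩ := c
  simp only [readingCells, List.mem_flatMap, List.mem_reverse, List.mem_range, List.mem_map,
    Prod.mk.injEq]
  constructor
  · rintro ⟨r', -, k', h, rfl, rfl⟩
    exact YoungDiagram.mem_iff_lt_rowLen.2 h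
  · intro h
    refine ⟨r, ?_, k, YoungDiagram.mem_iff_lt_rowLen.1 h, rfl, rfl⟩
    exact YoungDiagram.mem_iff_lt_colLen.1 (lam.up_left_mem le_rfl (Nat.zero_le k) h)

theorem readingCells_pairwise (lam : YoungDiagram) :
    (readingCells lam).Pairwise ReadBefore := by
  rw [readingCells, List.pairwise_flatMap]
  refine ⟨?_, ?_⟩
  · intro r _
    rw [List.pairwise_map]
    exact List.pairwise_lt_range.imp fun h => Or.inr ⟨rfl, h⟩
  · rw [List.pairwise_reverse]
    refine List.pairwise_lt_range.imp ?_
    intro a b hab x hx y hy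
    simp only [List.mem_map, List.mem_range] at hx hy
    obtain ⟨_, -, rfl⟩ := hx
    obtain ⟨_, -, rfl⟩ := hy
    exact Or.inl hab

theorem ReadBefore.irrefl (c : ℕ × ℕ) : ¬ ReadBefore c c := by
  unfold ReadBefore; omega

theorem readingCells_nodup (lam : YoungDiagram) : (readingCells lam).Nodup := by
  refine (readingCells_pairwise lam).imp (S := fun a b => a ≠ b) ?_
  rintro a b h rfl
  exact ReadBefore.irrefl a h

theorem idxOf_lt_idxOf_of_pairwise {α : Type*} [BEq α] [LawfulBEq α] {R : α → α → Prop} {l : List α}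
    (hl : l.Pairwise R) {x y : α} (hx : x ∈ l) (hy : y ∈ l)
    (h : l.idxOf x < l.idxOf y) : R x y := by
  have := List.pairwise_iff_getElem.1 hl _ _ (List.idxOf_lt_length_iff.2 hx)
    (List.idxOf_lt_length_iff.2 hy) h
  simpa using this

theorem idxOf_readingCells_lt_iff {lam : YoungDiagram} {c c' : ℕ × ℕ} (hc : c ∈ lam)
    (hc' : c' ∈ lam) :
    (readingCells lam).idxOf c < (readingCells lam).idxOf c' ↔ ReadBefore c c' := by
  rw [← mem_readingCells] at hc hc'
  constructor
  · exact idxOf_lt_idxOf_of_pairwise (readingCells_pairwise lam) hc hc'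
  · intro h
    by_contra hlt
    rcases Nat.lt_or_eq_of_le (not_lt.1 hlt) with h1 | h1
    · have := idxOf_lt_idxOf_of_pairwise (readingCells_pairwise lam) hc' hc h1
      unfold ReadBefore at *
      omega
    · rw [List.idxOf_inj hc'] at h1
      exact ReadBefore.irrefl _ (h1 ▸ h)

variable {lam : YoungDiagram}

theorem SYT.inj (T : SYT lam) {c c' : ℕ × ℕ} (hc : c ∈ lam) (hc' : c' ∈ lam)
    (h : T.1 c.1 c.2 = T.1 c'.1 c'.2) : c = c' :=
  T.2.injOn (by simpa using hc) (by simpa using hc') h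

theorem SYT.mem_Icc (T : SYT lam) {c : ℕ × ℕ} (hc : c ∈ lam) :
    1 ≤ T.1 c.1 c.2 ∧ T.1 c.1 c.2 ≤ lam.card := by
  have := T.2.mapsTo (show c ∈ (lam.cells : Set (ℕ × ℕ)) by simpa using hc)
  simpa using this

theorem SYT.exists_cell (T : SYT lam) {x : ℕ} (h1 : 1 ≤ x) (h2 : x ≤ lam.card) :
    ∃ c ∈ lam, T.1 c.1 c.2 = x := by
  obtain ⟨c, hc, h⟩ := T.2.surjOn (show x ∈ Set.Icc 1 lam.card from ⟨h1, h2⟩)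
  exact ⟨c, by simpa using hc, h⟩

theorem SYT.rowWord_perm (T : SYT lam) : (rowWord T.1).Perm (List.range' 1 lam.card) := by
  rw [rowWord_eq_map, List.perm_ext_iff_of_nodup ?_ List.nodup_range']
  · intro x
    rw [List.mem_map, List.mem_range'_1]
    constructor
    · rintro ⟨c, hc, rfl⟩
      have := T.mem_Icc (mem_readingCells.1 hc)
      omega
    · intro h
      obtain ⟨c, hc, h⟩ := T.exists_cell (x := x) (by omega) (by omega)
      exact ⟨c, mem_readingCells.2 hc, h⟩
  · refine List.Nodup.map_on ?_ (readingCells_nodup lam)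
    intro c hc c' hc' h
    exact T.inj (mem_readingCells.1 hc) (mem_readingCells.1 hc') h

theorem SYT.rowWord_nodup (T : SYT lam) : (rowWord T.1).Nodup :=
  T.rowWord_perm.nodup_iff.2 List.nodup_range'

theorem SYT.idxOf_rowWord (T : SYT lam) {c : ℕ × ℕ} (hc : c ∈ lam) :
    (rowWord T.1).idxOf (T.1 c.1 c.2) = (readingCells lam).idxOf c := by
  rw [rowWord_eq_map]
  exact idxOf_map_of_injOn (f := fun c : ℕ × ℕ => T.1 c.1 c.2)
    fun y hy h => T.inj (mem_readingCells.1 hy) hc h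

theorem SYT.idxOf_lt_iff (T : SYT lam) {c c' : ℕ × ℕ} (hc : c ∈ lam) (hc' : c' ∈ lam) :
    (rowWord T.1).idxOf (T.1 c.1 c.2) < (rowWord T.1).idxOf (T.1 c'.1 c'.2) ↔ ReadBefore c c' := by
  rw [T.idxOf_rowWord hc, T.idxOf_rowWord hc', idxOf_readingCells_lt_iff hc hc']

theorem rowWord_eq_iff {b b' : SemistandardYoungTableau lam} :
    rowWord b = rowWord b' ↔ ∀ c ∈ lam, b c.1 c.2 = b' c.1 c.2 := by
  rw [rowWord_eq_map, rowWord_eq_map, List.map_inj_left]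
  exact ⟨fun h c hc => h c (mem_readingCells.2 hc), fun h c hc => h c (mem_readingCells.1 hc)⟩

theorem SYT.ext_of_cells {T T' : SYT lam} (h : ∀ c ∈ lam, T.1 c.1 c.2 = T'.1 c.1 c.2) : T = T' := by
  apply Subtype.ext
  ext r k
  by_cases hc : (r, k) ∈ lam
  · exact h _ hc
  · rw [T.1.zeros hc, T'.1.zeros hc]

theorem SYT.ext_of_rowWord {T T' : SYT lam} (h : rowWord T.1 = rowWord T'.1) : T = T' :=
  SYT.ext_of_cells (rowWord_eq_iff.1 h)

theorem card_filter_cells (p : ℕ × ℕ → Prop) [DecidablePred p] :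
    (lam.cells.filter p).card = (readingCells lam).countP (fun c => decide (p c)) := by
  have h1 : lam.cells = (readingCells lam).toFinset := by
    ext c
    rw [List.mem_toFinset, mem_readingCells, YoungDiagram.mem_cells]
  have h2 : lam.cells.filter p = ((readingCells lam).filter (fun c => decide (p c))).toFinset := by
    rw [List.toFinset_filter, h1]
    simp
  rw [h2, List.toFinset_card_of_nodup ((readingCells_nodup lam).filter _),
    List.countP_eq_length_filter]

/-- For equal entries of a semistandard tableau, the reading order is the order of the columns. -/
theorem readBefore_iff_of_eq (b : SemistandardYoungTableau lam) {c c' : ℕ × ℕ} (hc : c ∈ lam)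
    (hc' : c' ∈ lam) (h : b c.1 c.2 = b c'.1 c'.2) : (ReadBefore c c' ∨ c = c') ↔ c.2 ≤ c'.2 := by
  have key : ∀ {c c' : ℕ × ℕ}, c ∈ lam → b c.1 c.2 = b c'.1 c'.2 → c'.1 < c.1 → c.2 < c'.2 := by
    intro c c' hc h h1
    by_contra h2
    have h3 : (c.1, c'.2) ∈ lam := lam.up_left_mem le_rfl (not_lt.1 h2) hc
    have h4 := b.col_strict h1 h3
    have h5 : b c.1 c'.2 ≤ b c.1 c.2 := b.row_weak_of_le (not_lt.1 h2) hc
    omega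
  obtain ⟨r, k⟩ := c
  obtain ⟨r', k'⟩ := c'
  unfold ReadBefore
  simp only [Prod.mk.injEq] at *
  constructor
  · rintro ((h1 | h1) | h1)
    · exact (key (c := (r, k)) (c' := (r', k')) hc h h1).le
    · omega
    · omega
  · intro h1
    rcases lt_trichotomy r' r with h2 | h2 | h2
    · exact Or.inl (Or.inl h2)
    · omega
    · have := key (c := (r', k')) (c' := (r, k)) hc' h.symm h2
      simp only at this
      omega

theorem isStandardization_iff {b T : SemistandardYoungTableau lam} :
    IsStandardization b T ↔ IsStdWord (rowWord b) (rowWord T) := by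
  have key : ∀ p r k, (readingCells lam)[p]? = some (r, k) →
      (lam.cells.filter fun c => b c.1 c.2 < b r k).card
      + (lam.cells.filter fun c => b c.1 c.2 = b r k ∧ c.2 ≤ k).card =
      (rowWord b).countP (· < b r k) + ((rowWord b).take (p + 1)).count (b r k) := by
    intro p r k hp
    have hrk : (r, k) ∈ lam := mem_readingCells.1 (List.mem_of_getElem? hp)
    have hidx : (readingCells lam).idxOf (r, k) = p := by
      obtain ⟨h, h'⟩ := List.getElem?_eq_some_iff.1 hp
      rw [← h', (readingCells_nodup lam).idxOf_getElem]
    rw [rowWord_eq_map, card_filter_cells, card_filter_cells, List.countP_map, ← List.map_take,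
      List.count, List.countP_map]
    congr 1
    conv_lhs => rw [← List.take_append_drop (p + 1) (readingCells lam), List.countP_append]
    have h1 : ((readingCells lam).drop (p + 1)).countP
        (fun c => decide (b c.1 c.2 = b r k ∧ c.2 ≤ k)) = 0 := by
      rw [List.countP_eq_zero]
      intro c hc
      have hcl := List.mem_of_mem_drop hc
      simp only [decide_eq_true_eq]
      rintro ⟨h2, h3⟩
      have h4 := (readBefore_iff_of_eq b (mem_readingCells.1 hcl) hrk h2).2 h3
      have h5 : (readingCells lam).idxOf c ≤ p := by
        rcases h4 with h4 | rfl
        · rw [← hidx]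
          exact ((idxOf_readingCells_lt_iff (mem_readingCells.1 hcl) hrk).2 h4).le
        · exact hidx.le
      obtain ⟨j, hj, rfl⟩ := List.getElem_of_mem hc
      rw [List.getElem_drop, (readingCells_nodup lam).idxOf_getElem] at h5
      omega
    rw [h1, add_zero]
    apply List.countP_congr
    intro c hc
    have hcl := List.mem_of_mem_take hc
    simp only [decide_eq_true_eq, Function.comp_apply, beq_iff_eq]
    refine ⟨fun h => h.1, fun h => ⟨h, ?_⟩⟩
    rw [← readBefore_iff_of_eq b (c' := (r, k)) (mem_readingCells.1 hcl) hrk h]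
    have h5 : (readingCells lam).idxOf c ≤ p := by
      obtain ⟨j, hj, rfl⟩ := List.getElem_of_mem hc
      rw [List.getElem_take, (readingCells_nodup lam).idxOf_getElem]
      rw [List.length_take] at hj
      omega
    rcases Nat.lt_or_eq_of_le h5 with h6 | h6
    · left
      rw [← idxOf_readingCells_lt_iff (mem_readingCells.1 hcl) hrk, hidx]
      exact h6
    · right
      rw [← hidx, List.idxOf_inj hcl] at h6
      exact h6
  constructor
  · intro h
    refine ⟨by simp [rowWord_eq_map], ?_⟩
    intro p x hx
    have hx' := hx
    rw [rowWord_eq_map, List.getElem?_map, Option.map_eq_some_iff] at hx'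
    obtain ⟨⟨r, k⟩, hp, rfl⟩ := hx'
    have hrk : (r, k) ∈ lam := mem_readingCells.1 (List.mem_of_getElem? hp)
    rw [rowWord_eq_map T, List.getElem?_map, hp, Option.map_some]
    simp only
    rw [h r k hrk, key p r k hp]
  · intro h r k hrk
    obtain ⟨p, hp⟩ := List.getElem?_of_mem (mem_readingCells.2 hrk)
    have h1 := h.2 p (b r k) (by rw [rowWord_eq_map, List.getElem?_map, hp]; rfl)
    rw [rowWord_eq_map T, List.getElem?_map, hp, Option.map_some, Option.some.injEq] at h1
    simp only at h1
    rw [key p r k hp, h1]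

/-- The semistandard tableau that arises by applying a weakly increasing map to all entries. -/
def relabel (T : SemistandardYoungTableau lam) (φ : ℕ → ℕ) (h0 : φ 0 = 0)
    (hmono : ∀ x y, x ≤ y → φ x ≤ φ y)
    (hcol : ∀ r r' k, r < r' → (r', k) ∈ lam → φ (T r k) ≠ φ (T r' k)) :
    SemistandardYoungTableau lam where
  entry r k := φ (T r k)
  row_weak' h hc := hmono _ _ (T.row_weak h hc)
  col_strict' h hc := lt_of_le_of_ne (hmono _ _ (T.col_strict h hc).le) (hcol _ _ _ h hc)
  zeros' h := by
    have := T.zeros h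
    rw [this, h0]

theorem rowWord_relabel (T : SemistandardYoungTableau lam) {φ : ℕ → ℕ} (h0 : φ 0 = 0)
    (hmono : ∀ x y, x ≤ y → φ x ≤ φ y)
    (hcol : ∀ r r' k, r < r' → (r', k) ∈ lam → φ (T r k) ≠ φ (T r' k)) :
    rowWord (relabel T φ h0 hmono hcol) = (rowWord T).map φ := by
  rw [rowWord_eq_map, rowWord_eq_map, List.map_map]
  rfl

/-- A map whose fibers are read in increasing order separates the entries of a column, which are
read in decreasing order. -/
theorem SYT.column_ne (T : SYT lam) {φ : ℕ → ℕ}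
    (hfib : ∀ x y, x < y → φ x = φ y → (rowWord T.1).idxOf x < (rowWord T.1).idxOf y)
    (r r' k : ℕ) (hr : r < r') (hc : (r', k) ∈ lam) : φ (T.1 r k) ≠ φ (T.1 r' k) := by
  intro h
  have h1 := hfib _ _ (T.1.col_strict hr hc) h
  have h2 := (T.idxOf_lt_iff (c := (r, k)) (c' := (r', k))
    (lam.up_left_mem hr.le le_rfl hc) hc).1 h1
  unfold ReadBefore at h2
  simp only at h2
  omega

/-- If consecutive letters occur in increasing order, they form the subword `lo, lo + 1, …`. -/
theorem filter_eq_range' {t : List ℕ} (ht : t.Nodup) {lo X : ℕ}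
    (hmem : ∀ x, lo ≤ x → x < lo + X → x ∈ t)
    (h : ∀ x y, lo ≤ x → x < y → y < lo + X → t.idxOf x < t.idxOf y) :
    t.filter (fun x => decide (lo ≤ x ∧ x < lo + X)) = List.range' lo X := by
  have hp : t.Pairwise (fun x y => t.idxOf x < t.idxOf y) := by
    rw [List.pairwise_iff_getElem]
    intro a b ha hb hab
    rw [ht.idxOf_getElem, ht.idxOf_getElem]
    exact hab
  have hp2 : (t.filter (fun x => decide (lo ≤ x ∧ x < lo + X))).Pairwise (· < ·) := by
    rw [List.pairwise_filter]
    refine hp.imp ?_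
    intro a b hab ha hb
    simp only [decide_eq_true_eq] at ha hb
    by_contra hlt
    rcases Nat.lt_or_eq_of_le (not_lt.1 hlt) with h1 | rfl
    · have := h b a hb.1 h1 ha.2
      omega
    · omega
  have hperm : (t.filter (fun x => decide (lo ≤ x ∧ x < lo + X))).Perm (List.range' lo X) := by
    rw [List.perm_ext_iff_of_nodup (ht.filter _) List.nodup_range']
    intro x
    simp only [List.mem_filter, decide_eq_true_eq, List.mem_range'_1]
    exact ⟨fun h => h.2, fun h => ⟨hmem x h.1 h.2, h⟩⟩
  exact hperm.eq_of_pairwise (fun a b _ _ h1 h2 => by omega) hp2 List.pairwise_lt_range'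

/-! ### Edges of the crystal skeleton as Dyck moves -/

theorem idxOf_filter_lt_iff {p : ℕ → Bool} {w : List ℕ} {x y : ℕ} (hx : p x = true)
    (hy : p y = true) :
    (w.filter p).idxOf x < (w.filter p).idxOf y ↔ w.idxOf x < w.idxOf y := by
  induction w with
  | nil => rfl
  | cons z w ih =>
    by_cases hz : p z = true
    · rw [List.filter_cons_of_pos hz, List.idxOf_cons, List.idxOf_cons, List.idxOf_cons,
        List.idxOf_cons]
      by_cases h1 : z = x
      · by_cases h2 : z = y
        · simp [← h1, ← h2]
        · simp [← h1, beq_false_of_ne h2]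
      · by_cases h2 : z = y
        · simp [← h2, beq_false_of_ne h1]
        · simp [beq_false_of_ne h1, beq_false_of_ne h2, ih]
    · have h1 : z ≠ x := fun h => hz (h ▸ hx)
      have h2 : z ≠ y := fun h => hz (h ▸ hy)
      rw [List.filter_cons_of_neg hz, List.idxOf_cons_ne _ h1, List.idxOf_cons_ne _ h2, ih]
      omega

theorem DyckOrder.congr {i m q : ℕ} {pos pos' : ℕ → ℕ} (h : DyckOrder i m q pos)
    (hp : ∀ x y, i ≤ x → x ≤ i + 2 * m → i ≤ y → y ≤ i + 2 * m → pos x < pos y →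
      pos' x < pos' y) : DyckOrder i m q pos' := by
  have hle := h.le
  refine ⟨h.le, fun j hj => ?_, fun j hj => ?_, fun j hj => ?_, fun hj => ?_, fun j hj hj' => ?_⟩
  · exact hp _ _ (by omega) (by omega) (by omega) (by omega) (h.small j hj)
  · exact hp _ _ (by omega) (by omega) (by omega) (by omega) (h.large j hj)
  · exact hp _ _ (by omega) (by omega) (by omega) (by omega) (h.left j hj)
  · exact hp _ _ (by omega) (by omega) (by omega) (by omega) (h.mid hj)
  · exact hp _ _ (by omega) (by omega) (by omega) (by omega) (h.right j hj hj')

theorem dyckOrder_filter_iff {i m q : ℕ} {p : ℕ → Bool} {w : List ℕ}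
    (hp : ∀ x, i ≤ x → x ≤ i + 2 * m → p x = true) :
    DyckOrder i m q (fun x => (w.filter p).idxOf x) ↔ DyckOrder i m q (fun x => w.idxOf x) :=
  ⟨fun h => h.congr fun x y h1 h2 h3 h4 => (idxOf_filter_lt_iff (hp x h1 h2) (hp y h3 h4)).1,
    fun h => h.congr fun x y h1 h2 h3 h4 => (idxOf_filter_lt_iff (hp x h1 h2) (hp y h3 h4)).2⟩

theorem openBrackets_filter {i : ℕ} (w : List ℕ) (φ : ℕ → ℕ) (p : ℕ → Bool)
    (hp : ∀ x, p x = false → φ x ≠ i ∧ φ x ≠ i + 1) :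
    openBrackets i ((w.filter p).map φ) = openBrackets i (w.map φ) := by
  induction w using List.reverseRecOn with
  | nil => rfl
  | append_singleton w x ih =>
    rw [List.filter_append, List.map_append, List.map_append, List.map_singleton,
      openBrackets_append_singleton, ← ih]
    by_cases hx : p x = true
    · rw [List.filter_cons_of_pos hx, List.filter_nil, List.map_singleton,
        openBrackets_append_singleton]
    · have := hp x (by simpa using hx)
      rw [List.filter_cons_of_neg hx, List.filter_nil, List.map_nil, List.append_nil,
        if_neg this.2, if_neg this.1]

theorem WordLowers.unique {i : ℕ} {w w' w'' : List ℕ} (h : WordLowers i w w')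
    (h' : WordLowers i w w'') : w' = w'' := by
  obtain ⟨p, h1, h2, rfl⟩ := h
  obtain ⟨p', h1', h2', rfl⟩ := h'
  have : p = p' := by
    rcases lt_trichotomy p p' with h | h | h
    · exact absurd h1' (h2 _ h)
    · exact h
    · exact absurd h1 (h2' _ h)
  rw [this]

theorem DyckMove.ne {i m : ℕ} (hm : 1 ≤ m) {t t' : List ℕ} (h : DyckMove i m t t') : t ≠ t' := by
  obtain ⟨q, h1, h2, rfl⟩ := h
  intro h
  have hle := h2.le
  have h3 : i + q ∈ t := h1 _ (by omega) (by omega)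
  obtain ⟨p, hp⟩ := List.getElem?_of_mem h3
  have h4 : (t.map (dyckCycle i m q))[p]? = some (i + q) := by rw [← h, hp]
  rw [List.getElem?_map, hp, Option.map_some, Option.some.injEq, dyckCycle, if_pos rfl] at h4
  omega

theorem exists_dyckMove_of_csEdge {n : ℕ} {T T' : SYT lam} (h : CSEdge n T T') :
    ∃ i m, 1 ≤ m ∧ DyckMove i m (rowWord T.1) (rowWord T'.1) := by
  obtain ⟨hne, b, b', hb, hb', i, -, -, hl⟩ := h
  obtain ⟨i₀, m, hm, h⟩ := exists_dyckMove_of_wordLowers (isStandardization_iff.1 hb)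
    (isStandardization_iff.1 hb') T.rowWord_nodup hl (fun h => hne (SYT.ext_of_rowWord h))
  exact ⟨i₀, m, hm, h⟩

/-- The letters of a Dyck pattern insert to the two rows required of a Dyck pattern interval,
because all large letters are bracketed. -/
theorem isDyckPatternInterval_of_dyckMove {i m : ℕ} (hm : 1 ≤ m) {T : SYT lam} {v : List ℕ}
    (h : DyckMove i m (rowWord T.1) v) : IsDyckPatternInterval T i m := by
  have hb := h.bound T.rowWord_perm
  have hob := (h.wordLowers hm T.rowWord_perm).2
  refine ⟨hm, hb.1, hb.2, ?_⟩
  obtain ⟨q, hmem, h, -⟩ := h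
  have hs := filter_eq_range' (lo := i) (X := m + 1) T.rowWord_nodup
    (fun x h1 h2 => hmem x h1 (by omega)) (fun x y h1 h2 h3 => h.small_lt h1 h2 (by omega))
  have hl := filter_eq_range' (lo := i + m + 1) (X := m) T.rowWord_nodup
    (fun x h1 h2 => hmem x (by omega) (by omega)) (fun x y h1 h2 h3 => h.large_lt h1 h2 (by omega))
  obtain ⟨d, e, h1, h2, -, h3⟩ := insertionTableau_of_filter (i := i) (m := m)
    ((rowWord T.1).filter fun x => decide (i ≤ x ∧ x ≤ i + 2 * m)) (α := m + 1) (β := m) le_rfl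
    (fun x hx => by simpa using (List.mem_filter.1 hx).2)
    (by
      rw [List.filter_filter, ← hs]
      apply List.filter_congr
      intro x _
      rw [← Bool.decide_and, decide_eq_decide]
      omega)
    (by
      rw [List.filter_filter, ← hl]
      apply List.filter_congr
      intro x _
      rw [← Bool.decide_and, decide_eq_decide]
      omega)
  rw [openBrackets_filter, hob] at h1
  · subst h1
    rw [h3]
    obtain rfl : e = m := by omega
    have : List.range' (i + e + 1) e ≠ [] := by
      rw [ne_eq, List.range'_eq_nil_iff]; omega
    simp [this]
  · intro x hx
    rw [decide_eq_false_iff_not] at hx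
    unfold collapse
    split_ifs <;> omega

theorem exists_dyckMove_of_isDyckPatternInterval {i m : ℕ} {T : SYT lam}
    (h : IsDyckPatternInterval T i m) : ∃ v, DyckMove i m (rowWord T.1) v := by
  obtain ⟨hm, hi, hn, h⟩ := h
  obtain ⟨v, q, hmem, h1, -⟩ := exists_dyckMove_of_insertionTableau
    (T.rowWord_nodup.filter _) h
  refine ⟨_, q, fun x h1 h2 => List.mem_of_mem_filter (hmem x h1 h2), ?_, rfl⟩
  rwa [dyckOrder_filter_iff] at h1
  intro x h1 h2
  simp [h1, h2]

theorem exists_lowers_of_dyckMove {i m : ℕ} (hm : 1 ≤ m) {T T' : SYT lam}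
    (h : DyckMove i m (rowWord T.1) (rowWord T'.1)) :
    ∃ b b' : SemistandardYoungTableau lam, (∀ r k, b r k = collapse i m (T.1 r k)) ∧
      (∀ r k, b' r k = collapseTarget i m (T'.1 r k)) ∧ Lowers i b b' ∧
      IsStandardization b T.1 ∧ IsStandardization b' T'.1 := by
  have hi := (h.bound T.rowWord_perm).1
  refine ⟨relabel T.1 (collapse i m) (by unfold collapse; split_ifs <;> omega)
      (fun _ _ => collapse_mono hm) (T.column_ne fun x y hxy he => ?_),
    relabel T'.1 (collapseTarget i m) (by unfold collapseTarget; split_ifs <;> omega)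
      (fun _ _ => collapseTarget_mono hm)
      (T'.column_ne fun x y hxy he => h.target_fiber hm hxy he),
    fun _ _ => rfl, fun _ _ => rfl, ?_, ?_, ?_⟩
  · obtain ⟨q, -, h, -⟩ := h
    exact dyckOrder_fiber h hxy he
  · rw [Lowers, rowWord_relabel, rowWord_relabel]
    exact (h.wordLowers hm T.rowWord_perm).1
  · rw [isStandardization_iff, rowWord_relabel]
    exact h.isStdWord_collapse hm T.rowWord_perm
  · rw [isStandardization_iff, rowWord_relabel]
    exact h.isStdWord_collapseTarget hm T.rowWord_perm

/-- A Dyck move between the reading words of two standard tableaux is an edge of the crystal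
skeleton.  Since `i + 2m ≤ |lam| ≤ n`, the collapsed tableaux have entries in `{1, …, n}`, and
`i < n`. -/
theorem csEdge_of_dyckMove {n i m : ℕ} (hn : lam.card ≤ n) (hm : 1 ≤ m) {T T' : SYT lam}
    (h : DyckMove i m (rowWord T.1) (rowWord T'.1)) : CSEdge n T T' := by
  obtain ⟨hi, hin⟩ := h.bound T.rowWord_perm
  obtain ⟨b, b', hb, hb', h1, h2, h3⟩ := exists_lowers_of_dyckMove hm h
  refine ⟨fun he => h.ne hm (by rw [he]), ⟨b, ?_⟩, ⟨b', ?_⟩, h2, h3, i, hi, by omega, h1⟩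
  · intro r k hrk
    have := T.mem_Icc hrk
    rw [hb, collapse]
    simp only at this
    split_ifs <;> omega
  · intro r k hrk
    have := T'.mem_Icc hrk
    rw [hb', collapseTarget]
    simp only at this
    split_ifs <;> omega

theorem hasDyckLabel_iff {i j : ℕ} {T T' : SYT lam} :
    HasDyckLabel T i j T' ↔
      ∃ m, 1 ≤ m ∧ j = i + 2 * m ∧ DyckMove i m (rowWord T.1) (rowWord T'.1) := by
  constructor
  · rintro ⟨m, rfl, hI, b, b', hb, hl, hstd⟩
    obtain ⟨v, hv⟩ := exists_dyckMove_of_isDyckPatternInterval hI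
    refine ⟨m, hI.1, rfl, ?_⟩
    have h1 := (hv.wordLowers hI.1 T.rowWord_perm).1
    have h2 : rowWord b = (rowWord T.1).map (collapse i m) := by
      rw [rowWord_eq_map, rowWord_eq_map, List.map_map]
      exact List.map_congr_left fun c _ => hb _ _
    rw [Lowers, h2] at hl
    have h3 := (h1.unique hl)
    have h4 := hv.isStdWord_collapseTarget hI.1 T.rowWord_perm
    rw [h3] at h4
    rwa [(isStandardization_iff.1 hstd).unique h4]
  · rintro ⟨m, hm, rfl, h⟩
    obtain ⟨b, b', hb, hb', h1, h2, h3⟩ := exists_lowers_of_dyckMove hm h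
    exact ⟨m, rfl, isDyckPatternInterval_of_dyckMove hm h, b, b', hb, h1, h3⟩

/-- The edges of the crystal skeleton labeled by `[i, j]` are the Dyck moves on `[i, j]` between the
reading words. -/
theorem csLabeledEdge_iff {n i j : ℕ} (hn : lam.card ≤ n) {T T' : SYT lam} :
    CSLabeledEdge n T i j T' ↔
      ∃ m, 1 ≤ m ∧ j = i + 2 * m ∧ DyckMove i m (rowWord T.1) (rowWord T'.1) := by
  rw [CSLabeledEdge, hasDyckLabel_iff]
  refine ⟨fun h => h.2, fun h => ⟨?_, h⟩⟩
  obtain ⟨m, hm, -, h⟩ := h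
  exact csEdge_of_dyckMove hn hm h

/-! ### Connectedness of the crystal skeleton -/

/-- The standard tableau that arises by applying to all entries a permutation of `{1, …, |lam|}`
that keeps rows and columns increasing. -/
def SYT.relabel (T : SYT lam) (σ : ℕ → ℕ) (h0 : σ 0 = 0)
    (hbij : Set.BijOn σ (Set.Icc 1 lam.card) (Set.Icc 1 lam.card))
    (hrow : ∀ r k k', k < k' → (r, k') ∈ lam → σ (T.1 r k) < σ (T.1 r k'))
    (hcol : ∀ r r' k, r < r' → (r', k) ∈ lam → σ (T.1 r k) < σ (T.1 r' k)) : SYT lam :=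
  ⟨{ entry := fun r k => σ (T.1 r k)
     row_weak' := fun h hc => (hrow _ _ _ h hc).le
     col_strict' := fun h hc => hcol _ _ _ h hc
     zeros' := fun h => by rw [T.1.zeros h, h0] }, hbij.comp T.2⟩

theorem SYT.row_lt (T : SYT lam) {r k k' : ℕ} (h : k < k') (hc : (r, k') ∈ lam) :
    T.1 r k < T.1 r k' := by
  refine lt_of_le_of_ne (T.1.row_weak h hc) fun he => ?_
  have := T.inj (c := (r, k)) (c' := (r, k')) (lam.up_left_mem le_rfl h.le hc) hc he
  simp at this
  omega

theorem SYT.lt_of_le (T : SYT lam) {c d : ℕ × ℕ} (hcd : c ≤ d) (hne : c ≠ d) (hd : d ∈ lam) :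
    T.1 c.1 c.2 < T.1 d.1 d.2 := by
  have hle : T.1 c.1 c.2 ≤ T.1 d.1 d.2 :=
    (T.1.col_weak hcd.1 (lam.up_left_mem le_rfl hcd.2 hd)).trans (T.1.row_weak_of_le hcd.2 hd)
  exact lt_of_le_of_ne hle fun he => hne (T.inj (lam.isLowerSet hcd hd) hd he)

theorem dyckCycle_bijOn {i m q n : ℕ} (h1 : 1 ≤ i + q) (h2 : i + m + q ≤ n) :
    Set.BijOn (dyckCycle i m q) (Set.Icc 1 n) (Set.Icc 1 n) := by
  refine ⟨?_, (dyckCycle_injective i m q).injOn, ?_⟩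
  · intro x hx
    simp only [Set.mem_Icc] at *
    unfold dyckCycle
    split_ifs <;> omega
  · intro a ha
    simp only [Set.mem_Icc] at ha
    refine ⟨if a = i + m + q then i + q else if i + q ≤ a ∧ a < i + m + q then a + 1 else a, ?_, ?_⟩
    · simp only [Set.mem_Icc]
      split_ifs <;> omega
    · unfold dyckCycle
      split_ifs <;> omega

/-- The cycle keeps a tableau standard if no entry that the entry `i + q` overtakes lies weakly
above and to the right of it. -/
theorem SYT.exists_dyckCycle (T : SYT lam) {i m q : ℕ} (h1 : 1 ≤ i + q) (h2 : i + m + q ≤ lam.card)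
    (h : ∀ c d : ℕ × ℕ, c ≤ d → d ∈ lam → T.1 c.1 c.2 = i + q → i + q < T.1 d.1 d.2 →
      i + m + q < T.1 d.1 d.2) :
    ∃ T' : SYT lam, ∀ c : ℕ × ℕ, T'.1 c.1 c.2 = dyckCycle i m q (T.1 c.1 c.2) := by
  have key : ∀ c d : ℕ × ℕ, c ≤ d → c ≠ d → d ∈ lam →
      dyckCycle i m q (T.1 c.1 c.2) < dyckCycle i m q (T.1 d.1 d.2) := by
    intro c d hcd hne hd
    have h3 := T.lt_of_le hcd hne hd
    have h4 := h c d hcd hd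
    rw [dyckCycle_lt_iff] <;> omega
  exact ⟨T.relabel (dyckCycle i m q) (by unfold dyckCycle; split_ifs <;> omega)
    (dyckCycle_bijOn h1 h2)
    (fun r k k' hk hc => key (r, k) (r, k') (by simp [hk.le]) (by simp; omega) hc)
    (fun r r' k hr hc => key (r, k) (r', k) (by simp [hr.le]) (by simp; omega) hc), fun _ => rfl⟩

/-- The letters `x` and `x + 1` of a standard tableau can be interchanged if the letter `y`, which
is `x + 2` or `x - 1`, is read between them: an elementary dual Knuth transformation.  The letter
`y` prevents `x` and `x + 1` from being in adjacent cells. -/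
theorem SYT.exists_swap (T : SYT lam) {x y : ℕ} (hx : 1 ≤ x) (hx2 : x + 1 ≤ lam.card)
    (hy : y = x + 2 ∨ y + 1 = x) (hy1 : 1 ≤ y) (hy2 : y ≤ lam.card)
    (hb : ((rowWord T.1).idxOf x < (rowWord T.1).idxOf y ∧
        (rowWord T.1).idxOf y < (rowWord T.1).idxOf (x + 1)) ∨
      ((rowWord T.1).idxOf (x + 1) < (rowWord T.1).idxOf y ∧
        (rowWord T.1).idxOf y < (rowWord T.1).idxOf x)) :
    ∃ T' : SYT lam, rowWord T'.1 = (rowWord T.1).map (dyckCycle x 1 0) := by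
  obtain ⟨cy, hcy, hTy⟩ := T.exists_cell hy1 hy2
  obtain ⟨T', hT'⟩ := T.exists_dyckCycle (i := x) (m := 1) (q := 0) hx hx2 (by
    intro c d hcd hd hc hd2
    by_contra hlt
    have hd3 : T.1 d.1 d.2 = x + 1 := by omega
    have hcl : c ∈ lam := lam.isLowerSet hcd hd
    rw [← hd3, ← hTy, ← (show T.1 c.1 c.2 = x from hc)] at hb
    rw [T.idxOf_lt_iff hcl hcy, T.idxOf_lt_iff hcy hd, T.idxOf_lt_iff hd hcy,
      T.idxOf_lt_iff hcy hcl] at hb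
    obtain ⟨r, k⟩ := c
    obtain ⟨r', k'⟩ := d
    obtain ⟨a, b⟩ := cy
    simp only [Prod.mk_le_mk] at hcd
    simp only [ReadBefore] at *
    have hval : ∀ e ∈ lam, T.1 e.1 e.2 = x → e = (r, k) := fun e he h =>
      T.inj he hcl (h.trans hc.symm)
    have hval' : ∀ e ∈ lam, T.1 e.1 e.2 = x + 1 → e = (r', k') := fun e he h =>
      T.inj he hd (h.trans hd3.symm)
    rcases Nat.eq_or_lt_of_le hcd.1 with rfl | hr
    · -- same row
      rcases hb with hb | hb
      · obtain rfl : a = r := by omega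
        have h1 := T.row_lt (show k < b by omega) hcy
        have h2 := T.row_lt (show b < k' by omega) hd
        omega
      · rcases Nat.eq_or_lt_of_le hcd.2 with rfl | hk
        · omega
        · omega
    · -- the cell above `x` holds `x + 1`
      have h1 : (r', k) ∈ lam := lam.up_left_mem le_rfl hcd.2 hd
      have h2 : (r + 1, k) ∈ lam := lam.up_left_mem hr le_rfl h1
      have h3 := T.1.col_strict (show r < r + 1 by omega) h2
      have h4 : T.1 (r + 1) k ≤ T.1 r' k' :=
        (T.1.col_weak hr h1).trans (T.1.row_weak_of_le hcd.2 hd)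
      have h5 := hval' (r + 1, k) h2 (by simp only; omega)
      simp only [Prod.mk.injEq] at h5
      obtain ⟨rfl, rfl⟩ := h5
      rcases hb with hb | hb
      · omega
      · rcases (show (a = r + 1 ∧ k < b) ∨ (a = r ∧ b < k) by omega) with ⟨rfl, hbk⟩ | ⟨rfl, hbk⟩
        · have h6 := T.row_lt hbk hcy
          have h7 : (r + 1, k + 1) ∈ lam := lam.up_left_mem le_rfl hbk hcy
          have h8 : (r, k + 1) ∈ lam := lam.up_left_mem (by omega) le_rfl h7
          have h9 := T.1.col_strict (show r < r + 1 by omega) h7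
          have h10 := T.1.row_weak_of_le (show k + 1 ≤ b from hbk) hcy
          have h11 := T.row_lt (show k < k + 1 by omega) h8
          have h12 := hval' (r, k + 1) h8 (by simp only; omega)
          simp at h12
        · have h6 := T.row_lt hbk hcl
          have h7 : (a + 1, b) ∈ lam := lam.up_left_mem le_rfl hbk.le h2
          have h8 := T.1.col_strict (show a < a + 1 by omega) h7
          have h9 := T.row_lt hbk h2
          have h12 := hval (a + 1, b) h7 (by simp only; omega)
          simp at h12)
  refine ⟨T', ?_⟩
  rw [rowWord_eq_map, rowWord_eq_map, List.map_map]
  exact List.map_congr_left fun c _ => hT' c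

/-- For `m = 1` the cycle is the transposition of `i + q` and `i + q + 1`. -/
theorem dyckCycle_one (i q x : ℕ) : dyckCycle i 1 q x = dyckCycle (i + q) 1 0 x := by
  unfold dyckCycle
  split_ifs <;> omega

theorem dyckCycle_one_involutive (x : ℕ) : Function.Involutive (dyckCycle x 1 0) := by
  intro y
  unfold dyckCycle
  split_ifs <;> omega

theorem SYT.exists_of_dyckMove (T : SYT lam) {i : ℕ} {v : List ℕ}
    (h : DyckMove i 1 (rowWord T.1) v) : ∃ T' : SYT lam, rowWord T'.1 = v := by
  obtain ⟨hi, hin⟩ := h.bound T.rowWord_perm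
  obtain ⟨q, -, h, rfl⟩ := h
  have hle := h.le
  rw [show dyckCycle i 1 q = dyckCycle (i + q) 1 0 from funext (dyckCycle_one i q)]
  obtain rfl | rfl : q = 0 ∨ q = 1 := by omega
  · have h1 := h.mid (by omega)
    have h2 := h.right 0 le_rfl (by omega)
    exact T.exists_swap (y := i + 2) (by omega) (by omega) (by omega) (by omega) (by omega)
      (Or.inl ⟨h1, h2⟩)
  · have h1 := h.left 0 (by omega)
    have h2 := h.small 0 (by omega)
    exact T.exists_swap (y := i) (by omega) (by omega) (by omega) (by omega) (by omega)
      (Or.inr ⟨h1, h2⟩)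

theorem SYT.exists_of_dyckMove_symm (T : SYT lam) {i : ℕ} {v : List ℕ}
    (h : DyckMove i 1 v (rowWord T.1)) : ∃ T' : SYT lam, rowWord T'.1 = v := by
  obtain ⟨q, hmem, h, hT⟩ := h
  have hle := h.le
  rw [show dyckCycle i 1 q = dyckCycle (i + q) 1 0 from funext (dyckCycle_one i q)] at hT
  have hletters : ∀ x, i ≤ x → x ≤ i + 2 → 1 ≤ x ∧ x < 1 + lam.card := by
    intro x h1 h2
    rw [← List.mem_range'_1, ← T.rowWord_perm.mem_iff, hT,
      ← dyckCycle_one_involutive (i + q) x]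
    refine List.mem_map_of_mem (hmem _ ?_ ?_) <;>
    · unfold dyckCycle
      split_ifs <;> omega
  have hi := hletters i le_rfl (by omega)
  have hin := hletters (i + 2) (by omega) le_rfl
  have hv' : v = (rowWord T.1).map (dyckCycle (i + q) 1 0) := by
    rw [hT, List.map_map, (dyckCycle_one_involutive _).comp_self, List.map_id]
  have hidx : ∀ x, (rowWord T.1).idxOf (dyckCycle (i + q) 1 0 x) = v.idxOf x := by
    intro x
    rw [hT, idxOf_map_of_injective (dyckCycle_injective _ _ _)]
  rw [hv']
  obtain rfl | rfl : q = 0 ∨ q = 1 := by omega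
  · have h1 := h.mid (by omega)
    have h2 := h.right 0 le_rfl (by omega)
    simp only [← hidx] at h1 h2
    rw [show dyckCycle (i + 0) 1 0 (i + 0) = i + 0 + 1 by simp [dyckCycle],
      show dyckCycle (i + 0) 1 0 (i + 1 + 1 + 0) = i + 2 by
        unfold dyckCycle; split_ifs <;> omega] at h1
    rw [show dyckCycle (i + 0) 1 0 (i + 0 + 1) = i + 0 by simp [dyckCycle],
      show dyckCycle (i + 0) 1 0 (i + 1 + 1 + 0) = i + 2 by
        unfold dyckCycle; split_ifs <;> omega] at h2
    exact T.exists_swap (y := i + 2) (by omega) (by omega) (by omega) (by omega) (by omega)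
      (Or.inr ⟨h1, h2⟩)
  · have h1 := h.left 0 (by omega)
    have h2 := h.small 0 (by omega)
    simp only [← hidx] at h1 h2
    rw [show dyckCycle (i + 1) 1 0 (i + 0) = i by simp [dyckCycle],
      show dyckCycle (i + 1) 1 0 (i + 1 + 1 + 0) = i + 1 by simp [dyckCycle]] at h1
    rw [show dyckCycle (i + 1) 1 0 (i + 0) = i by simp [dyckCycle],
      show dyckCycle (i + 1) 1 0 (i + 0 + 1) = i + 1 + 1 by simp [dyckCycle]] at h2
    exact T.exists_swap (y := i) (by omega) (by omega) (by omega) (by omega) (by omega)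
      (Or.inl ⟨h1, h2⟩)

/-- In a standard tableau, an entry in a cell that is maximal among the cells with entries at most
`k` can be raised to `k`. -/
theorem SYT.exists_send (S : SYT lam) {k : ℕ} {c : ℕ × ℕ} (hc : c ∈ lam) (hk : S.1 c.1 c.2 ≤ k)
    (hkn : k ≤ lam.card) (hmax : ∀ d ∈ lam, c ≤ d → c ≠ d → k < S.1 d.1 d.2) :
    ∃ S' : SYT lam, S'.1 c.1 c.2 = k ∧ (∀ d : ℕ × ℕ, k < S.1 d.1 d.2 → S'.1 d.1 d.2 = S.1 d.1 d.2) ∧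
      ∀ d : ℕ × ℕ, S.1 d.1 d.2 ≤ k → S'.1 d.1 d.2 ≤ k := by
  have h1 := S.mem_Icc hc
  obtain ⟨S', hS'⟩ := S.exists_dyckCycle (i := S.1 c.1 c.2) (m := k - S.1 c.1 c.2) (q := 0) h1.1
    (by omega) (by
      intro c' d hcd hd hc' hlt
      have hcc : c' = c := S.inj (lam.isLowerSet hcd hd) hc hc'
      subst hcc
      have := hmax d hd hcd (by rintro rfl; omega)
      omega)
  refine ⟨S', ?_, ?_, ?_⟩
  · rw [hS', dyckCycle, if_pos (by omega)]; omega
  · intro d hd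
    rw [hS', dyckCycle, if_neg (by omega), if_neg (by omega)]
  · intro d hd
    rw [hS', dyckCycle]
    split_ifs <;> omega

/-- The two tableaux are connected by edges with labels `[i, i + 2]`, regardless of their
directions. -/
def Linked (S S' : SYT lam) : Prop :=
  Relation.EqvGen (fun S S' : SYT lam => ∃ i, DyckMove i 1 (rowWord S.1) (rowWord S'.1)) S S'

/-- The tableaux agree on the entries larger than `k + 1`, and the entry `k + 1` lies in different
corners `c` and `c'` of the remaining shape.  Then some corner `e` of what is left lies between `c`
and `c'`.  Within tableaux having `k + 1` in `c`, the entries `k` and `k - 1` can be brought to `c'`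
and `e`; the letter `k - 1` then witnesses the exchange of `k` and `k + 1`. -/
theorem linked_of_corners {k : ℕ}
    (ih : ∀ S S' : SYT lam, (∀ d ∈ lam, k < S.1 d.1 d.2 → S'.1 d.1 d.2 = S.1 d.1 d.2) → Linked S S')
    (S S' : SYT lam) (hk : k + 1 ≤ lam.card)
    (h : ∀ d ∈ lam, k + 1 < S.1 d.1 d.2 → S'.1 d.1 d.2 = S.1 d.1 d.2)
    (h' : ∀ d ∈ lam, k + 1 < S'.1 d.1 d.2 → S.1 d.1 d.2 = S'.1 d.1 d.2)
    {c c' : ℕ × ℕ} (hc : c ∈ lam) (hc' : c' ∈ lam) (hSc : S.1 c.1 c.2 = k + 1)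
    (hSc' : S'.1 c'.1 c'.2 = k + 1) (hrow : c'.1 < c.1) : Linked S S' := by
  have hne : c ≠ c' := by rintro rfl; omega
  have hS'c : S'.1 c.1 c.2 ≤ k := by
    by_contra h1
    rcases Nat.lt_or_eq_of_le (not_le.1 h1) with h2 | h2
    · have := h' c hc h2; omega
    · exact hne (S'.inj hc hc' (by omega))
  have hScc' : S.1 c'.1 c'.2 ≤ k := by
    by_contra h1
    rcases Nat.lt_or_eq_of_le (not_le.1 h1) with h2 | h2
    · have := h c' hc' h2; omega
    · exact hne (S.inj hc hc' (by omega))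
  have hmaxc : ∀ d ∈ lam, c ≤ d → c ≠ d → k + 1 < S.1 d.1 d.2 := by
    intro d hd h1 h2
    have := S.lt_of_le h1 h2 hd
    omega
  have hmaxc' : ∀ d ∈ lam, c' ≤ d → c' ≠ d → k + 1 < S.1 d.1 d.2 := by
    intro d hd h1 h2
    have h3 := S'.lt_of_le h1 h2 hd
    have := h' d hd (by omega)
    omega
  have hcol : c.2 < c'.2 := by
    by_contra h1
    have := hmaxc' c hc ⟨hrow.le, not_lt.1 h1⟩ hne.symm
    omega
  -- a corner of the rest of the shape that lies between the two corners in reading order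
  obtain ⟨e, he, hemax⟩ :
      ∃ e ∈ lam.cells.filter (fun d => d.1 + 1 = c.1 ∧ S.1 d.1 d.2 ≤ k ∧ d ≠ c'),
      ∀ d ∈ lam.cells.filter (fun d => d.1 + 1 = c.1 ∧ S.1 d.1 d.2 ≤ k ∧ d ≠ c'),
        S.1 d.1 d.2 ≤ S.1 e.1 e.2 := by
    apply Finset.exists_max_image
    refine ⟨(c.1 - 1, c.2), ?_⟩
    have h1 : (c.1 - 1, c.2) ∈ lam := lam.up_left_mem (by omega) le_rfl hc
    have h2 := S.1.col_strict (show c.1 - 1 < c.1 by omega) hc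
    simp only [Finset.mem_filter, YoungDiagram.mem_cells]
    refine ⟨h1, by omega, by omega, ?_⟩
    rintro rfl
    simp at hcol
  have hbelow := hemax (c.1 - 1, c.2) (by
    have h1 : (c.1 - 1, c.2) ∈ lam := lam.up_left_mem (by omega) le_rfl hc
    have h2 := S.1.col_strict (show c.1 - 1 < c.1 by omega) hc
    simp only [Finset.mem_filter, YoungDiagram.mem_cells]
    refine ⟨h1, by omega, by omega, ?_⟩
    rintro rfl
    simp at hcol)
  simp only [Finset.mem_filter, YoungDiagram.mem_cells] at he hemax hbelow
  obtain ⟨hel, her, hSe, hec'⟩ := he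
  have hecol : c.2 ≤ e.2 := by
    by_contra h1
    have h2 : (c.1 - 1, c.2) ∈ lam := lam.up_left_mem (by omega) le_rfl hc
    have h3 := S.row_lt (not_le.1 h1) h2
    rw [show c.1 - 1 = e.1 by omega] at hbelow h3
    omega
  have hmaxe : ∀ d ∈ lam, e ≤ d → e ≠ d → d ≠ c → d ≠ c' → k + 1 < S.1 d.1 d.2 := by
    intro d hd h1 h2 h3 h4
    have h5 := S.lt_of_le h1 h2 hd
    rcases Nat.eq_or_lt_of_le h1.1 with h6 | h6
    · by_contra h7
      have h8 : S.1 d.1 d.2 ≠ k + 1 := fun h => h3 (S.inj hd hc (by omega))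
      have := hemax d ⟨hd, by omega, by omega, h4⟩
      omega
    · exact hmaxc d hd ⟨by omega, hecol.trans h1.2⟩ (Ne.symm h3)
  have hk1 := S.mem_Icc hel
  have hk2 := S.mem_Icc hc'
  have hk3 : S.1 e.1 e.2 ≠ S.1 c'.1 c'.2 := fun h => hec' (S.inj hel hc' h)
  obtain ⟨S₂, a1, a2, a3⟩ := S.exists_send (k := k) hc' hScc' (by omega)
    (fun d hd h1 h2 => by have := hmaxc' d hd h1 h2; omega)
  have b1 : S₂.1 c.1 c.2 = k + 1 := by rw [a2 c (by omega), hSc]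
  have b2 : S₂.1 e.1 e.2 ≤ k - 1 := by
    have h1 := a3 e hSe
    have h2 : S₂.1 e.1 e.2 ≠ k := fun h => hec' (S₂.inj hel hc' (by omega))
    omega
  obtain ⟨S₃, d1, d2, d3⟩ := S₂.exists_send (k := k - 1) hel b2 (by omega) (by
    intro d hd h1 h2
    by_cases h3 : d = c
    · rw [h3]; omega
    · by_cases h4 : d = c'
      · rw [h4]; omega
      · have := hmaxe d hd h1 h2 h3 h4
        rw [a2 d (by omega)]
        omega)
  have e1 : S₃.1 c.1 c.2 = k + 1 := by rw [d2 c (by omega), b1]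
  have e2 : S₃.1 c'.1 c'.2 = k := by rw [d2 c' (by omega), a1]
  have e3 : ∀ d : ℕ × ℕ, k + 1 < S.1 d.1 d.2 → S₃.1 d.1 d.2 = S.1 d.1 d.2 := by
    intro d hd
    have := a2 d (by omega)
    rw [d2 d (by omega), this]
  have link1 : Linked S S₃ := by
    apply ih
    intro d hd h1
    rcases Nat.lt_or_eq_of_le (show k + 1 ≤ _ from h1) with h2 | h2
    · exact e3 d h2
    · have : d = c := S.inj hd hc (by omega)
      rw [this, e1, hSc]
  have r1 : ReadBefore c e := Or.inl (by omega)
  have r2 : ReadBefore e c' := by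
    rcases Nat.lt_or_eq_of_le (show c'.1 ≤ e.1 by omega) with h1 | h1
    · exact Or.inl h1
    · refine Or.inr ⟨h1.symm, ?_⟩
      by_contra h2
      have := hmaxc' e hel ⟨h1.le, not_lt.1 h2⟩ (Ne.symm hec')
      omega
  rw [← S₃.idxOf_lt_iff hc hel, e1, d1] at r1
  rw [← S₃.idxOf_lt_iff hel hc', e2, d1] at r2
  have hmove : DyckMove (k - 1) 1 (rowWord S₃.1) ((rowWord S₃.1).map (dyckCycle (k - 1) 1 1)) := by
    refine ⟨1, ?_, ⟨le_rfl, ?_, ?_, ?_, ?_, ?_⟩, rfl⟩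
    · intro x h1 h2
      rw [S₃.rowWord_perm.mem_iff, List.mem_range'_1]
      omega
    · intro j hj
      obtain rfl : j = 0 := by omega
      simpa [show k - 1 + 1 = k by omega] using r2
    · intro j hj
      omega
    · intro j hj
      obtain rfl : j = 0 := by omega
      simpa [show k - 1 + 1 = k by omega] using r1
    · omega
    · omega
  obtain ⟨S₄, hS₄⟩ := S₃.exists_of_dyckMove hmove
  have link2 : Linked S₃ S₄ := Relation.EqvGen.rel _ _ ⟨k - 1, by rw [hS₄]; exact hmove⟩
  have hval : ∀ d ∈ lam, S₄.1 d.1 d.2 = dyckCycle (k - 1) 1 1 (S₃.1 d.1 d.2) := by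
    rw [rowWord_eq_map, rowWord_eq_map, List.map_map, List.map_inj_left] at hS₄
    exact fun d hd => hS₄ d (mem_readingCells.2 hd)
  have link3 : Linked S' S₄ := by
    apply ih
    intro d hd h1
    rw [hval d hd]
    rcases Nat.lt_or_eq_of_le (show k + 1 ≤ _ from h1) with h2 | h2
    · have h3 := h' d hd h2
      rw [e3 d (by omega), h3, dyckCycle, if_neg (by omega), if_neg (by omega)]
    · have : d = c' := S'.inj hd hc' (by omega)
      rw [this, e2, hSc', dyckCycle, if_pos (by omega)]
      omega
  exact (link1.trans _ _ _ link2).trans _ _ _ (link3.symm _ _)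

theorem linked_of_agree (k : ℕ) (S S' : SYT lam)
    (h : ∀ d ∈ lam, k < S.1 d.1 d.2 → S'.1 d.1 d.2 = S.1 d.1 d.2) : Linked S S' := by
  induction k generalizing S S' with
  | zero =>
    have : S = S' := SYT.ext_of_cells fun c hc => (h c hc (S.mem_Icc hc).1).symm
    rw [this]
    exact Relation.EqvGen.refl _
  | succ k ih =>
    by_cases hk : k + 1 ≤ lam.card
    · obtain ⟨c, hc, hSc⟩ := S.exists_cell (by omega) hk
      obtain ⟨c', hc', hSc'⟩ := S'.exists_cell (by omega) hk
      have h' : ∀ d ∈ lam, k + 1 < S'.1 d.1 d.2 → S.1 d.1 d.2 = S'.1 d.1 d.2 := by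
        intro d hd h1
        obtain ⟨d', hd', h2⟩ := S.exists_cell (S'.mem_Icc hd).1 (S'.mem_Icc hd).2
        have h3 := h d' hd' (by omega)
        rw [← S'.inj hd' hd (by omega), h3]
      rcases lt_trichotomy c'.1 c.1 with h1 | h1 | h1
      · exact linked_of_corners ih S S' hk h h' hc hc' hSc hSc' h1
      · have hcc : c = c' := by
          by_contra hne
          rcases le_total c.2 c'.2 with h2 | h2
          · have h3 := S.lt_of_le (c := c) (d := c') ⟨h1.ge, h2⟩ hne hc'
            have := h c' hc' (by omega)
            omega
          · have h3 := S'.lt_of_le (c := c') (d := c) ⟨h1.le, h2⟩ (Ne.symm hne) hc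
            have := h' c hc (by omega)
            omega
        subst hcc
        apply ih
        intro d hd h2
        rcases Nat.lt_or_eq_of_le (show k + 1 ≤ _ from h2) with h3 | h3
        · exact h d hd h3
        · have : d = c := S.inj hd hc (by omega)
          rw [this, hSc, hSc']
      · exact (linked_of_corners ih S' S hk h' h hc' hc hSc' hSc h1).symm _ _
    · exact ih S S' fun d hd h1 => by
        have := S.mem_Icc hd
        omega

/-- `CS(lam)` is connected, already by the edges with labels of length three. -/
theorem linked (S S' : SYT lam) : Linked S S' :=
  linked_of_agree lam.card S S' fun d hd h => by
    have := S.mem_Icc hd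
    omega

/-! ### Reading words of restricted tableaux -/

/-- The subword of the letters in the interval `[a, b]`. -/
def restrictWord (a b : ℕ) (w : List ℕ) : List ℕ := w.filter fun x => decide (a ≤ x ∧ x ≤ b)

theorem mem_restrictWord {a b x : ℕ} {w : List ℕ} :
    x ∈ restrictWord a b w ↔ x ∈ w ∧ a ≤ x ∧ x ≤ b := by
  simp [restrictWord]

theorem SYT.restrictWord_perm (T : SYT lam) {a b : ℕ} (ha : 1 ≤ a) (hb : b ≤ lam.card) :
    (restrictWord a b (rowWord T.1)).Perm (List.range' a (b + 1 - a)) := by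
  refine (List.perm_ext_iff_of_nodup (T.rowWord_nodup.filter _) List.nodup_range').2 fun x => ?_
  rw [← restrictWord, mem_restrictWord, T.rowWord_perm.mem_iff, List.mem_range'_1,
    List.mem_range'_1]
  omega

theorem fillingWord_eq {N : ℕ} (hN : ∀ c ∈ lam, c.1 < N ∧ c.2 < N) {f : ℕ × ℕ → ℕ}
    (hf : ∀ c, f c ≠ 0 → c ∈ lam) :
    fillingWord N f = ((readingCells lam).map f).filter (· ≠ 0) := by
  have hbox : fillingWord N f = (((List.range N).reverse.flatMap fun r =>
      (List.range N).map (Prod.mk r)).filter (fun c => f c ≠ 0)).map f := by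
    simp only [fillingWord, entries, List.filter_flatMap, List.map_flatMap, List.filter_map,
      List.map_map, Function.comp_def]
  have hpair : ((List.range N).reverse.flatMap fun r =>
      (List.range N).map (Prod.mk r)).Pairwise ReadBefore := by
    rw [List.pairwise_flatMap]
    refine ⟨fun r _ => ?_, ?_⟩
    · rw [List.pairwise_map]
      exact List.pairwise_lt_range.imp fun h => Or.inr ⟨rfl, h⟩
    · rw [List.pairwise_reverse]
      refine List.pairwise_lt_range.imp ?_
      intro r s hrs x hx y hy
      simp only [List.mem_map, List.mem_range] at hx hy
      obtain ⟨_, -, rfl⟩ := hx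
      obtain ⟨_, -, rfl⟩ := hy
      exact Or.inl hrs
  rw [hbox, List.filter_map]
  congr 1
  -- both lists enumerate the support of `f` in reading order
  refine List.Perm.eq_of_pairwise (le := ReadBefore) ?_ ?_ ?_ ?_
  · intro c d _ _ h1 h2
    unfold ReadBefore at h1 h2
    omega
  · exact hpair.filter _
  · exact (readingCells_pairwise lam).filter _
  · have hnd : ∀ {l : List (ℕ × ℕ)}, l.Pairwise ReadBefore → l.Nodup := fun h =>
      h.imp (S := fun a b => a ≠ b) (by rintro a b h rfl; exact ReadBefore.irrefl a h)
    rw [List.perm_ext_iff_of_nodup ?_ ((readingCells_nodup lam).filter _)]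
    · rintro ⟨r, k⟩
      simp only [List.mem_filter, List.mem_flatMap, List.mem_reverse, List.mem_range, List.mem_map,
        Prod.mk.injEq, mem_readingCells, decide_eq_true_eq, Function.comp_apply]
      constructor
      · rintro ⟨-, h⟩
        exact ⟨hf _ h, h⟩
      · rintro ⟨h, h'⟩
        exact ⟨⟨r, (hN _ h).1, k, (hN _ h).2, rfl, rfl⟩, h'⟩
    · exact (hnd hpair).filter _

theorem restrictFilling_ne_zero {T : SYT lam} {a b : ℕ} (ha : 1 ≤ a) {c : ℕ × ℕ} :
    restrictFilling T a b c ≠ 0 ↔ c ∈ lam ∧ a ≤ T.1 c.1 c.2 ∧ T.1 c.1 c.2 ≤ b := by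
  have h0 : c ∉ lam → T.1 c.1 c.2 = 0 := fun h => T.1.zeros h
  unfold restrictFilling
  split_ifs with h
  · have : c ∈ lam := by by_contra hc; have := h0 hc; omega
    exact ⟨fun _ => ⟨this, h⟩, fun _ => by omega⟩
  · simp only [ne_eq, not_true_eq_false, false_iff]
    exact fun h' => h h'.2

theorem restrictFilling_eq {T : SYT lam} {a b : ℕ} {c : ℕ × ℕ}
    (h : restrictFilling T a b c ≠ 0) : restrictFilling T a b c = T.1 c.1 c.2 := by
  unfold restrictFilling at *
  split_ifs at * with h'
  · rfl
  · exact absurd rfl h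

theorem fillingWord_restrictFilling (T : SYT lam) {a b N : ℕ} (ha : 1 ≤ a)
    (hN : ∀ c ∈ lam, c.1 < N ∧ c.2 < N) :
    fillingWord N (restrictFilling T a b) = restrictWord a b (rowWord T.1) := by
  rw [fillingWord_eq hN fun c hc => ((restrictFilling_ne_zero ha).1 hc).1, restrictWord,
    rowWord_eq_map, List.filter_map, List.filter_map]
  have hfil : (readingCells lam).filter ((fun x => decide (x ≠ 0)) ∘ restrictFilling T a b) =
      (readingCells lam).filter ((fun x => decide (a ≤ x ∧ x ≤ b)) ∘ fun c => T.1 c.1 c.2) := by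
    apply List.filter_congr
    intro c hc
    have := restrictFilling_ne_zero (T := T) (a := a) (b := b) ha (c := c)
    rw [mem_readingCells] at hc
    simp only [Function.comp_apply, decide_eq_decide, this]
    tauto
  rw [hfil]
  apply List.map_congr_left
  intro c hc
  simp only [List.mem_filter, Function.comp_apply, decide_eq_true_eq] at hc
  exact restrictFilling_eq ((restrictFilling_ne_zero ha).2 ⟨mem_readingCells.1 hc.1, hc.2⟩)

theorem isSkewTableau_restrictFilling (T : SYT lam) {a b N : ℕ} (ha : 1 ≤ a)
    (hN : ∀ c ∈ lam, c.1 < N ∧ c.2 < N) :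
    IsSkewTableau N (innerShape T a, restrictFilling T a b) := by
  have hin : ∀ c : ℕ × ℕ, c ∈ innerShape T a ↔ c ∈ lam ∧ T.1 c.1 c.2 < a := by
    intro c
    rw [← YoungDiagram.mem_cells]
    simp [innerShape]
  have hlt : ∀ c d : ℕ × ℕ, c ≤ d → c ≠ d → restrictFilling T a b c ≠ 0 →
      restrictFilling T a b d ≠ 0 → restrictFilling T a b c < restrictFilling T a b d := by
    intro c d h1 h2 h3 h4
    rw [restrictFilling_eq h3, restrictFilling_eq h4]
    exact T.lt_of_le h1 h2 ((restrictFilling_ne_zero ha).1 h4).1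
  refine ⟨?_, ?_, ?_, ?_, ?_, ?_⟩
  · intro x hx
    by_contra h
    have h1 := (restrictFilling_ne_zero ha).1 h
    have h2 := (hin x).1 hx
    omega
  · intro x z hxz hz
    have h1 := (restrictFilling_ne_zero ha).1 hz
    have hx : x ∈ lam := lam.isLowerSet hxz h1.1
    have h2 : T.1 x.1 x.2 ≤ T.1 z.1 z.2 := by
      by_cases h : x = z
      · rw [h]
      · exact (T.lt_of_le hxz h h1.1).le
    simp only [restrictFilling_ne_zero ha, hin]
    by_cases h3 : T.1 x.1 x.2 < a
    · exact Or.inr ⟨hx, h3⟩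
    · exact Or.inl ⟨hx, by omega, by omega⟩
  · intro r k k' hk h1 h2
    exact hlt _ _ (by simp [hk.le]) (by simp; omega) h1 h2
  · intro r r' k hr h1 h2
    exact hlt _ _ (by simp [hr.le]) (by simp; omega) h1 h2
  · intro x y hx hxy
    have hy : restrictFilling T a b y ≠ 0 := by
      intro h
      exact hx (hxy.trans h)
    refine T.inj ((restrictFilling_ne_zero ha).1 hx).1 ((restrictFilling_ne_zero ha).1 hy).1 ?_
    rw [← restrictFilling_eq hx, ← restrictFilling_eq hy]
    exact hxy
  · rintro x (hx | hx)
    · exact hN x ((restrictFilling_ne_zero ha).1 hx).1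
    · exact hN x ((hin x).1 hx).1

theorem length_readingCells (lam : YoungDiagram) : (readingCells lam).length = lam.card := by
  have h1 : (readingCells lam).toFinset = lam.cells := by
    ext c
    rw [List.mem_toFinset, mem_readingCells, YoungDiagram.mem_cells]
  rw [← List.toFinset_card_of_nodup (readingCells_nodup lam), h1]

/-- A straight tableau of shape `mu` with the entries `a, …, b` is a standard tableau shifted by
`a - 1`. -/
theorem IsSkewTableau.exists_syt {mu : YoungDiagram} {N a b : ℕ} {g : ℕ × ℕ → ℕ} (ha : 1 ≤ a)
    (hg : IsSkewTableau N (⊥, g)) (hmu : ∀ c, g c ≠ 0 ↔ c ∈ mu)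
    (hperm : (fillingWord N g).Perm (List.range' a (b + 1 - a))) :
    mu.card = b + 1 - a ∧ ∃ S : SYT mu, fillingWord N g = (rowWord S.1).map (· + (a - 1)) := by
  have hword : fillingWord N g = (readingCells mu).map g := by
    rw [fillingWord_eq (fun c hc => hg.bound c (Or.inl ((hmu c).2 hc))) fun c => (hmu c).1]
    rw [List.filter_eq_self]
    intro x hx
    obtain ⟨c, hc, rfl⟩ := List.mem_map.1 hx
    exact decide_eq_true ((hmu c).2 (mem_readingCells.1 hc))
  have hcard : mu.card = b + 1 - a := by
    have := hperm.length_eq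
    rwa [hword, List.length_map, length_readingCells, List.length_range'] at this
  have hmem : ∀ x, (∃ c ∈ mu, g c = x) ↔ a ≤ x ∧ x < a + (b + 1 - a) := by
    intro x
    rw [← List.mem_range'_1, ← hperm.mem_iff, hword, List.mem_map]
    simp only [mem_readingCells]
  have hval : ∀ c ∈ mu, a ≤ g c ∧ g c < a + (b + 1 - a) := fun c hc => (hmem _).1 ⟨c, hc, rfl⟩
  refine ⟨hcard, ⟨{
    entry := fun r k => g (r, k) - (a - 1)
    row_weak' := ?_
    col_strict' := ?_
    zeros' := ?_ }, ?_, ?_, ?_⟩, ?_⟩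
  · intro r k k' hk hc
    have h1 := hg.row r k k' hk ((hmu _).2 (mu.up_left_mem le_rfl hk.le hc)) ((hmu _).2 hc)
    simp only at h1
    omega
  · intro r r' k hr hc
    have hc' := mu.up_left_mem hr.le le_rfl hc
    have h1 := hg.col r r' k hr ((hmu _).2 hc') ((hmu _).2 hc)
    have h2 := hval _ hc'
    simp only at h1
    omega
  · intro r k hc
    have : g (r, k) = 0 := by
      by_contra h
      exact hc ((hmu _).1 h)
    omega
  · intro c hc
    have := hval c hc
    change 1 ≤ g c - (a - 1) ∧ g c - (a - 1) ≤ mu.card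
    omega
  · intro c hc d hd h
    have h1 := hval c hc
    have h2 := hval d hd
    change g c - (a - 1) = g d - (a - 1) at h
    exact hg.inj c d ((hmu c).2 hc) (show g c = g d by omega)
  · rintro x ⟨h1, h2⟩
    obtain ⟨c, hc, h⟩ := (hmem (x + (a - 1))).2 (by omega)
    exact ⟨c, hc, show g c - (a - 1) = x by omega⟩
  · rw [hword, rowWord_eq_map, List.map_map]
    apply List.map_congr_left
    intro c hc
    have := hval c (mem_readingCells.1 hc)
    change g c = g c - (a - 1) + (a - 1)
    omega

/-- If slides straighten `T_{[a,b]}` to a tableau of shape `mu`, then the subword of `row(T)` on the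
letters in `[a, b]` is Knuth equivalent to the shifted reading word of a standard tableau of shape
`mu`. -/
theorem IsJdtShape.exists_knuthEq {T : SYT lam} {a b : ℕ} {mu : YoungDiagram}
    (h : IsJdtShape T a b mu) (ha : 1 ≤ a) (hb : b ≤ lam.card) :
    mu.card = b + 1 - a ∧ ∃ S : SYT mu,
      KnuthEq (restrictWord a b (rowWord T.1)) ((rowWord S.1).map (· + (a - 1))) := by
  obtain ⟨g, hstep, hmu⟩ := h
  have hN : ∀ c ∈ lam, c.1 < lam.colLen 0 + lam.rowLen 0 ∧ c.2 < lam.colLen 0 + lam.rowLen 0 := by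
    rintro ⟨r, k⟩ hc
    have h1 := YoungDiagram.mem_iff_lt_colLen.1 (lam.up_left_mem le_rfl (Nat.zero_le k) hc)
    have h2 := YoungDiagram.mem_iff_lt_rowLen.1 (lam.up_left_mem (Nat.zero_le r) le_rfl hc)
    exact ⟨by simp only; omega, by simp only; omega⟩
  obtain ⟨h1, h2⟩ := (isSkewTableau_restrictFilling T ha hN (b := b)).reflTransGen hstep
  simp only [fillingWord_restrictFilling T ha hN] at h2
  obtain ⟨h3, S, hS⟩ := h1.exists_syt (b := b) ha hmu (h2.perm.trans (T.restrictWord_perm ha hb))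
  exact ⟨h3, S, hS ▸ h2⟩

/-! ### Lifting families of tableaux -/

theorem dyckCycle_add (i m q d x : ℕ) : dyckCycle (i + d) m q (x + d) = dyckCycle i m q x + d := by
  unfold dyckCycle
  split_ifs <;> omega

theorem dyckMove_map_add_iff {i m d : ℕ} {w v : List ℕ} :
    DyckMove (i + d) m (w.map (· + d)) (v.map (· + d)) ↔ DyckMove i m w v := by
  have hinj : Function.Injective (fun x : ℕ => x + d) := add_left_injective d
  have hidx : ∀ x, (w.map (· + d)).idxOf (x + d) = w.idxOf x := idxOf_map_of_injective hinj w
  have hmap : ∀ q, (w.map (· + d)).map (dyckCycle (i + d) m q) =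
      (w.map (dyckCycle i m q)).map (· + d) := by
    intro q
    simp only [List.map_map]
    exact List.map_congr_left fun x _ => dyckCycle_add i m q d x
  have hmem : (∀ x, i + d ≤ x → x ≤ i + d + 2 * m → x ∈ w.map (· + d)) ↔
      ∀ x, i ≤ x → x ≤ i + 2 * m → x ∈ w := by
    constructor
    · intro h x h1 h2
      obtain ⟨y, hy, h3⟩ := List.mem_map.1 (h (x + d) (by omega) (by omega))
      rwa [← hinj h3]
    · intro h x h1 h2
      exact List.mem_map.2 ⟨x - d, h _ (by omega) (by omega), by omega⟩
  have hord : ∀ q, DyckOrder (i + d) m q (fun x => (w.map (· + d)).idxOf x) ↔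
      DyckOrder i m q (fun x => w.idxOf x) := by
    intro q
    have e : ∀ x y, x = y + d → (w.map (· + d)).idxOf x = w.idxOf y := by
      rintro x y rfl
      exact hidx y
    have e1 : ∀ j, (w.map (· + d)).idxOf (i + d + j) = w.idxOf (i + j) := fun j => e _ _ (by omega)
    have e2 : ∀ j, (w.map (· + d)).idxOf (i + d + j + 1) = w.idxOf (i + j + 1) :=
      fun j => e _ _ (by omega)
    have e3 : ∀ j, (w.map (· + d)).idxOf (i + d + m + 1 + j) = w.idxOf (i + m + 1 + j) :=
      fun j => e _ _ (by omega)
    have e4 : ∀ j, (w.map (· + d)).idxOf (i + d + m + 1 + j + 1) = w.idxOf (i + m + 1 + j + 1) :=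
      fun j => e _ _ (by omega)
    constructor <;> rintro ⟨h1, h2, h3, h4, h5, h6⟩
    · simp only [e1, e2, e3, e4] at h2 h3 h4 h5 h6
      exact ⟨h1, h2, h3, h4, h5, h6⟩
    · refine ⟨h1, ?_, ?_, ?_, ?_, ?_⟩ <;> simpa only [e1, e2, e3, e4]
  unfold DyckMove
  simp only [hmem, hord, hmap, (List.map_injective_iff.2 hinj).eq_iff]

theorem restrictWord_map {a b : ℕ} {φ : ℕ → ℕ} {w : List ℕ}
    (hφ : ∀ x ∈ w, (a ≤ φ x ∧ φ x ≤ b) ↔ (a ≤ x ∧ x ≤ b)) :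
    restrictWord a b (w.map φ) = (restrictWord a b w).map φ := by
  rw [restrictWord, restrictWord, List.filter_map]
  congr 1
  apply List.filter_congr
  intro x hx
  simp only [Function.comp_apply, decide_eq_decide]
  exact hφ x hx

theorem dyckCycle_mem_iff {i m q a b x : ℕ} (hq : q ≤ m)
    (h : (∀ y, i ≤ y → y ≤ i + 2 * m → a ≤ y ∧ y ≤ b) ∨
      ∀ y, i ≤ y → y ≤ i + 2 * m → ¬ (a ≤ y ∧ y ≤ b)) :
    (a ≤ dyckCycle i m q x ∧ dyckCycle i m q x ≤ b) ↔ (a ≤ x ∧ x ≤ b) := by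
  by_cases hx : i ≤ x ∧ x ≤ i + 2 * m
  · have hx' : i ≤ dyckCycle i m q x ∧ dyckCycle i m q x ≤ i + 2 * m := by
      unfold dyckCycle
      split_ifs <;> omega
    rcases h with h | h
    · exact iff_of_true (h _ hx'.1 hx'.2) (h _ hx.1 hx.2)
    · exact iff_of_false (h _ hx'.1 hx'.2) (h _ hx.1 hx.2)
  · rw [show dyckCycle i m q x = x by unfold dyckCycle; split_ifs <;> omega]

theorem dyckCycle_eq_self {i m q x : ℕ} (hq : q ≤ m) (h : ¬ (i ≤ x ∧ x ≤ i + 2 * m)) :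
    dyckCycle i m q x = x := by
  unfold dyckCycle
  split_ifs <;> omega

theorem dyckOrder_restrictWord_iff {i m q a b : ℕ} (ha : a ≤ i) (hb : i + 2 * m ≤ b)
    {w : List ℕ} :
    ((∀ x, i ≤ x → x ≤ i + 2 * m → x ∈ restrictWord a b w) ∧
      DyckOrder i m q (fun x => (restrictWord a b w).idxOf x)) ↔
    ((∀ x, i ≤ x → x ≤ i + 2 * m → x ∈ w) ∧ DyckOrder i m q (fun x => w.idxOf x)) := by
  have hord : DyckOrder i m q (fun x => (restrictWord a b w).idxOf x) ↔
      DyckOrder i m q (fun x => w.idxOf x) :=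
    dyckOrder_filter_iff fun x h1 h2 => decide_eq_true ⟨by omega, by omega⟩
  rw [hord]
  refine and_congr_left fun _ => ⟨fun h x h1 h2 => (mem_restrictWord.1 (h x h1 h2)).1,
    fun h x h1 h2 => mem_restrictWord.2 ⟨h x h1 h2, by omega, by omega⟩⟩

theorem restrictWord_rowWord_eq {T T' : SYT lam} {a b : ℕ}
    (h : ∀ c ∈ lam, (a ≤ T'.1 c.1 c.2 ∧ T'.1 c.1 c.2 ≤ b) ↔ (a ≤ T.1 c.1 c.2 ∧ T.1 c.1 c.2 ≤ b)) :
    restrictWord a b (rowWord T'.1) = ((readingCells lam).filter fun c =>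
      decide (a ≤ T.1 c.1 c.2 ∧ T.1 c.1 c.2 ≤ b)).map fun c => T'.1 c.1 c.2 := by
  rw [restrictWord, rowWord_eq_map, List.filter_map]
  congr 1
  apply List.filter_congr
  intro c hc
  simp only [Function.comp_apply, decide_eq_decide]
  exact h c (mem_readingCells.1 hc)

/-- If two standard tableaux have the letters of `[a, b]` in the same cells, a Dyck move between
them on an interval inside `[a, b]` is a Dyck move between the subwords on `[a, b]`, provided that
the tableaux agree outside `[a, b]`. -/
theorem dyckMove_rowWord_iff {T T' : SYT lam} {a b i m : ℕ} (ha : a ≤ i) (hb : i + 2 * m ≤ b)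
    (hcells : ∀ c ∈ lam,
      (a ≤ T'.1 c.1 c.2 ∧ T'.1 c.1 c.2 ≤ b) ↔ (a ≤ T.1 c.1 c.2 ∧ T.1 c.1 c.2 ≤ b)) :
    DyckMove i m (rowWord T.1) (rowWord T'.1) ↔
      (∀ c ∈ lam, ¬ (a ≤ T.1 c.1 c.2 ∧ T.1 c.1 c.2 ≤ b) → T'.1 c.1 c.2 = T.1 c.1 c.2) ∧
      DyckMove i m (restrictWord a b (rowWord T.1)) (restrictWord a b (rowWord T'.1)) := by
  have hmap : ∀ q, q ≤ m → (rowWord T'.1 = (rowWord T.1).map (dyckCycle i m q) ↔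
      (∀ c ∈ lam, ¬ (a ≤ T.1 c.1 c.2 ∧ T.1 c.1 c.2 ≤ b) → T'.1 c.1 c.2 = T.1 c.1 c.2) ∧
      restrictWord a b (rowWord T'.1) =
        (restrictWord a b (rowWord T.1)).map (dyckCycle i m q)) := by
    intro q hq
    rw [restrictWord_rowWord_eq hcells,
      restrictWord_rowWord_eq (T := T) (T' := T) fun _ _ => Iff.rfl,
      rowWord_eq_map, rowWord_eq_map, List.map_map, List.map_map, List.map_inj_left,
      List.map_inj_left]
    simp only [List.mem_filter, mem_readingCells, decide_eq_true_eq, Function.comp_apply, and_imp]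
    constructor
    · intro h
      refine ⟨fun c hc hn => ?_, fun c hc _ _ => h c hc⟩
      rw [h c hc, dyckCycle_eq_self hq fun h' => hn ⟨by omega, by omega⟩]
    · rintro ⟨h1, h2⟩ c hc
      by_cases hn : a ≤ T.1 c.1 c.2 ∧ T.1 c.1 c.2 ≤ b
      · exact h2 c hc hn.1 hn.2
      · rw [h1 c hc hn, dyckCycle_eq_self hq fun h' => hn ⟨by omega, by omega⟩]
  constructor
  · rintro ⟨q, h1, h2, h3⟩
    obtain ⟨h4, h5⟩ := (hmap q h2.le).1 h3
    obtain ⟨h6, h7⟩ := (dyckOrder_restrictWord_iff ha hb).2 ⟨h1, h2⟩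
    exact ⟨h4, q, h6, h7, h5⟩
  · rintro ⟨h4, q, h6, h7, h5⟩
    obtain ⟨h1, h2⟩ := (dyckOrder_restrictWord_iff ha hb).1 ⟨h6, h7⟩
    exact ⟨q, h1, h2, (hmap q h2.le).2 ⟨h4, h5⟩⟩

/-- For disjoint intervals `[a k, b k]` of the lengths `|mu k|`, the maps `K k` on words are
bijective and compatible with Dyck moves, and they only rearrange letters. -/
structure IsTransport {ι : Type*} (a b : ι → ℕ) (mu : ι → YoungDiagram)
    (K : ι → List ℕ → List ℕ) : Prop where
  disj : ∀ k l, k ≠ l → ∀ x, a k ≤ x → x ≤ b k → ¬ (a l ≤ x ∧ x ≤ b l)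
  pos : ∀ k, 1 ≤ a k
  card : ∀ k, (mu k).card = b k + 1 - a k
  bij : ∀ k, Function.Bijective (K k)
  perm : ∀ k u, (K k u).Perm u
  move : ∀ k (i m : ℕ) (u v : List ℕ), u.Nodup → v.Nodup →
    (DyckMove i m u v ↔ DyckMove i m (K k u) (K k v))

/-- The tableau `T'` arises from `T` by rearranging the entries within each of the intervals
`[a k, b k]` in such a way that `K k` carries the subword on this interval to the shifted reading
word of `S k`. -/
structure IsLift {ι : Type*} (T : SYT lam) (a b : ι → ℕ) (mu : ι → YoungDiagram)
    (K : ι → List ℕ → List ℕ) (S : ∀ k, SYT (mu k)) (T' : SYT lam) : Prop where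
  cells : ∀ k, ∀ c ∈ lam,
    (a k ≤ T'.1 c.1 c.2 ∧ T'.1 c.1 c.2 ≤ b k) ↔ (a k ≤ T.1 c.1 c.2 ∧ T.1 c.1 c.2 ≤ b k)
  rest : ∀ c ∈ lam, (∀ k, ¬ (a k ≤ T.1 c.1 c.2 ∧ T.1 c.1 c.2 ≤ b k)) →
    T'.1 c.1 c.2 = T.1 c.1 c.2
  word : ∀ k, K k (restrictWord (a k) (b k) (rowWord T'.1)) = (rowWord (S k).1).map (· + (a k - 1))

section Lift

variable {ι : Type*} {T : SYT lam} {a b : ι → ℕ} {mu : ι → YoungDiagram} {K : ι → List ℕ → List ℕ}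

theorem IsLift.unique (hK : IsTransport a b mu K) {S : ∀ k, SYT (mu k)} {T' T'' : SYT lam}
    (h' : IsLift T a b mu K S T') (h'' : IsLift T a b mu K S T'') : T' = T'' := by
  apply SYT.ext_of_cells
  intro c hc
  by_cases h : ∃ k, a k ≤ T.1 c.1 c.2 ∧ T.1 c.1 c.2 ≤ b k
  · obtain ⟨k, hk⟩ := h
    have h1 := (hK.bij k).1 ((h'.word k).trans (h''.word k).symm)
    rw [restrictWord_rowWord_eq (h'.cells k), restrictWord_rowWord_eq (h''.cells k),
      List.map_inj_left] at h1
    exact h1 c (List.mem_filter.2 ⟨mem_readingCells.2 hc, decide_eq_true hk⟩)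
  · push Not at h
    rw [h'.rest c hc fun k hk => absurd hk.2 (not_le.2 (h k hk.1)),
      h''.rest c hc fun k hk => absurd hk.2 (not_le.2 (h k hk.1))]

theorem IsLift.family_eq {k : ι} {S S' : ∀ k, SYT (mu k)} {T' T'' : SYT lam}
    (h' : IsLift T a b mu K S T') (h'' : IsLift T a b mu K S' T'')
    (h : restrictWord (a k) (b k) (rowWord T'.1) = restrictWord (a k) (b k) (rowWord T''.1)) :
    S k = S' k := by
  have h1 := h'.word k
  rw [h, h''.word k] at h1
  exact (SYT.ext_of_rowWord (List.map_injective_iff.2 (add_left_injective (a k - 1)) h1)).symm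

/-- If a cycle inside `[a k, b k]` turns a lift of `S` into a standard tableau whose subword on
`[a k, b k]` corresponds to `S' k`, then the result is a lift of `S'`. -/
theorem IsLift.of_map (hK : IsTransport a b mu K) {S S' : ∀ k, SYT (mu k)} {T' T'' : SYT lam}
    (h' : IsLift T a b mu K S T') {k : ι} {i m q : ℕ} (hq : q ≤ m) (ha : a k ≤ i)
    (hb : i + 2 * m ≤ b k) (hS : ∀ l, l ≠ k → S' l = S l)
    (hT : rowWord T''.1 = (rowWord T'.1).map (dyckCycle i m q))
    (hword : K k ((restrictWord (a k) (b k) (rowWord T'.1)).map (dyckCycle i m q)) =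
      (rowWord (S' k).1).map (· + (a k - 1))) : IsLift T a b mu K S' T'' := by
  have hval : ∀ c ∈ lam, T''.1 c.1 c.2 = dyckCycle i m q (T'.1 c.1 c.2) := by
    rw [rowWord_eq_map, rowWord_eq_map, List.map_map, List.map_inj_left] at hT
    exact fun c hc => hT c (mem_readingCells.2 hc)
  have hself : ∀ l, l ≠ k → ∀ y, i ≤ y → y ≤ i + 2 * m → ¬ (a l ≤ y ∧ y ≤ b l) :=
    fun l hl y h1 h2 => hK.disj k l hl.symm y (by omega) (by omega)
  have hmem : ∀ l x, (a l ≤ dyckCycle i m q x ∧ dyckCycle i m q x ≤ b l) ↔ (a l ≤ x ∧ x ≤ b l) := by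
    intro l x
    apply dyckCycle_mem_iff hq
    by_cases hl : l = k
    · subst hl
      exact Or.inl fun y h1 h2 => ⟨by omega, by omega⟩
    · exact Or.inr (hself l hl)
  refine ⟨?_, ?_, ?_⟩
  · intro l c hc
    rw [hval c hc, hmem, h'.cells l c hc]
  · intro c hc h
    have h1 := h'.rest c hc h
    rw [hval c hc, h1]
    apply dyckCycle_eq_self hq
    intro h2
    exact h k ⟨by omega, by omega⟩
  · intro l
    rw [hT, restrictWord_map fun x _ => hmem l x]
    by_cases hl : l = k
    · subst hl
      exact hword
    · rw [hS l hl, ← h'.word l]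
      congr 1
      conv_rhs => rw [← List.map_id (restrictWord (a l) (b l) (rowWord T'.1))]
      apply List.map_congr_left
      intro x hx
      apply dyckCycle_eq_self hq
      intro h2
      exact hself l hl x h2.1 h2.2 (mem_restrictWord.1 hx).2

/-- Dyck moves between lifts inside the interval `[a k, b k]` are Dyck moves of the `k`-th
coordinate. -/
theorem IsLift.dyckMove_iff (hK : IsTransport a b mu K) {S S' : ∀ k, SYT (mu k)} {T' T'' : SYT lam}
    (h' : IsLift T a b mu K S T') (h'' : IsLift T a b mu K S' T'') {k : ι} {i m : ℕ}
    (hi : 1 ≤ i) (him : i + 2 * m ≤ (mu k).card) :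
    DyckMove (i + (a k - 1)) m (rowWord T'.1) (rowWord T''.1) ↔
      (∀ l, l ≠ k → S' l = S l) ∧ DyckMove i m (rowWord (S k).1) (rowWord (S' k).1) := by
  have hcells : ∀ l, ∀ c ∈ lam, (a l ≤ T''.1 c.1 c.2 ∧ T''.1 c.1 c.2 ≤ b l) ↔
      (a l ≤ T'.1 c.1 c.2 ∧ T'.1 c.1 c.2 ≤ b l) :=
    fun l c hc => (h''.cells l c hc).trans (h'.cells l c hc).symm
  have hcard := hK.card k
  have hpos := hK.pos k
  have hnd' : (restrictWord (a k) (b k) (rowWord T'.1)).Nodup := T'.rowWord_nodup.filter _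
  have hnd'' : (restrictWord (a k) (b k) (rowWord T''.1)).Nodup := T''.rowWord_nodup.filter _
  rw [dyckMove_rowWord_iff (a := a k) (b := b k) (by omega) (by omega) (hcells k),
    hK.move k _ _ _ _ hnd' hnd'', h'.word k,
    h''.word k, dyckMove_map_add_iff]
  refine and_congr_left fun _ => ?_
  have hval : ∀ l,
      restrictWord (a l) (b l) (rowWord T'.1) = restrictWord (a l) (b l) (rowWord T''.1) ↔
        ∀ c ∈ lam, (a l ≤ T'.1 c.1 c.2 ∧ T'.1 c.1 c.2 ≤ b l) → T''.1 c.1 c.2 = T'.1 c.1 c.2 := by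
    intro l
    rw [restrictWord_rowWord_eq (hcells l),
      restrictWord_rowWord_eq (T := T') (T' := T') fun _ _ => Iff.rfl, List.map_inj_left]
    simp only [List.mem_filter, mem_readingCells, decide_eq_true_eq, and_imp]
    exact ⟨fun h c h1 h2 h3 => (h c h1 h2 h3).symm, fun h c h1 h2 h3 => (h c h1 h2 h3).symm⟩
  constructor
  · intro h l hl
    refine (h'.family_eq h'' ((hval l).2 fun c hc hcl => h c hc fun hck => ?_)).symm
    exact hK.disj k l hl.symm _ hck.1 hck.2 hcl
  · intro h c hc hck
    by_cases h1 : ∃ l, a l ≤ T'.1 c.1 c.2 ∧ T'.1 c.1 c.2 ≤ b l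
    · obtain ⟨l, hl⟩ := h1
      have hlk : l ≠ k := by
        rintro rfl
        exact hck hl
      refine (hval l).1 ((hK.bij l).1 ?_) c hc hl
      rw [h'.word, h''.word, h l hlk]
    · have h2 : ∀ l, ¬ (a l ≤ T.1 c.1 c.2 ∧ T.1 c.1 c.2 ≤ b l) :=
        fun l hl => h1 ⟨l, (h'.cells l c hc).2 hl⟩
      rw [h'.rest c hc h2, h''.rest c hc h2]

/-- A lift can be carried along an edge with a label of length three in one coordinate, in both
directions. -/
theorem IsLift.exists_of_dyckMove (hK : IsTransport a b mu K) {S S' : ∀ k, SYT (mu k)}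
    {T' : SYT lam}
    (h' : IsLift T a b mu K S T') {k : ι} (hS : ∀ l, l ≠ k → S' l = S l) {i : ℕ}
    (hmove : DyckMove i 1 (rowWord (S k).1) (rowWord (S' k).1) ∨
      DyckMove i 1 (rowWord (S' k).1) (rowWord (S k).1)) :
    ∃ T'' : SYT lam, IsLift T a b mu K S' T'' := by
  have hcard := hK.card k
  have hpos := hK.pos k
  have hi : 1 ≤ i ∧ i + 2 * 1 ≤ (mu k).card := by
    rcases hmove with h | h
    · exact h.bound (S k).rowWord_perm
    · exact h.bound (S' k).rowWord_perm
  obtain ⟨u, hu⟩ := (hK.bij k).2 ((rowWord (S' k).1).map (· + (a k - 1)))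
  have hund : u.Nodup := by
    rw [← (hK.perm k u).nodup_iff, hu]
    exact (S' k).rowWord_nodup.map (add_left_injective (a k - 1))
  have hrnd : (restrictWord (a k) (b k) (rowWord T'.1)).Nodup := T'.rowWord_nodup.filter _
  rcases hmove with h | h
  · rw [← dyckMove_map_add_iff (d := a k - 1), ← h'.word k, ← hu,
      ← hK.move _ _ _ _ _ hrnd hund] at h
    obtain ⟨q, h1, h2, rfl⟩ := h
    obtain ⟨h3, h4⟩ := (dyckOrder_restrictWord_iff (by omega) (by omega)).1 ⟨h1, h2⟩
    obtain ⟨T'', hT⟩ := T'.exists_of_dyckMove ⟨q, h3, h4, rfl⟩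
    exact ⟨T'', h'.of_map hK h2.le (by omega) (by omega) hS hT hu⟩
  · rw [← dyckMove_map_add_iff (d := a k - 1), ← h'.word k, ← hu,
      ← hK.move _ _ _ _ _ hund hrnd] at h
    obtain ⟨q, h1, h2, h3⟩ := h
    have hq := h2.le
    -- a cycle of length two is its own inverse
    have hinv : Function.Involutive (dyckCycle (i + (a k - 1)) 1 q) := by
      rw [show dyckCycle (i + (a k - 1)) 1 q = dyckCycle (i + (a k - 1) + q) 1 0 from
        funext (dyckCycle_one _ q)]
      exact dyckCycle_one_involutive _
    have hu' : u =
        (restrictWord (a k) (b k) (rowWord T'.1)).map (dyckCycle (i + (a k - 1)) 1 q) := by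
      rw [h3, List.map_map, hinv.comp_self, List.map_id]
    have hmem : ∀ x, (a k ≤ dyckCycle (i + (a k - 1)) 1 q x ∧
        dyckCycle (i + (a k - 1)) 1 q x ≤ b k) ↔ (a k ≤ x ∧ x ≤ b k) :=
      fun x => dyckCycle_mem_iff hq (Or.inl fun y h1 h2 => ⟨by omega, by omega⟩)
    have hu'' := hu'
    rw [← restrictWord_map fun x _ => hmem x] at hu''
    rw [hu''] at h1 h2
    obtain ⟨h4, h5⟩ := (dyckOrder_restrictWord_iff (by omega) (by omega)).1 ⟨h1, h2⟩
    have hv : DyckMove (i + (a k - 1)) 1 ((rowWord T'.1).map (dyckCycle (i + (a k - 1)) 1 q))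
        (rowWord T'.1) :=
      ⟨q, h4, h5, by rw [List.map_map, hinv.comp_self, List.map_id]⟩
    obtain ⟨T'', hT⟩ := T'.exists_of_dyckMove_symm hv
    exact ⟨T'', h'.of_map hK hq (by omega) (by omega) hS hT (hu' ▸ hu)⟩

end Lift

/-! ### Products of crystal skeletons -/

variable {ι : Type*} {T : SYT lam} {a b : ι → ℕ} {mu : ι → YoungDiagram}
  {K : ι → List ℕ → List ℕ}

theorem IsLift.exists_update [DecidableEq ι] (hK : IsTransport a b mu K) (S : ∀ k, SYT (mu k))
    (k : ι) {X Y : SYT (mu k)} (h : Linked X Y) :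
    (∃ T', IsLift T a b mu K (Function.update S k X) T') ↔
      ∃ T', IsLift T a b mu K (Function.update S k Y) T' := by
  induction h with
  | rel X Y h =>
    obtain ⟨i, h⟩ := h
    constructor
    · rintro ⟨T', h'⟩
      exact h'.exists_of_dyckMove hK (k := k) (i := i) (fun l hl => by simp [hl]) (by simp [h])
    · rintro ⟨T', h'⟩
      exact h'.exists_of_dyckMove hK (k := k) (i := i) (fun l hl => by simp [hl]) (by simp [h])
  | refl X => rfl
  | symm X Y _ ih => exact ih.symm
  | trans X Y Z _ _ ih ih' => exact ih.trans ih'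

/-- Every family of tableaux has a lift, since each coordinate can be reached from `S₀` along edges
with labels of length three. -/
theorem exists_isLift [Fintype ι] (hK : IsTransport a b mu K) {S₀ : ∀ k, SYT (mu k)}
    (h₀ : IsLift T a b mu K S₀ T) (S : ∀ k, SYT (mu k)) : ∃ T', IsLift T a b mu K S T' := by
  classical
  suffices h : ∀ (s : Finset ι) (S : ∀ k, SYT (mu k)), (∀ k, k ∉ s → S k = S₀ k) →
      ∃ T', IsLift T a b mu K S T' from h Finset.univ S (by simp)
  intro s
  induction s using Finset.induction_on with
  | empty =>
    intro S hS
    rw [show S = S₀ from funext fun k => hS k (by simp)]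
    exact ⟨T, h₀⟩
  | insert k s _ ih =>
    intro S hS
    rw [← Function.update_eq_self k S, ← IsLift.exists_update hK S k (linked (S₀ k) (S k))]
    refine ih _ fun l hl => ?_
    by_cases hlk : l = k
    · subst hlk
      simp
    · rw [Function.update_of_ne hlk]
      exact hS l (by simp [hl, hlk])

/-- The embedding of the Cartesian product of crystal skeletons for a finite family of disjoint
intervals.  It sends a family of tableaux to its lift. -/
theorem exists_embedding [Fintype ι] (T : SYT lam) {n : ℕ} (hn : lam.card ≤ n) {m : ι → ℕ}
    (hab : ∀ k, 1 ≤ a k ∧ b k ≤ lam.card)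
    (hdisj : ∀ k l, k ≠ l → Disjoint (Set.Icc (a k) (b k)) (Set.Icc (a l) (b l)))
    (hjdt : ∀ k, IsJdtShape T (a k) (b k) (mu k)) (hm : ∀ k, (mu k).card ≤ m k) :
    ∃ psi : (∀ k, SYT (mu k)) → SYT lam,
      Function.Injective psi ∧ T ∈ Set.range psi ∧
      (∀ (S S' : ∀ k, SYT (mu k)) (k : ι), (∀ l, l ≠ k → S' l = S l) →
        CSEdge (m k) (S k) (S' k) → CSEdge n (psi S) (psi S')) ∧
      (∀ (S S' : ∀ k, SYT (mu k)) (k : ι) (i j : ℕ), 1 ≤ i → j ≤ (mu k).card →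
        (((∀ l, l ≠ k → S' l = S l) ∧ CSLabeledEdge (m k) (S k) i j (S' k)) ↔
          CSLabeledEdge n (psi S) (i + (a k - 1)) (j + (a k - 1)) (psi S'))) := by
  choose hcard S₀ hS₀ using fun k => (hjdt k).exists_knuthEq (hab k).1 (hab k).2
  choose K hbij hword hperm hmove using fun k => (hS₀ k).exists_bijective
  have hK : IsTransport a b mu K := by
    refine ⟨?_, fun k => (hab k).1, hcard, hbij, hperm, hmove⟩
    intro k l hkl x h1 h2 h3
    exact Set.disjoint_left.1 (hdisj k l hkl) ⟨h1, h2⟩ h3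
  have h₀ : IsLift T a b mu K S₀ T := ⟨fun _ _ _ => Iff.rfl, fun _ _ _ => rfl, hword⟩
  choose psi hpsi using exists_isLift hK h₀
  refine ⟨psi, ?_, ⟨S₀, (hpsi S₀).unique hK h₀⟩, ?_, ?_⟩
  · intro S S' h
    funext k
    exact (hpsi S).family_eq (hpsi S') (by rw [h])
  · intro S S' k hS h
    obtain ⟨i, p, hp, hd⟩ := exists_dyckMove_of_csEdge h
    obtain ⟨hi, hip⟩ := hd.bound (S k).rowWord_perm
    exact csEdge_of_dyckMove hn hp (((hpsi S).dyckMove_iff hK (hpsi S') hi hip).2 ⟨hS, hd⟩)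
  · intro S S' k i j hi hj
    rw [csLabeledEdge_iff (hm k), csLabeledEdge_iff hn]
    constructor
    · rintro ⟨hS, p, hp, rfl, hd⟩
      exact ⟨p, hp, by omega, ((hpsi S).dyckMove_iff hK (hpsi S') hi hj).2 ⟨hS, hd⟩⟩
    · rintro ⟨p, hp, hjp, hd⟩
      obtain rfl : j = i + 2 * p := by omega
      obtain ⟨hS, hd⟩ := ((hpsi S).dyckMove_iff hK (hpsi S') hi hj).1 hd
      exact ⟨hS, p, hp, rfl, hd⟩

end CrystalSkeleton

theorem mainTheorem4 {lam : YoungDiagram} (T : SYT lam) (n : ℕ) (hn : lam.card ≤ n) :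
    -- one interval
    (∀ (a b : ℕ) (mu : YoungDiagram) (m : ℕ), 1 ≤ a → a ≤ b → b ≤ lam.card →
      IsJdtShape T a b mu → mu.card ≤ m →
      ∃ psi : SYT mu → SYT lam,
        Function.Injective psi ∧ T ∈ Set.range psi ∧
        (∀ S S' : SYT mu, CSEdge m S S' → CSEdge n (psi S) (psi S')) ∧
        (∀ (S S' : SYT mu) (i j : ℕ), 1 ≤ i → j ≤ mu.card →
          (CSLabeledEdge m S i j S' ↔
            CSLabeledEdge n (psi S) (i + (a - 1)) (j + (a - 1)) (psi S')))) ∧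
    -- several disjoint intervals, with the Cartesian product of crystal skeletons
    (∀ (N : ℕ) (a b : Fin N → ℕ) (mu : Fin N → YoungDiagram) (m : Fin N → ℕ), 0 < N →
      (∀ k, 1 ≤ a k ∧ a k ≤ b k ∧ b k ≤ lam.card) →
      (∀ k l, k ≠ l → Disjoint (Set.Icc (a k) (b k)) (Set.Icc (a l) (b l))) →
      (∀ k, IsJdtShape T (a k) (b k) (mu k)) → (∀ k, (mu k).card ≤ m k) →
      ∃ psi : (∀ k, SYT (mu k)) → SYT lam,
        Function.Injective psi ∧ T ∈ Set.range psi ∧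
        (∀ (S S' : ∀ k, SYT (mu k)) (k : Fin N), (∀ l, l ≠ k → S' l = S l) →
          CSEdge (m k) (S k) (S' k) → CSEdge n (psi S) (psi S')) ∧
        (∀ (S S' : ∀ k, SYT (mu k)) (k : Fin N) (i j : ℕ), 1 ≤ i → j ≤ (mu k).card →
          (((∀ l, l ≠ k → S' l = S l) ∧ CSLabeledEdge (m k) (S k) i j (S' k)) ↔
            CSLabeledEdge n (psi S) (i + (a k - 1)) (j + (a k - 1)) (psi S')))) := by
  refine ⟨?_, ?_⟩
  · intro a b mu m ha _ hb hjdt hm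
    -- a single interval is a family of intervals indexed by `Unit`
    obtain ⟨psi, hinj, ⟨S₀, hS₀⟩, hedge, hlabel⟩ :=
      exists_embedding (ι := Unit) (a := fun _ => a) (b := fun _ => b) (mu := fun _ => mu)
        (m := fun _ => m) T hn (fun _ => ⟨ha, hb⟩) (fun k l h => absurd (Subsingleton.elim k l) h)
        (fun _ => hjdt) (fun _ => hm)
    refine ⟨fun S => psi fun _ => S, fun S S' h => congrFun (hinj h) (), ⟨S₀ (), hS₀⟩, ?_, ?_⟩
    · intro S S' h
      exact hedge _ _ () (fun l hl => absurd rfl hl) h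
    · intro S S' i j hi hj
      rw [← hlabel (fun _ => S) (fun _ => S') () i j hi hj]
      exact ⟨fun h => ⟨fun l hl => absurd rfl hl, h⟩, fun h => h.2⟩
  · intro N a b mu m _ hab hdisj hjdt hm
    exact exists_embedding T hn (fun k => ⟨(hab k).1, (hab k).2.2⟩) hdisj hjdt hm
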